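/- Let $p$ be a prime, $K$ a field of characteristic $p$, and $R=\bigoplus_{n\ge 0}R_n$ a standard graded $K$-algebra (that is, $R$ is a commutative graded ring with $R_0=K$, $\dim_K R_1<\infty$ and $R=K[R_1]$) which is $F$-finite, i.e. a finitely generated module over itself via the Frobenius map. Let $\mathfrak m=\bigoplus_{n\ge1}R_n$ and $d=\dim R$. For $i\in\mathbb N$ let $H^i_{\mathfrak m}(R)$ be the $i$-th local cohomology module, i.e. the $i$-th cohomology of the Čech complex of $R$ on any finite system of homogeneous generators of $\mathfrak m$, with its natural $\mathbb Z$-grading; if it is nonzero, put $a_i(R)=\max\{\alpha\in\mathbb Z \mid H^i_{\mathfrak m}(R)_\alpha\neq 0\}$. For $e\in\mathbb N$ let $\mathfrak m^{[p^e]}$ be the ideal generated by the $p^e$-th powers of the elements of $\mathfrak m$, let $\nu(p^e)=\max\{r\in\mathbb N \mid \mathfrak m^r\not\subseteq\mathfrak m^{[p^e]}\}$, and put $c^{\mathfrak m}_-(R)=\liminf_{e\to\infty}\nu(p^e)/p^e$. Then $a_d(R)$ is a well-defined integer (that is, $H^d_{\mathfrak m}(R)\neq0$ and the maximum exists), and $$-a_d(R)\le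 c^{\mathfrak m}_-(R).$$ If moreover $R$ is $F$-pure (that is, for every $R$-module $M$ the map $M\to F_*R\otimes_R M$, $m\mapsto 1\otimes m$, is injective, where $F_*R$ is $R$ regarded as an $R$-module via Frobenius), then the limit $c^{\mathfrak m}(R)=\lim_{e\to\infty}\nu(p^e)/p^e$ exists in $\mathbb R$, and for every $i\in\mathbb N$ with $H^i_{\mathfrak m}(R)\neq0$ the maximum defining $a_i(R)$ exists and $$-a_i(R)\le c^{\mathfrak m}(R).$$ -/

import Mathlib

namespace FThreshold

open scoped TensorProduct

universe u v

/-! ### Frobenius: purity -/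

/-- A ring homomorphism `φ : A → B` is pure if `M → B ⊗[A] M`, `m ↦ 1 ⊗ m`, is injective for
every `A`-module `M`, where `B` is an `A`-module through `φ`. -/
def IsPureHom {A : Type u} {B : Type v} [CommRing A] [CommRing B] (φ : A →+* B) : Prop :=
  letI := φ.toAlgebra
  ∀ (M : Type u) [AddCommGroup M] [Module A M],
    Function.Injective (fun m : M => (1 : B) ⊗ₜ[A] m)

/-- `R` is `F`-finite: it is a finite module over itself through the Frobenius map. -/
def IsFFinite (R : Type u) [CommRing R] (p : ℕ) [Fact p.Prime] [CharP R p] : Prop :=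
  (frobenius R p).Finite

/-- `R` is `F`-pure: the Frobenius map is a pure ring homomorphism. -/
def IsFPure (R : Type u) [CommRing R] (p : ℕ) [Fact p.Prime] [CharP R p] : Prop :=
  IsPureHom (frobenius R p)

/-! ### Standard graded algebras -/

/-- A graded `K`-algebra `R = ⨁ 𝒜 n` (`n ≥ 0`) is standard graded if `R₀ = K` (in particular `R`
is nonzero), `R = K[R₁]` and `R₁` is finite dimensional over `K`. -/
structure IsStandardGraded {K : Type v} {R : Type u} [Field K] [CommRing R] [Algebra K R]
    (𝒜 : ℕ → Submodule K R) [GradedAlgebra 𝒜] : Prop where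
  nontrivial : Nontrivial R
  degree_zero : 𝒜 0 = 1
  adjoin_degree_one : Algebra.adjoin K (𝒜 1 : Set R) = ⊤
  finite_degree_one : Module.Finite K (𝒜 1)

/-! ### The Čech complex and local cohomology -/

section Cech

variable {R : Type u} [CommRing R] {n : ℕ}

/-- The localization `R_{f_{s 0} ⋯ f_{s (i-1)}}` for a sequence `s 0 < ⋯ < s (i-1)` of indices. -/
abbrev CechTerm (f : Fin n → R) {i : ℕ} (s : Fin i ↪o Fin n) : Type u :=
  Localization.Away (∏ k, f (s k))

/-- The `i`-th term of the Čech complex of `R` on `f`. -/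
abbrev CechCochain (f : Fin n → R) (i : ℕ) : Type u :=
  ∀ s : Fin i ↪o Fin n, CechTerm f s

/-- Omit the `k`-th entry of an increasing sequence of indices. -/
abbrev dropIndex {i : ℕ} (s : Fin (i + 1) ↪o Fin n) (k : Fin (i + 1)) : Fin i ↪o Fin n :=
  (Fin.succAboveOrderEmb k).trans s

theorem isUnit_of_mem_powers_dropIndex (f : Fin n → R) {i : ℕ} (s : Fin (i + 1) ↪o Fin n)
    (k : Fin (i + 1)) (y : Submonoid.powers (∏ l, f (dropIndex s k l))) :
    IsUnit (Algebra.ofId R (CechTerm f s) y) := by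
  obtain ⟨_, m, rfl⟩ := y
  have h : IsUnit (algebraMap R (CechTerm f s) (∏ l, f (s l))) :=
    IsLocalization.Away.algebraMap_isUnit _
  have hprod : ∏ l, f (s l) = f (s k) * ∏ l, f (dropIndex s k l) :=
    Fin.prod_univ_succAbove _ k
  have h' := congrArg (algebraMap R (CechTerm f s)) hprod
  rw [map_mul] at h'
  have h2 := isUnit_of_mul_isUnit_right (h' ▸ h)
  simpa only [Algebra.ofId_apply, map_pow] using h2.pow m

/-- The localization map `R_{∏ l ≠ k, f (s l)} → R_{∏ l, f (s l)}`. -/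
noncomputable def cechRestrict (f : Fin n → R) {i : ℕ} (s : Fin (i + 1) ↪o Fin n)
    (k : Fin (i + 1)) : CechTerm f (dropIndex s k) →ₐ[R] CechTerm f s :=
  IsLocalization.liftAlgHom (M := Submonoid.powers (∏ l, f (dropIndex s k l)))
    (f := Algebra.ofId R (CechTerm f s)) (isUnit_of_mem_powers_dropIndex f s k)

/-- The Čech differential `(d c)_s = ∑ₖ (-1)ᵏ c_{s without its k-th entry}`. -/
noncomputable def cechDiff (f : Fin n → R) (i : ℕ) :
    CechCochain f i →ₗ[R] CechCochain f (i + 1) :=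
  LinearMap.pi fun s => ∑ k : Fin (i + 1),
    ((-1 : R) ^ (k : ℕ)) • (cechRestrict f s k).toLinearMap ∘ₗ LinearMap.proj (dropIndex s k)

/-- The Čech differentials form a complex. -/
theorem cechDiff_cechDiff (f : Fin n → R) (i : ℕ) (c : CechCochain f i) :
    cechDiff f (i+1) (cechDiff f i c) = 0 := by
  have key : ∀ (s : Fin (i+2) ↪o Fin n) (k : Fin (i+2)) (l : Fin (i+1)),
      ∀ (t : Fin i ↪o Fin n) (h : t = dropIndex (dropIndex s k) l) (φ : CechTerm f t →ₐ[R] CechTerm f s),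
       cechRestrict f s k (cechRestrict f (dropIndex s k) l (c (dropIndex (dropIndex s k) l)))
        = φ (c t) := by
    intro s k l t h φ
    subst h
    have : (cechRestrict f s k).comp (cechRestrict f (dropIndex s k) l) = φ :=
      IsLocalization.algHom_ext (Submonoid.powers (∏ m, f (dropIndex (dropIndex s k) l m))) (by ext)
    rw [← this]; rfl
  funext s
  simp only [cechDiff, LinearMap.pi_apply, LinearMap.sum_apply, LinearMap.smul_apply, LinearMap.comp_apply, LinearMap.proj_apply, AlgHom.toLinearMap_apply, map_sum, map_smul, Pi.zero_apply, Finset.smul_sum, smul_smul, ← pow_add]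
  rw [← Finset.sum_product']
  apply Finset.sum_involution (fun (x : Fin (i+2) × Fin (i+1)) _ => (x.1.succAbove x.2, x.2.predAbove x.1))
  · rintro ⟨k, l⟩ -
    have hd : dropIndex (dropIndex s k) l = dropIndex (dropIndex s (k.succAbove l)) (l.predAbove k) := by
      ext x
      simp only [dropIndex, RelEmbedding.trans_apply, Fin.succAboveOrderEmb_apply]
      congr 2
      exact (Fin.succAbove_succAbove_succAbove_predAbove k l x).symm
    rw [key s k l _ hd.symm ((cechRestrict f s _).comp (cechRestrict f _ _))]
    simp only [AlgHom.comp_apply]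
    rw [← add_smul]
    convert zero_smul R _
    have : ((k.succAbove l : ℕ) + (l.predAbove k : ℕ)) % 2 ≠ (k + l : ℕ) % 2 := by
      rcases Fin.lt_or_ge l.castSucc k with h | h
      · rw [Fin.succAbove_of_castSucc_lt _ _ h, Fin.predAbove_of_castSucc_lt _ _ h]
        simp [Fin.lt_def] at h ⊢; omega
      · rw [Fin.succAbove_of_le_castSucc _ _ h, Fin.predAbove_of_le_castSucc _ _ h]
        simp [Fin.le_def] at h ⊢; omega
    rcases Nat.even_or_odd (k + l : ℕ) with h | h
    · have h' : Odd ((k.succAbove l : ℕ) + (l.predAbove k : ℕ)) := by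
        rw [Nat.even_iff] at h; rw [Nat.odd_iff]; omega
      rw [h.neg_one_pow, h'.neg_one_pow]; ring
    · have h' : Even ((k.succAbove l : ℕ) + (l.predAbove k : ℕ)) := by
        rw [Nat.odd_iff] at h; rw [Nat.even_iff]; omega
      rw [h.neg_one_pow, h'.neg_one_pow]; ring
  · rintro ⟨k, l⟩ - _ h
    simp at h
  · simp
  · rintro ⟨k, l⟩ -
    simp [Fin.succAbove_succAbove_predAbove, Fin.predAbove_predAbove_succAbove]

/-- The `i`-cocycles of the Čech complex. -/
noncomputable def cechCocycles (f : Fin n → R) (i : ℕ) : Submodule R (CechCochain f i) :=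
  LinearMap.ker (cechDiff f i)

/-- The `i`-coboundaries of the Čech complex; there are none but `0` for `i = 0`. -/
noncomputable def cechCoboundaries (f : Fin n → R) :
    ∀ i : ℕ, Submodule R (CechCochain f i)
  | 0 => ⊥
  | i + 1 => LinearMap.range (cechDiff f i)

/-- The `i`-th local cohomology of `R` with support in the ideal generated by `f`: the `i`-th
cohomology of the Čech complex on `f`. -/
abbrev LocalCohomology (f : Fin n → R) (i : ℕ) : Type u :=
  cechCocycles f i ⧸ (cechCoboundaries f i).submoduleOf (cechCocycles f i)

end Cech

/-! ### The grading of local cohomology -/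

section Graded

variable {K : Type v} {R : Type u} [Field K] [CommRing R] [Algebra K R]

/-- The grading of `R` extended by `0` to negative degrees. -/
def intPiece (𝒜 : ℕ → Submodule K R) : ℤ → Submodule K R
  | Int.ofNat a => 𝒜 a
  | Int.negSucc _ => ⊥

theorem mul_mem_intPiece (𝒜 : ℕ → Submodule K R) [GradedAlgebra 𝒜] {α : ℤ} {b : ℕ} {r s : R}
    (hr : r ∈ intPiece 𝒜 α) (hs : s ∈ 𝒜 b) : r * s ∈ intPiece 𝒜 (α + b) := by
  cases α with
  | ofNat a => exact SetLike.mul_mem_graded (A := 𝒜) hr hs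
  | negSucc a =>
    have h : r = 0 := hr
    simp [h]

/-- The degree `α` part of the localization `R_g` (for `g` homogeneous): the fractions `r / s` with
`s` a power of `g` of some degree `b` and `r` homogeneous of degree `α + b`. -/
def localizationPiece (𝒜 : ℕ → Submodule K R) [GradedAlgebra 𝒜] (g : R) (α : ℤ) :
    AddSubgroup (Localization.Away g) where
  carrier := {x | ∃ (b : ℕ) (r : R) (s : Submonoid.powers g),
    (s : R) ∈ 𝒜 b ∧ r ∈ intPiece 𝒜 (α + b) ∧ x = Localization.mk r s}
  zero_mem' := ⟨0, 0, 1, SetLike.GradedOne.one_mem, Submodule.zero_mem _,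
    (Localization.mk_zero _).symm⟩
  neg_mem' := by
    rintro _ ⟨b, r, s, hs, hr, rfl⟩
    exact ⟨b, -r, s, hs, Submodule.neg_mem _ hr, Localization.neg_mk r s⟩
  add_mem' := by
    rintro _ _ ⟨b, r, s, hs, hr, rfl⟩ ⟨b', r', s', hs', hr', rfl⟩
    refine ⟨b + b', s * r' + s' * r, s * s', SetLike.mul_mem_graded hs hs', ?_,
      Localization.add_mk r s r' s'⟩
    refine Submodule.add_mem _ ?_ ?_
    · have h := mul_mem_intPiece 𝒜 hr' hs
      rw [mul_comm, show α + ((b + b' : ℕ) : ℤ) = α + b' + b by push_cast; ring]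
      exact h
    · have h := mul_mem_intPiece 𝒜 hr hs'
      rw [mul_comm, show α + ((b + b' : ℕ) : ℤ) = α + b + b' by push_cast; ring]
      exact h

/-- The Čech cocycles all of whose components are homogeneous of degree `α`. -/
noncomputable def homogeneousCocycles (𝒜 : ℕ → Submodule K R) [GradedAlgebra 𝒜] {n : ℕ} (f : Fin n → R)
    (i : ℕ) (α : ℤ) : AddSubgroup (cechCocycles f i) :=
  AddSubgroup.comap (cechCocycles f i).subtype.toAddMonoidHom
    (AddSubgroup.pi Set.univ fun s => localizationPiece 𝒜 (∏ k, f (s k)) α)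

/-- The degree `α` part of the `i`-th local cohomology: the classes of the homogeneous cocycles of
degree `α`. -/
noncomputable def localCohomologyPiece (𝒜 : ℕ → Submodule K R) [GradedAlgebra 𝒜] {n : ℕ} (f : Fin n → R)
    (i : ℕ) (α : ℤ) : AddSubgroup (LocalCohomology f i) :=
  AddSubgroup.map
    ((cechCoboundaries f i).submoduleOf (cechCocycles f i)).mkQ.toAddMonoidHom
    (homogeneousCocycles 𝒜 f i α)

/-- The integer `a` is the `aᵢ`-invariant of `R`: the largest degree in which the `i`-th local
cohomology is nonzero. It is computed on homogeneous generators `f` of the irrelevant ideal. -/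
def IsAInvariant (𝒜 : ℕ → Submodule K R) [GradedAlgebra 𝒜] {n : ℕ} (f : Fin n → R)
    (i : ℕ) (a : ℤ) : Prop :=
  IsGreatest {α : ℤ | localCohomologyPiece 𝒜 f i α ≠ ⊥} a

/-! ### Diagonal `F`-thresholds -/

/-- The irrelevant ideal `𝔪`. -/
abbrev irrelevantIdeal (𝒜 : ℕ → Submodule K R) [GradedAlgebra 𝒜] : Ideal R :=
  (HomogeneousIdeal.irrelevant 𝒜).toIdeal

/-- `ν(pᵉ)`, the largest `r` such that `𝔪 ^ r` is not contained in the ideal `𝔪^[pᵉ]` generated by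
the `pᵉ`-th powers of the elements of `𝔪`. -/
noncomputable def nu (𝒜 : ℕ → Submodule K R) [GradedAlgebra 𝒜] (p : ℕ) [Fact p.Prime] [CharP R p]
    (e : ℕ) : ℕ :=
  sSup {r : ℕ |
    ¬ irrelevantIdeal 𝒜 ^ r ≤ (irrelevantIdeal 𝒜).map (iterateFrobenius R p e)}

/-- The lower diagonal `F`-threshold, `liminf ν(pᵉ) / pᵉ`. -/
noncomputable def lowerDiagonalFThreshold (𝒜 : ℕ → Submodule K R) [GradedAlgebra 𝒜] (p : ℕ)
    [Fact p.Prime] [CharP R p] : EReal :=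
  Filter.liminf (fun e : ℕ => (((nu 𝒜 p e : ℝ) / (p : ℝ) ^ e : ℝ) : EReal)) Filter.atTop

/-- The real number `c` is the diagonal `F`-threshold: the sequence `ν(pᵉ) / pᵉ` converges
to `c`. -/
def IsDiagonalFThreshold (𝒜 : ℕ → Submodule K R) [GradedAlgebra 𝒜] (p : ℕ)
    [Fact p.Prime] [CharP R p] (c : ℝ) : Prop :=
  Filter.Tendsto (fun e : ℕ => (nu 𝒜 p e : ℝ) / (p : ℝ) ^ e) Filter.atTop (nhds c)

end Graded

end FThreshold

/-! Write q = pᵉ. Frobenius acts on H = Hⁱ_𝔪(R); its e-th iterate F is semilinear over r ↦ r^q and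
multiplies degrees by q. Since R is generated in degree one, every form of degree greater than ν(q)
lies in 𝔪^[q] (`mem_map_of_nu_lt`). Both inequalities play this fact against the top degree a of H.

For i = d, the functor H^d is right exact on finitely generated modules, because H^{d+1} vanishes on
them. A surjection from a finite free module onto R viewed through F therefore shows that H is
spanned over R by the image of F (`exists_eq_sum_localCohomologyHom`). Suppose ν(q) < a - qa. An
element of degree a is a sum of terms r F(y) with y of degree β ≤ a and r of degree a - qβ ≥ a - qa.
Such an r lies in 𝔪^[q], and s m^q F(y) = s F(my) replaces y by elements of larger degree. Repeating
this pushes β above a, where H vanishes, so H_a = 0 (`eq_bot_of_span`), a contradiction. Hence a -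
qa ≤ ν(q) for all e; divide by q and let e grow.

If R is F-pure, ideals are contracted from their Frobenius powers, so ν(pᵉ)/pᵉ increases to a limit
c, and Frobenius is injective on every Hⁱ (`localCohomologyHom_injective`). Let x have the top
degree a, so that 𝔪x = 0 and 𝔪^[pʲ] kills Fʲx, where F now denotes Frobenius itself. Then R Fʲx
lives in degrees at most pʲa + ν(pʲ) ≤ pʲ(a + c), which tends to -∞ if a + c < 0. But H is Artinian,
so Fᵉx lies in the span of the Fʲx with j arbitrarily large once e is large. Thus Fᵉx = 0 and x = 0
(`eq_zero_of_injective`).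

The top degree exists because H is Artinian (`isArtinian_HM`), and H^d ≠ 0 by Grothendieck's theorem
(`nontrivial_HM_quotient`), which needs ht 𝔪 = dim R (`height_irrelevantIdeal`). These facts are
proved for the Čech complex with module coefficients: its terms are flat, which gives long exact
sequences, and its cohomology is torsion for each f j. Prime filtrations then reduce Artinianness
and vanishing to the modules R/p. -/

namespace FThreshold

open scoped TensorProduct

universe u v w

/-! ### Heights of primes and their homogeneous cores; the height of the irrelevant ideal. -/

section Dimension

open Polynomial DirectSum

variable {K : Type v} {R : Type u} [Field K] [CommRing R] [Algebra K R]
  (𝒜 : ℕ → Submodule K R) [GradedAlgebra 𝒜]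

/-- The ring homomorphism `R → B[X]`, `r ↦ ∑ φ(rₙ) Xⁿ`, attached to a ring homomorphism
`φ : R → B` on a graded ring `R`. -/
noncomputable def coaction {B : Type w} [CommRing B] (φ : R →+* B) : R →+* B[X] :=
  (DirectSum.toSemiring
    (fun n => (monomial n : B →ₗ[B] B[X]).toAddMonoidHom.comp
      (φ.toAddMonoidHom.comp (𝒜 n).subtype.toAddMonoidHom))
    (by
      change monomial 0 (φ (1 : R)) = 1
      rw [map_one, monomial_zero_one])
    (by
      intro i j a b
      change monomial (i + j) (φ ((a : R) * b)) = monomial i (φ a) * monomial j (φ b)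
      rw [map_mul, monomial_mul_monomial])).comp
  (decomposeRingEquiv 𝒜).toRingHom

theorem coaction_of_mem {B : Type w} [CommRing B] (φ : R →+* B) {n : ℕ} {r : R} (hr : r ∈ 𝒜 n) :
    coaction 𝒜 φ r = monomial n (φ r) := by
  rw [coaction, RingHom.comp_apply]
  change DirectSum.toSemiring _ _ _ (decompose 𝒜 r) = _
  rw [decompose_of_mem _ hr, toSemiring_of]
  rfl

theorem coeff_coaction {B : Type w} [CommRing B] (φ : R →+* B) (r : R) (n : ℕ) :
    (coaction 𝒜 φ r).coeff n = φ (decompose 𝒜 r n) := by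
  classical
  induction r using DirectSum.Decomposition.inductionOn 𝒜 with
  | zero => simp
  | homogeneous r =>
    rename_i i
    rw [coaction_of_mem 𝒜 φ r.2, coeff_monomial, decompose_coe, coe_of_apply]
    split_ifs <;> simp
  | add r s hr hs => simp [hr, hs]

/-- The coefficients are the classes of the homogeneous components, and P contains an element
exactly when it contains all of these. So R/P embeds in a polynomial ring over the domain R/P, where
degrees can be used. -/
theorem coaction_mk_eq_zero_iff {P : Ideal R} (hP : P.IsHomogeneous 𝒜) (r : R) :
    coaction 𝒜 (Ideal.Quotient.mk P) r = 0 ↔ r ∈ P := by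
  rw [Polynomial.ext_iff]
  simp only [coeff_coaction, coeff_zero, Ideal.Quotient.eq_zero_iff_mem]
  refine ⟨fun h => ?_, fun h n => hP n h⟩
  classical
  rw [← DirectSum.sum_support_decompose 𝒜 r]
  exact P.sum_mem fun n _ => h n

/-- Division with remainder in a graded ring, modulo a homogeneous prime. -/
theorem exists_width_lt {P : Ideal R} [P.IsPrime] (hP : P.IsHomogeneous 𝒜) {g v : R}
    (hg : g ∉ P) (hv : v ∉ P)
    (hw : (coaction 𝒜 (Ideal.Quotient.mk P) g).natDegree +
        (coaction 𝒜 (Ideal.Quotient.mk P) v).natTrailingDegree ≤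
      (coaction 𝒜 (Ideal.Quotient.mk P) v).natDegree +
        (coaction 𝒜 (Ideal.Quotient.mk P) g).natTrailingDegree) :
    ∃ s a : R, SetLike.IsHomogeneousElem 𝒜 s ∧ s ∉ P ∧ (s * v - a * g ∈ P ∨
      (coaction 𝒜 (Ideal.Quotient.mk P) (s * v - a * g)).natDegree +
        (coaction 𝒜 (Ideal.Quotient.mk P) v).natTrailingDegree <
      (coaction 𝒜 (Ideal.Quotient.mk P) v).natDegree +
        (coaction 𝒜 (Ideal.Quotient.mk P) (s * v - a * g)).natTrailingDegree) := by
  set ρ := coaction 𝒜 (Ideal.Quotient.mk P) with hρ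
  have hg0 : ρ g ≠ 0 := fun h => hg ((coaction_mk_eq_zero_iff 𝒜 hP g).1 h)
  have hv0 : ρ v ≠ 0 := fun h => hv ((coaction_mk_eq_zero_iff 𝒜 hP v).1 h)
  set m := (ρ g).natDegree
  set k := (ρ v).natDegree
  have hlg : Ideal.Quotient.mk P (decompose 𝒜 g m : R) = (ρ g).leadingCoeff :=
    (coeff_coaction 𝒜 _ g m).symm
  have hlv : Ideal.Quotient.mk P (decompose 𝒜 v k : R) = (ρ v).leadingCoeff :=
    (coeff_coaction 𝒜 _ v k).symm
  -- Cross-multiplying by the components of `g` and `v` that lead modulo P cancels the terms of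
  -- degree m + k.
  refine ⟨decompose 𝒜 g m, decompose 𝒜 v k, ⟨m, SetLike.coe_mem _⟩, fun h => ?_, ?_⟩
  · rw [Ideal.Quotient.eq_zero_iff_mem.2 h] at hlg
    exact hg0 (leadingCoeff_eq_zero.1 hlg.symm)
  · rw [or_iff_not_imp_left]
    intro hne
    set r := (decompose 𝒜 g m : R) * v - (decompose 𝒜 v k : R) * g with hr
    have hr0 : ρ r ≠ 0 := fun h => hne ((coaction_mk_eq_zero_iff 𝒜 hP r).1 h)
    have hρr : ρ r = monomial m (ρ g).leadingCoeff * ρ v - monomial k (ρ v).leadingCoeff * ρ g := by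
      rw [hr, map_sub, map_mul, map_mul, hρ, coaction_of_mem 𝒜 _ (SetLike.coe_mem _),
        coaction_of_mem 𝒜 _ (SetLike.coe_mem _), ← hρ, hlg, hlv]
    have hdeg : (ρ r).natDegree < m + k := by
      have h1 : (ρ r).natDegree ≤ m + k := by
        rw [hρr]
        refine (natDegree_sub_le_of_le (m := m + k) (n := m + k) ?_ ?_).trans (max_self _).le
        · exact natDegree_mul_le_of_le (natDegree_monomial_le _) le_rfl
        · rw [add_comm]; exact natDegree_mul_le_of_le (natDegree_monomial_le _) le_rfl
      refine lt_of_le_of_ne h1 fun h2 => hr0 ?_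
      rw [← leadingCoeff_eq_zero, leadingCoeff, h2, hρr, coeff_sub]
      nth_rewrite 2 [add_comm m k]
      rw [← C_mul_X_pow_eq_monomial, ← C_mul_X_pow_eq_monomial, mul_assoc, mul_assoc, coeff_C_mul,
        coeff_C_mul, add_comm m k, coeff_X_pow_mul, add_comm k m, coeff_X_pow_mul]
      simp only [leadingCoeff]
      change _ * (ρ v).coeff k - _ * (ρ g).coeff m = 0
      ring
    have htr : min (m + (ρ v).natTrailingDegree) (k + (ρ g).natTrailingDegree) ≤
        (ρ r).natTrailingDegree := by
      refine le_natTrailingDegree hr0 fun j hj => ?_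
      rw [lt_min_iff] at hj
      have aux : ∀ (l : ℕ) (c : R ⧸ P) (q : (R ⧸ P)[X]), j < l + q.natTrailingDegree →
          (monomial l c * q).coeff j = 0 := by
        intro l c q h
        rw [← C_mul_X_pow_eq_monomial, mul_assoc, coeff_C_mul, coeff_X_pow_mul']
        split_ifs with h'
        · rw [coeff_eq_zero_of_lt_natTrailingDegree (by omega), mul_zero]
        · rw [mul_zero]
      rw [hρr, coeff_sub, aux _ _ _ hj.1, aux _ _ _ hj.2, sub_zero]
    have := natTrailingDegree_le_natDegree (ρ r)
    rcases min_le_iff.1 htr with h | h <;> omega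

/-- Two primes `P < Q` not containing homogeneous elements outside a homogeneous prime `P₀`
satisfy `P = P₀`. -/
theorem eq_of_homogeneousCore_eq {P₀ P Q : Ideal R} [P₀.IsPrime] [P.IsPrime] [Q.IsPrime]
    (h0 : P₀.IsHomogeneous 𝒜) (h0P : P₀ ≤ P) (hPQ : P < Q)
    (hQ : ∀ s ∈ Q, SetLike.IsHomogeneousElem 𝒜 s → s ∈ P₀) : P ≤ P₀ := by
  classical
  by_contra hP
  set ρ := coaction 𝒜 (Ideal.Quotient.mk P₀) with hρ
  have hz : ∀ r, ρ r = 0 ↔ r ∈ P₀ := coaction_mk_eq_zero_iff 𝒜 h0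
  -- The width, top degree minus bottom degree modulo P₀, is a Euclidean function: inverting the
  -- homogeneous elements outside P₀ turns R/P₀ into a field or a Laurent polynomial ring over a
  -- field.
  set W : R → ℕ := fun r => (ρ r).natDegree - (ρ r).natTrailingDegree with hW
  have htd : ∀ r, (ρ r).natTrailingDegree ≤ (ρ r).natDegree := fun r =>
    natTrailingDegree_le_natDegree _
  have hWmul : ∀ r s, r ∉ P₀ → s ∉ P₀ → W (r * s) = W r + W s := by
    intro r s hr hs
    have hr' : ρ r ≠ 0 := fun h => hr ((hz r).1 h)
    have hs' : ρ s ≠ 0 := fun h => hs ((hz s).1 h)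
    have := htd r; have := htd s
    simp only [hW]
    rw [map_mul, natDegree_mul hr' hs', natTrailingDegree_mul hr' hs']
    omega
  have hWhom : ∀ s, SetLike.IsHomogeneousElem 𝒜 s → s ∉ P₀ → W s = 0 := by
    rintro s ⟨n, hs⟩ hs0
    have : Ideal.Quotient.mk P₀ s ≠ 0 := fun h => hs0 (Ideal.Quotient.eq_zero_iff_mem.1 h)
    simp only [hW]
    rw [hρ, coaction_of_mem 𝒜 _ hs, natDegree_monomial_eq _ this, natTrailingDegree_monomial this]
    omega
  have hWcongr : ∀ r s, r - s ∈ P₀ → W r = W s := by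
    intro r s h
    have : ρ r = ρ s := by rw [← sub_eq_zero, ← map_sub, hz]; exact h
    simp only [hW, this]
  have hex : ∃ w, ∃ g ∈ Q, g ∉ P ∧ g ∉ P₀ ∧ W g = w := by
    obtain ⟨g, hgQ, hgP⟩ := SetLike.exists_of_lt hPQ
    exact ⟨_, g, hgQ, hgP, fun h => hgP (h0P h), rfl⟩
  have hex' : ∃ w, ∃ g ∈ Q, g ∉ P₀ ∧ W g = w := by
    obtain ⟨w, g, h1, _, h2, h3⟩ := hex
    exact ⟨w, g, h1, h2, h3⟩
  -- An element of minimal width generates Q modulo P₀, up to multiplication by homogeneous elements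
  -- outside P₀.
  obtain ⟨g, hgQ, hg0, hgw⟩ := Nat.find_spec hex'
  have hmin : ∀ v ∈ Q, v ∉ P₀ → W g ≤ W v := fun v hv hv0 => by
    rw [hgw]; exact Nat.find_min' hex' ⟨v, hv, hv0, rfl⟩
  have hdiv : ∀ n, ∀ v ∈ Q, W v = n →
      ∃ s a, SetLike.IsHomogeneousElem 𝒜 s ∧ s ∉ P₀ ∧ s * v - a * g ∈ P₀ := by
    intro n
    induction n using Nat.strong_induction_on with
    | _ n ih =>
      intro v hv hn
      by_cases hv0 : v ∈ P₀
      · refine ⟨1, 0, ⟨0, SetLike.GradedOne.one_mem⟩, (Ideal.ne_top_iff_one _).1 Ideal.IsPrime.ne_top', by simpa⟩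
      have hle := hmin v hv hv0
      obtain ⟨s, a, hs, hs0, h⟩ := exists_width_lt 𝒜 h0 hg0 hv0 (by
        have := htd g; have := htd v
        simp only [hW, hρ] at *
        omega)
      rcases h with h | h
      · exact ⟨s, a, hs, hs0, h⟩
      · obtain ⟨s', a', hs', hs0', h'⟩ := ih (W (s * v - a * g)) (by
            have := htd v
            have := htd (s * v - a * g)
            simp only [hW, hρ] at *
            omega)
          (s * v - a * g) (Q.sub_mem (Q.mul_mem_left _ hv) (Q.mul_mem_left _ hgQ)) rfl
        refine ⟨s' * s, s' * a + a', SetLike.IsHomogeneousElem.mul hs' hs, fun h => ?_, ?_⟩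
        · rcases Ideal.IsPrime.mem_or_mem ‹_› h with h | h <;> contradiction
        · convert h' using 1; ring
  have hsP : ∀ s, SetLike.IsHomogeneousElem 𝒜 s → s ∉ P₀ → s ∉ P := fun s hs hs0 h =>
    hs0 (hQ s (hPQ.le h) hs)
  have hgP : g ∉ P := by
    intro hgP
    refine hPQ.not_ge fun v hv => ?_
    obtain ⟨s, a, hs, hs0, h⟩ := hdiv _ v hv rfl
    have : s * v ∈ P := by
      have := P.add_mem (h0P h) (P.mul_mem_left a hgP)
      simpa using this
    exact (Ideal.IsPrime.mem_or_mem ‹_› this).resolve_left (hsP s hs hs0)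
  -- Width zero would make g congruent modulo P₀ to one of its components, a homogeneous element of
  -- Q and hence an element of P₀.
  have hwpos : W g ≠ 0 := by
    intro h
    apply hg0
    apply hQ g hgQ
    have hg' : ρ g ≠ 0 := fun h => hg0 ((hz g).1 h)
    by_contra hnh
    have hmono : ρ g = monomial (ρ g).natDegree (ρ g).leadingCoeff := by
      ext j
      rw [coeff_monomial]
      split_ifs with hj
      · rw [← hj]; rfl
      · rcases lt_or_gt_of_ne hj with hj | hj
        · exact coeff_eq_zero_of_natDegree_lt hj
        · refine coeff_eq_zero_of_lt_natTrailingDegree ?_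
          have := htd g
          simp only [hW] at h
          omega
    set k := (ρ g).natDegree
    have hsub : g - (decompose 𝒜 g k : R) ∈ P₀ := by
      rw [← hz, map_sub, sub_eq_zero, hρ, coaction_of_mem 𝒜 _ (SetLike.coe_mem _), ← hρ,
        ← coeff_coaction, ← hρ]
      exact hmono
    have hk : (decompose 𝒜 g k : R) ∈ Q := by
      have := Q.sub_mem hgQ (hPQ.le (h0P hsub))
      simpa using this
    have := P₀.add_mem hsub (hQ _ hk ⟨k, SetLike.coe_mem _⟩)
    rw [sub_add_cancel] at this
    exact hg0 this
  have hexP : ∃ w, ∃ v ∈ P, v ∉ P₀ ∧ W v = w := by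
    obtain ⟨v, hv, hv0⟩ := SetLike.not_le_iff_exists.1 hP
    exact ⟨_, v, hv, hv0, rfl⟩
  -- Dividing an element v of minimal width in P by g gives a cofactor `a`, still in P and not in
  -- P₀, of width W v - W g < W v.
  obtain ⟨v, hvP, hv0, hvw⟩ := Nat.find_spec hexP
  obtain ⟨s, a, hs, hs0, h⟩ := hdiv _ v (hPQ.le hvP) rfl
  have hag : a * g ∈ P := by
    have := P.sub_mem (P.mul_mem_left s hvP) (h0P h)
    simpa using this
  have haP : a ∈ P := (Ideal.IsPrime.mem_or_mem ‹_› hag).resolve_right hgP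
  have ha0 : a ∉ P₀ := by
    intro ha0
    have : s * v ∈ P₀ := by
      have := P₀.add_mem h (P₀.mul_mem_right g ha0)
      simpa using this
    rcases Ideal.IsPrime.mem_or_mem ‹_› this with h | h <;> contradiction
  have h1 := hWcongr _ _ h
  rw [hWmul _ _ hs0 hv0, hWmul _ _ ha0 hg0, hWhom s hs hs0] at h1
  have h2 := Nat.find_min' hexP ⟨a, haP, ha0, rfl⟩
  omega

/-- This is ht Q ≤ ht Q* + 1 for the homogeneous core Q*. Take a prime P < Q of height at least n +
1. If P is homogeneous, it lies in Q*. Otherwise P* ≠ Q* by `eq_of_homogeneousCore_eq`, and the step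
from P* to Q* supplies the missing unit of height. -/
theorem height_le_height_homogeneousCore_add_one [IsNoetherianRing R] (n : ℕ) (Q : Ideal R)
    [Q.IsPrime] (hn : n < Q.height) : n ≤ (Q.homogeneousCore 𝒜).toIdeal.height := by
  induction n generalizing Q with
  | zero => simp
  | succ n ih =>
    have : ¬ Q.height ≤ (n + 1 : ℕ) := not_le.2 hn
    rw [Ideal.height_le_iff] at this
    push Not at this
    obtain ⟨P, hP, hPQ, hPn⟩ := this
    have hcP : (P.homogeneousCore 𝒜).toIdeal.IsPrime := hP.homogeneousCore
    have hcQ : (Q.homogeneousCore 𝒜).toIdeal.IsPrime := Ideal.IsPrime.homogeneousCore ‹_›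
    have hle : (P.homogeneousCore 𝒜).toIdeal ≤ (Q.homogeneousCore 𝒜).toIdeal :=
      Ideal.homogeneousCore_mono 𝒜 hPQ.le
    by_cases hPh : P ≤ (P.homogeneousCore 𝒜).toIdeal
    · exact hPn.trans (Ideal.height_mono (hPh.trans hle))
    · have hne : (P.homogeneousCore 𝒜).toIdeal ≠ (Q.homogeneousCore 𝒜).toIdeal := by
        intro h
        refine hPh (eq_of_homogeneousCore_eq 𝒜 (HomogeneousIdeal.isHomogeneous _)
          (Ideal.toIdeal_homogeneousCore_le 𝒜 P) hPQ fun s hs hs' => ?_)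
        rw [h]
        exact Ideal.mem_homogeneousCore_of_homogeneous_of_mem hs' hs
      have h1 := Ideal.height_add_one_le_of_lt_of_isPrime (lt_of_le_of_ne hle hne)
      have h2 := ih P (lt_of_lt_of_le (by exact_mod_cast Nat.lt_succ_self n) hPn)
      push_cast
      exact (add_le_add_left h2 1).trans h1

/-- If the irrelevant ideal is maximal, its height is the dimension of the ring. -/
theorem height_irrelevantIdeal [IsNoetherianRing R] (hm : (irrelevantIdeal 𝒜).IsMaximal)
    (h0 : ∀ r ∈ 𝒜 0, r ≠ 0 → IsUnit r) {d : ℕ}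
    (hd : ringKrullDim R = d) : (irrelevantIdeal 𝒜).height = d := by
  -- The core Q* lies in 𝔪. If Q is not homogeneous then Q* is strictly smaller than 𝔪, which
  -- absorbs the possible loss of one in passing from Q to Q*.
  have key : ∀ Q : Ideal R, Q.IsPrime → Q.height ≤ (irrelevantIdeal 𝒜).height := by
    intro Q hQ
    have hc : (Q.homogeneousCore 𝒜).toIdeal.IsPrime := hQ.homogeneousCore
    have hcm : (Q.homogeneousCore 𝒜).toIdeal ≤ irrelevantIdeal 𝒜 := by
      intro x hx
      by_contra hx'
      have hx0 : (decompose 𝒜 x 0 : R) ≠ 0 := hx'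
      exact hc.ne_top (Ideal.eq_top_of_isUnit_mem _
        ((Q.homogeneousCore 𝒜).isHomogeneous 0 hx) (h0 _ (SetLike.coe_mem _) hx0))
    by_cases hQc : Q ≤ (Q.homogeneousCore 𝒜).toIdeal
    · exact Ideal.height_mono (hQc.trans hcm)
    have hne : (Q.homogeneousCore 𝒜).toIdeal ≠ irrelevantIdeal 𝒜 := by
      intro h
      refine hQc ?_
      rw [h, hm.eq_of_le hQ.ne_top (h ▸ Ideal.toIdeal_homogeneousCore_le 𝒜 Q)]
    have hh := Ideal.height_add_one_le_of_lt_of_isPrime (lt_of_le_of_ne hcm hne)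
    obtain ⟨k, hk⟩ := ENat.ne_top_iff_exists.1 (Ideal.height_ne_top hQ.ne_top)
    rw [← hk]
    cases k with
    | zero => simp
    | succ k =>
      have := height_le_height_homogeneousCore_add_one 𝒜 k Q (by
        rw [← hk]; exact_mod_cast Nat.lt_succ_self k)
      push_cast
      exact (add_le_add_left this 1).trans hh
  apply le_antisymm
  · have : (((irrelevantIdeal 𝒜).height : ℕ∞) : WithBot ℕ∞) ≤ ringKrullDim R :=
      Ideal.height_le_ringKrullDim_of_isPrime
    rw [hd] at this
    exact_mod_cast this
  · have : ringKrullDim R ≤ ((irrelevantIdeal 𝒜).height : ℕ∞) :=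
      (ringKrullDim_le_iff_height_le _).2 fun Q hQ => by exact_mod_cast key Q hQ
    rw [hd] at this
    exact_mod_cast this

end Dimension

/-! ### Melkersson's criterion for torsion modules to be Artinian. -/

section Melkersson

variable {R M : Type*} [CommRing R] [AddCommGroup M] [Module R M]

theorem exists_stable_of_antitone [IsArtinian R M] (N : ℕ → Submodule R M) (hN : Antitone N) :
    ∃ n, ∀ m, n ≤ m → N m = N n := by
  obtain ⟨n, hn⟩ := IsArtinian.monotone_stabilizes
    (⟨fun j => OrderDual.toDual (N j), fun _ _ h => hN h⟩ : ℕ →o (Submodule R M)ᵒᵈ)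
  exact ⟨n, fun m hm => (hn m hm).symm⟩

theorem isArtinian_of_antitone_stable
    (h : ∀ N : ℕ → Submodule R M, Antitone N → ∃ n, ∀ m, n ≤ m → N n ≤ N m) :
    IsArtinian R M := by
  rw [← monotone_stabilizes_iff_artinian]
  intro N
  have hN : Antitone fun j => OrderDual.ofDual (N j) := fun _ _ h => N.monotone h
  obtain ⟨n, hn⟩ := h _ hN
  exact ⟨n, fun m hm => le_antisymm (N.monotone hm) (hn m hm)⟩

/-- A module all of whose elements are killed by powers of `x` is Artinian as soon as the
submodule of elements killed by `x` is. -/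
theorem isArtinian_of_torsion (x : R) (hx : ∀ m : M, ∃ k : ℕ, x ^ k • m = 0)
    [IsArtinian R (LinearMap.ker (LinearMap.lsmul R M x))] : IsArtinian R M := by
  refine isArtinian_of_antitone_stable fun N hN => ?_
  set K := LinearMap.ker (LinearMap.lsmul R M x)
  -- `G j k` is xᵏN_j ∩ (0 : x), decreasing in both indices inside the Artinian module (0 : x).
  let G : ℕ → ℕ → Submodule R K := fun j k =>
    (Submodule.map (LinearMap.lsmul R M (x ^ k)) (N j)).comap K.subtype
  have hG : ∀ {j j' k k'}, j ≤ j' → k ≤ k' → G j' k' ≤ G j k := by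
    rintro j j' k k' hj hk u ⟨v, hv, hvu⟩
    refine ⟨x ^ (k' - k) • v, Submodule.smul_mem _ _ (hN hj hv), ?_⟩
    rw [← hvu]
    simp only [LinearMap.lsmul_apply, smul_smul, ← pow_add]
    congr 2; omega
  obtain ⟨a, ha⟩ := exists_stable_of_antitone (fun j => G j j) fun _ _ h => hG h h
  have hb : ∀ k, ∃ b, ∀ j, b ≤ j → G j k = G b k := fun k =>
    exists_stable_of_antitone (fun j => G j k) fun _ _ h => hG h le_rfl
  choose b hb using hb
  -- Beyond J the rows k < a are constant by choice of `b`; the rows k ≥ a are controlled by the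
  -- diagonal, which is constant from a on.
  obtain ⟨J, hJa, hJb⟩ : ∃ J, a ≤ J ∧ ∀ k < a, b k ≤ J := by
    refine ⟨a + ∑ k ∈ Finset.range a, b k, Nat.le_add_right _ _, fun k hk => ?_⟩
    exact (Finset.single_le_sum (f := b) (fun _ _ => Nat.zero_le _)
      (Finset.mem_range.2 hk)).trans (Nat.le_add_left _ _)
  have hst : ∀ j, J ≤ j → ∀ k, G J k ≤ G j k := by
    intro j hj k
    rcases lt_or_ge k a with hk | hk
    · rw [hb k J (hJb k hk), hb k j ((hJb k hk).trans hj)]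
    · have h1 : G a a ≤ G (max j k) (max j k) :=
        (ha _ ((hJa.trans hj).trans (le_max_left _ _))).ge
      exact (hG hJa hk).trans (h1.trans (hG (le_max_left _ _) (le_max_right _ _)))
  refine ⟨J, fun j hj u hu => ?_⟩
  have key : ∀ k, ∀ u ∈ N J, x ^ k • u = 0 → u ∈ N j := by
    intro k
    induction k with
    | zero => intro u _ h; rw [pow_zero, one_smul] at h; rw [h]; exact Submodule.zero_mem _
    | succ k ih =>
      intro u hu h
      have hmem : x ^ k • u ∈ K := by
        change x • x ^ k • u = 0
        rw [smul_smul, ← pow_succ', h]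
      obtain ⟨v, hv, hvu⟩ := hst j hj k (show (⟨x ^ k • u, hmem⟩ : K) ∈ G J k from ⟨u, hu, rfl⟩)
      have := ih (u - v) (Submodule.sub_mem _ hu (hN hj hv)) (by
        rw [smul_sub, sub_eq_zero]; exact hvu.symm)
      simpa using Submodule.add_mem _ this hv
  obtain ⟨k, hk⟩ := hx u
  exact key k u hu hk

end Melkersson

/-! ### Cohomology of complexes of modules -/

section Cohomology

variable {R : Type*} [CommRing R]

section Def

variable {C : ℕ → Type*} [∀ i, AddCommGroup (C i)] [∀ i, Module R (C i)]
  (d : ∀ i, C i →ₗ[R] C (i + 1))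

/-- The coboundaries of a sequence of linear maps. -/
def coboundaries : ∀ i : ℕ, Submodule R (C i)
  | 0 => ⊥
  | i + 1 => LinearMap.range (d i)

/-- The cohomology of a sequence of linear maps. -/
abbrev Coh (i : ℕ) : Type _ :=
  LinearMap.ker (d i) ⧸ (coboundaries d i).submoduleOf (LinearMap.ker (d i))

variable {d} in
/-- The class of a cocycle. -/
abbrev Coh.mk {i : ℕ} (z : LinearMap.ker (d i)) : Coh d i := Submodule.Quotient.mk z

variable {d} in
theorem Coh.mk_eq_zero {i : ℕ} {z : LinearMap.ker (d i)} :
    Coh.mk z = 0 ↔ (z : C i) ∈ coboundaries d i :=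
  Submodule.Quotient.mk_eq_zero _

variable {d} in
theorem Coh.mk_surjective {i : ℕ} (h : Coh d i) : ∃ z : LinearMap.ker (d i), Coh.mk z = h :=
  Submodule.Quotient.mk_surjective _ h

end Def

variable {C D E : ℕ → Type*} [∀ i, AddCommGroup (C i)] [∀ i, Module R (C i)]
  [∀ i, AddCommGroup (D i)] [∀ i, Module R (D i)] [∀ i, AddCommGroup (E i)] [∀ i, Module R (E i)]
  {dC : ∀ i, C i →ₗ[R] C (i + 1)} {dD : ∀ i, D i →ₗ[R] D (i + 1)}
  {dE : ∀ i, E i →ₗ[R] E (i + 1)}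

theorem map_mem_coboundaries (φ : ∀ i, C i →ₗ[R] D i)
    (hφ : ∀ i x, φ (i + 1) (dC i x) = dD i (φ i x)) {i : ℕ} {x : C i}
    (hx : x ∈ coboundaries dC i) : φ i x ∈ coboundaries dD i := by
  cases i with
  | zero =>
    have : x = 0 := hx
    rw [this, map_zero]; exact Submodule.zero_mem _
  | succ i =>
    obtain ⟨y, rfl⟩ := hx
    exact ⟨φ i y, (hφ i y).symm⟩

/-- The map on cocycles induced by a morphism of complexes. -/
def cocycleMap (φ : ∀ i, C i →ₗ[R] D i) (hφ : ∀ i x, φ (i + 1) (dC i x) = dD i (φ i x)) (i : ℕ) :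
    LinearMap.ker (dC i) →ₗ[R] LinearMap.ker (dD i) :=
  (φ i).restrict fun x hx => by
    rw [LinearMap.mem_ker] at hx ⊢
    rw [← hφ, hx, map_zero]

/-- The map on cohomology induced by a morphism of complexes. -/
def cohMap (φ : ∀ i, C i →ₗ[R] D i) (hφ : ∀ i x, φ (i + 1) (dC i x) = dD i (φ i x)) (i : ℕ) :
    Coh dC i →ₗ[R] Coh dD i :=
  Submodule.mapQ _ _ (cocycleMap φ hφ i) fun _ hx => map_mem_coboundaries φ hφ hx

theorem cohMap_mk (φ : ∀ i, C i →ₗ[R] D i) (hφ : ∀ i x, φ (i + 1) (dC i x) = dD i (φ i x)) (i : ℕ)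
    (z : LinearMap.ker (dC i)) : cohMap φ hφ i (Coh.mk z) = Coh.mk (cocycleMap φ hφ i z) := rfl

/-- Isomorphic complexes have isomorphic cohomology. -/
def cohEquiv (φ : ∀ i, C i ≃ₗ[R] D i) (hφ : ∀ i x, φ (i + 1) (dC i x) = dD i (φ i x)) (i : ℕ) :
    Coh dC i ≃ₗ[R] Coh dD i :=
  have hφ' : ∀ i x, (φ (i + 1)).symm (dD i x) = dC i ((φ i).symm x) := fun i x => by
    rw [LinearEquiv.symm_apply_eq, hφ, LinearEquiv.apply_symm_apply]
  LinearEquiv.ofLinearMap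
    (cohMap (fun i => (φ i).toLinearMap) hφ i)
    (cohMap (fun i => (φ i).symm.toLinearMap) hφ' i)
    (by
      ext z
      exact congrArg Coh.mk (Subtype.ext ((φ i).apply_symm_apply _)))
    (by
      ext z
      exact congrArg Coh.mk (Subtype.ext ((φ i).symm_apply_apply _)))

section Exact

variable (hdD : ∀ i x, dD (i + 1) (dD i x) = 0)
  (φ : ∀ i, C i →ₗ[R] D i) (hφ : ∀ i x, φ (i + 1) (dC i x) = dD i (φ i x))
  (ψ : ∀ i, D i →ₗ[R] E i) (hψ : ∀ i x, ψ (i + 1) (dD i x) = dE i (ψ i x))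
  (hinj : ∀ i, Function.Injective (φ i)) (hex : ∀ i, Function.Exact (φ i) (ψ i))
  (hsurj : ∀ i, Function.Surjective (ψ i))

include hinj in
theorem cohMap_zero_injective : Function.Injective (cohMap φ hφ 0) := by
  rw [injective_iff_map_eq_zero]
  intro h hh
  obtain ⟨z, rfl⟩ := Coh.mk_surjective h
  rw [cohMap_mk, Coh.mk_eq_zero] at hh
  have hz : φ 0 (z : C 0) = 0 := hh
  rw [Coh.mk_eq_zero]
  exact (map_eq_zero_iff _ (hinj 0)).1 hz

include hdD hinj hex hsurj in
theorem cohMap_exact (i : ℕ) : Function.Exact (cohMap φ hφ i) (cohMap ψ hψ i) := by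
  intro h
  constructor
  · intro hh
    obtain ⟨z, rfl⟩ := Coh.mk_surjective h
    rw [cohMap_mk, Coh.mk_eq_zero] at hh
    obtain ⟨y, hy, hyz⟩ : ∃ y ∈ coboundaries dD i, ψ i y = ψ i z := by
      cases i with
      | zero =>
        have : ψ 0 (z : D 0) = 0 := hh
        exact ⟨0, Submodule.zero_mem _, by rw [this, map_zero]⟩
      | succ i =>
        obtain ⟨e, he⟩ := hh
        obtain ⟨y, rfl⟩ := hsurj i e
        exact ⟨_, ⟨y, rfl⟩, (hψ i y).trans he⟩
    have hdy : dD i y = 0 := by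
      cases i with
      | zero => rw [show y = 0 from hy, map_zero]
      | succ i => obtain ⟨w, rfl⟩ := hy; exact hdD i w
    obtain ⟨c, hc⟩ := (hex i ((z : D i) - y)).1 (by rw [map_sub, hyz, sub_self])
    have hdc : dC i c = 0 := by
      apply hinj (i + 1)
      rw [hφ, hc, map_sub, hdy, LinearMap.mem_ker.1 z.2, sub_zero, map_zero]
    refine ⟨Coh.mk ⟨c, hdc⟩, ?_⟩
    rw [cohMap_mk, ← sub_eq_zero, ← Submodule.Quotient.mk_sub]
    refine Coh.mk_eq_zero.2 ?_
    change φ i c - (z : D i) ∈ _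
    rw [hc]
    have : (z : D i) - y - z = -y := by abel
    rw [this]
    exact Submodule.neg_mem _ hy
  · rintro ⟨k, rfl⟩
    obtain ⟨z, rfl⟩ := Coh.mk_surjective k
    rw [cohMap_mk, cohMap_mk, Coh.mk_eq_zero]
    change ψ i (φ i z) ∈ _
    rw [(hex i).apply_apply_eq_zero]
    exact Submodule.zero_mem _

variable (hdC : ∀ i x, dC (i + 1) (dC i x) = 0) (hdE : ∀ i x, dE (i + 1) (dE i x) = 0)

include hdC hdD hdE hφ hψ hinj hex hsurj in
/-- The connecting homomorphism of a short exact sequence of complexes. -/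
theorem exists_connecting (i : ℕ) : ∃ δ : Coh dE i →ₗ[R] Coh dC (i + 1),
    Function.Exact (cohMap ψ hψ i) δ ∧ Function.Exact δ (cohMap φ hφ (i + 1)) := by
  -- The snake lemma is applied to the differentials Cⁱ → Zⁱ⁺¹ into the cocycles: their kernels are
  -- the cocycles Zⁱ and their cokernels the cohomology in degree i + 1.
  let i₁ := (dC i).codRestrict (LinearMap.ker (dC (i + 1))) fun x => hdC i x
  let i₂ := (dD i).codRestrict (LinearMap.ker (dD (i + 1))) fun x => hdD i x
  let i₃ := (dE i).codRestrict (LinearMap.ker (dE (i + 1))) fun x => hdE i x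
  have hg : Function.Exact (cocycleMap φ hφ (i + 1)) (cocycleMap ψ hψ (i + 1)) := by
    rintro ⟨z, hz⟩
    constructor
    · intro h
      obtain ⟨c, rfl⟩ := (hex (i + 1) z).1 (congrArg Subtype.val h)
      refine ⟨⟨c, ?_⟩, rfl⟩
      apply hinj (i + 1 + 1)
      rw [hφ, map_zero]; exact hz
    · rintro ⟨c, hc⟩
      rw [← hc]
      exact Subtype.ext ((hex (i + 1)).apply_apply_eq_zero _)
  have hι₃ : Function.Exact (LinearMap.ker (dE i)).subtype i₃ := by
    intro x
    constructor
    · intro h; exact ⟨⟨x, congrArg Subtype.val h⟩, rfl⟩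
    · rintro ⟨y, rfl⟩; exact Subtype.ext y.2
  have hι₂ : Function.Exact (LinearMap.ker (dD i)).subtype i₂ := by
    intro x
    constructor
    · intro h; exact ⟨⟨x, congrArg Subtype.val h⟩, rfl⟩
    · rintro ⟨y, rfl⟩; exact Subtype.ext y.2
  have hπ₁ : Function.Exact i₁
      ((coboundaries dC (i + 1)).submoduleOf (LinearMap.ker (dC (i + 1)))).mkQ := by
    intro x
    rw [Submodule.mkQ_apply, Submodule.Quotient.mk_eq_zero]
    constructor
    · rintro ⟨y, hy⟩; exact ⟨y, Subtype.ext hy⟩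
    · rintro ⟨y, rfl⟩; exact ⟨y, rfl⟩
  have hπ₂ : Function.Exact i₂
      ((coboundaries dD (i + 1)).submoduleOf (LinearMap.ker (dD (i + 1)))).mkQ := by
    intro x
    rw [Submodule.mkQ_apply, Submodule.Quotient.mk_eq_zero]
    constructor
    · rintro ⟨y, hy⟩; exact ⟨y, Subtype.ext hy⟩
    · rintro ⟨y, rfl⟩; exact ⟨y, rfl⟩
  have h₁ : (cocycleMap φ hφ (i + 1)).comp i₁ = i₂.comp (φ i) := by
    ext x; exact hφ i x
  have h₂ : (cocycleMap ψ hψ (i + 1)).comp i₂ = i₃.comp (ψ i) := by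
    ext x; exact hψ i x
  have hg₁ : Function.Injective (cocycleMap φ hφ (i + 1)) := fun x y h =>
    Subtype.ext (hinj _ (congrArg Subtype.val h))
  let δ := SnakeLemma.δ' i₁ i₂ i₃ (φ i) (ψ i) (hex i) _ _ hg h₁ h₂ _ hι₃ _ hπ₁ (hsurj i) hg₁
  have hright : Function.Exact (cocycleMap ψ hψ i) δ :=
    SnakeLemma.exact_δ'_right i₁ i₂ i₃ (φ i) (ψ i) (hex i) _ _ hg h₁ h₂ _ hι₂ _ hι₃ _ hπ₁
      (hsurj i) hg₁ (cocycleMap ψ hψ i) rfl Subtype.val_injective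
  have hleft : Function.Exact δ (cohMap φ hφ (i + 1)) :=
    SnakeLemma.exact_δ'_left i₁ i₂ i₃ (φ i) (ψ i) (hex i) _ _ hg h₁ h₂ _ hι₃ _ hπ₁ _ hπ₂
      (hsurj i) hg₁ (cohMap φ hφ (i + 1)) rfl (Submodule.mkQ_surjective _)
  -- The snake map starts on cocycles of E. It kills coboundaries, since these lift to coboundaries
  -- of D, and so descends to cohomology.
  have hle : (coboundaries dE i).submoduleOf (LinearMap.ker (dE i)) ≤ LinearMap.ker δ := by
    rintro ⟨z, hz⟩ hz'
    rw [LinearMap.mem_ker, hright]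
    cases i with
    | zero =>
      have : z = 0 := hz'
      exact ⟨0, Subtype.ext (by simpa using this.symm)⟩
    | succ i =>
      obtain ⟨e, rfl⟩ : ∃ e, dE i e = z := hz'
      obtain ⟨y, rfl⟩ := hsurj i e
      exact ⟨⟨dD i y, hdD i y⟩, Subtype.ext (hψ i y)⟩
  refine ⟨Submodule.liftQ _ δ hle, ?_, ?_⟩
  · intro h
    obtain ⟨z, rfl⟩ := Coh.mk_surjective h
    rw [Submodule.liftQ_apply, hright]
    constructor
    · rintro ⟨y, rfl⟩; exact ⟨Coh.mk y, rfl⟩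
    · rintro ⟨k, hk⟩
      obtain ⟨y, rfl⟩ := Coh.mk_surjective k
      rw [cohMap_mk] at hk
      have := hle ((Submodule.Quotient.eq _).1 hk)
      rw [LinearMap.mem_ker, map_sub, hright.apply_apply_eq_zero, zero_sub, neg_eq_zero] at this
      exact (hright z).1 this
  · intro h
    rw [hleft]
    constructor
    · rintro ⟨z, rfl⟩; exact ⟨Coh.mk z, rfl⟩
    · rintro ⟨k, rfl⟩
      obtain ⟨z, rfl⟩ := Coh.mk_surjective k
      exact ⟨z, rfl⟩

end Exact

end Cohomology

/-! ### Inserting and deleting entries of increasing index sequences. -/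

section Insert

variable {n : ℕ}

theorem orderEmb_eq_of_range_subset {i : ℕ} {s t : Fin i ↪o Fin n}
    (h : ∀ k, s k ∈ Set.range t) : s = t := by
  classical
  have hc : (Finset.univ.map t.toEmbedding).card = i := by simp
  have h1 := Finset.orderEmbOfFin_unique hc (f := s) (fun x => by simpa using h x) s.strictMono
  have h2 := Finset.orderEmbOfFin_unique hc (f := t) (fun x => by simp) t.strictMono
  exact DFunLike.coe_injective (h1.trans h2.symm)

/-- Every index not occurring in an increasing sequence can be inserted into it. -/
theorem exists_dropIndex_eq {i : ℕ} (s : Fin i ↪o Fin n) {j : Fin n} (hj : j ∉ Set.range s) :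
    ∃ (t : Fin (i + 1) ↪o Fin n) (k : Fin (i + 1)), t k = j ∧ dropIndex t k = s := by
  classical
  have hc : (insert j (Finset.univ.map s.toEmbedding)).card = i + 1 := by
    rw [Finset.card_insert_of_notMem]
    · simp
    · simpa using hj
  set t := Finset.orderEmbOfFin _ hc
  obtain ⟨k, hk⟩ : j ∈ Set.range t := by
    rw [Finset.range_orderEmbOfFin]; simp
  refine ⟨t, k, hk, orderEmb_eq_of_range_subset fun l => ?_⟩
  have h1 : t (k.succAbove l) ∈ insert j (Finset.univ.map s.toEmbedding) :=
    Finset.orderEmbOfFin_mem _ hc _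
  rw [Finset.mem_insert] at h1
  rcases h1 with h1 | h1
  · rw [← hk] at h1
    exact absurd (t.injective h1) (Fin.succAbove_ne k l)
  · simpa using h1

theorem eq_of_dropIndex_eq {i : ℕ} {t t' : Fin (i + 1) ↪o Fin n} {k k' : Fin (i + 1)}
    (hk : t k = t' k') (hd : dropIndex t k = dropIndex t' k') : t = t' ∧ k = k' := by
  have ht : t = t' := by
    refine orderEmb_eq_of_range_subset fun l => ?_
    rcases Fin.eq_self_or_eq_succAbove k l with rfl | ⟨m, rfl⟩
    · exact ⟨k', hk.symm⟩
    · exact ⟨k'.succAbove m, (DFunLike.congr_fun hd m).symm⟩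
  subst ht
  exact ⟨rfl, t.injective hk⟩

theorem dropIndex_dropIndex {i : ℕ} (s : Fin (i + 2) ↪o Fin n) (k : Fin (i + 2))
    (l : Fin (i + 1)) :
    dropIndex (dropIndex s (k.succAbove l)) (l.predAbove k) = dropIndex (dropIndex s k) l := by
  ext x
  simp only [dropIndex, RelEmbedding.trans_apply, Fin.succAboveOrderEmb_apply]
  congr 2
  exact Fin.succAbove_succAbove_succAbove_predAbove k l x

/-- Deleting two entries in the opposite order shifts exactly one of the two positions by one; this
sign drives the contracting homotopy used for torsion. -/
theorem neg_one_pow_succAbove {A : Type*} [Ring A] {i : ℕ} (k : Fin (i + 2)) (l : Fin (i + 1)) :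
    (-1 : A) ^ ((k.succAbove l : ℕ) + (l.predAbove k : ℕ)) = -(-1) ^ ((k : ℕ) + l) := by
  have : ((k.succAbove l : ℕ) + (l.predAbove k : ℕ)) % 2 ≠ (k + l : ℕ) % 2 := by
    rcases Fin.lt_or_ge l.castSucc k with h | h
    · rw [Fin.succAbove_of_castSucc_lt _ _ h, Fin.predAbove_of_castSucc_lt _ _ h]
      simp [Fin.lt_def] at h ⊢; omega
    · rw [Fin.succAbove_of_le_castSucc _ _ h, Fin.predAbove_of_le_castSucc _ _ h]
      simp [Fin.le_def] at h ⊢; omega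
  rcases Nat.even_or_odd (k + l : ℕ) with h | h
  · have h' : Odd ((k.succAbove l : ℕ) + (l.predAbove k : ℕ)) := by
      rw [Nat.even_iff] at h; rw [Nat.odd_iff]; omega
    rw [h.neg_one_pow, h'.neg_one_pow]
  · have h' : Even ((k.succAbove l : ℕ) + (l.predAbove k : ℕ)) := by
      rw [Nat.odd_iff] at h; rw [Nat.even_iff]; omega
    rw [h.neg_one_pow, h'.neg_one_pow, neg_neg]

end Insert

/-! ### Local cohomology with module coefficients: long exact sequences and torsion. -/

section CechModule

variable {R : Type u} [CommRing R] {n : ℕ} (f : Fin n → R)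
  (M : Type w) [AddCommGroup M] [Module R M]

/-- The differential of the Čech complex with coefficients in a module. -/
noncomputable def cechDiffM (i : ℕ) :
    M ⊗[R] CechCochain f i →ₗ[R] M ⊗[R] CechCochain f (i + 1) :=
  (cechDiff f i).lTensor M

theorem cechDiffM_comp (i : ℕ) (x : M ⊗[R] CechCochain f i) :
    cechDiffM f M (i + 1) (cechDiffM f M i x) = 0 := by
  have : cechDiff f (i + 1) ∘ₗ cechDiff f i = 0 := LinearMap.ext (cechDiff_cechDiff f i)
  rw [cechDiffM, cechDiffM, ← LinearMap.comp_apply, ← LinearMap.lTensor_comp, this,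
    LinearMap.lTensor_zero, LinearMap.zero_apply]

/-- The `i`-th local cohomology of a module. -/
def HM (i : ℕ) : Type (max u w) := Coh (cechDiffM f M) i

noncomputable instance (i : ℕ) : AddCommGroup (HM f M i) :=
  inferInstanceAs (AddCommGroup (Coh (cechDiffM f M) i))

noncomputable instance (i : ℕ) : Module R (HM f M i) :=
  inferInstanceAs (Module R (Coh (cechDiffM f M) i))

variable {M} {N P : Type*} [AddCommGroup N] [Module R N] [AddCommGroup P] [Module R P]

theorem rTensor_cechDiffM (g : M →ₗ[R] N) (i : ℕ) (x : M ⊗[R] CechCochain f i) :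
    g.rTensor _ (cechDiffM f M i x) = cechDiffM f N i (g.rTensor _ x) := by
  simp only [cechDiffM, ← LinearMap.comp_apply, LinearMap.rTensor_comp_lTensor,
    LinearMap.lTensor_comp_rTensor]

/-- Functoriality of local cohomology. -/
noncomputable def HM.map (g : M →ₗ[R] N) (i : ℕ) : HM f M i →ₗ[R] HM f N i :=
  cohMap (fun i => g.rTensor (CechCochain f i)) (rTensor_cechDiffM f g) i

/-- With this, the long exact sequence of multiplication by a on M speaks about multiplication by a
on cohomology. -/
theorem HM.map_lsmul (a : R) (i : ℕ) (x : HM f M i) :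
    HM.map f (LinearMap.lsmul R M a) i x = a • x := by
  obtain ⟨z, rfl⟩ := Coh.mk_surjective x
  refine congrArg Coh.mk (Subtype.ext ?_)
  change (LinearMap.lsmul R M a).rTensor _ (z : M ⊗[R] CechCochain f i) =
    a • (z : M ⊗[R] CechCochain f i)
  have : LinearMap.lsmul R M a = a • LinearMap.id := rfl
  rw [this, LinearMap.rTensor_smul, LinearMap.rTensor_id]
  rfl

/-- Isomorphic modules have isomorphic local cohomology. -/
noncomputable def HM.congr (e : M ≃ₗ[R] N) (i : ℕ) : HM f M i ≃ₗ[R] HM f N i :=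
  cohEquiv (fun i => e.rTensor (CechCochain f i)) (rTensor_cechDiffM f e.toLinearMap) i

section LES

variable (g : M →ₗ[R] N) (h : N →ₗ[R] P) (hg : Function.Injective g) (hgh : Function.Exact g h)
  (hh : Function.Surjective h)

include hg in
theorem HM.map_zero_injective : Function.Injective (HM.map f g 0) :=
  cohMap_zero_injective _ _ fun _ => Module.Flat.rTensor_preserves_injective_linearMap g hg

-- The Čech terms are finite products of localizations, hence flat, so a short exact sequence of
-- modules stays exact after tensoring with the Čech complex.
include hg hgh hh in
theorem HM.map_exact (i : ℕ) : Function.Exact (HM.map f g i) (HM.map f h i) :=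
  cohMap_exact (cechDiffM_comp f N) _ _ _ _
    (fun _ => Module.Flat.rTensor_preserves_injective_linearMap g hg)
    (fun _ => rTensor_exact _ hgh hh) (fun _ => LinearMap.rTensor_surjective _ hh) i

include hg hgh hh in
theorem HM.exists_connecting (i : ℕ) : ∃ δ : HM f P i →ₗ[R] HM f M (i + 1),
    Function.Exact (HM.map f h i) δ ∧ Function.Exact δ (HM.map f g (i + 1)) :=
  FThreshold.exists_connecting (cechDiffM_comp f N) _ _ _ _
    (fun _ => Module.Flat.rTensor_preserves_injective_linearMap g hg)
    (fun _ => rTensor_exact _ hgh hh) (fun _ => LinearMap.rTensor_surjective _ hh)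
    (cechDiffM_comp f M) (cechDiffM_comp f P) i

end LES

/-! ### Torsion -/

theorem cechRestrict_comm {i : ℕ} (s : Fin (i + 2) ↪o Fin n) (k : Fin (i + 2)) (l : Fin (i + 1))
    (x : ∀ t : Fin i ↪o Fin n, M ⊗[R] CechTerm f t) :
    (cechRestrict f s k).toLinearMap.lTensor M
        ((cechRestrict f (dropIndex s k) l).toLinearMap.lTensor M (x _)) =
      (cechRestrict f s (k.succAbove l)).toLinearMap.lTensor M
        ((cechRestrict f (dropIndex s (k.succAbove l)) (l.predAbove k)).toLinearMap.lTensor M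
          (x _)) := by
  have key : ∀ (t t' : Fin i ↪o Fin n) (_ : t = t') (φ : CechTerm f t →ₐ[R] CechTerm f s)
      (ψ : CechTerm f t' →ₐ[R] CechTerm f s),
      φ.toLinearMap.lTensor M (x t) = ψ.toLinearMap.lTensor M (x t') := by
    intro t t' h φ ψ
    subst h
    have : φ = ψ := IsLocalization.algHom_ext (Submonoid.powers (∏ m, f (t m))) (by ext)
    rw [this]
  have := key _ _ (dropIndex_dropIndex s k l).symm
    ((cechRestrict f s k).comp (cechRestrict f (dropIndex s k) l))
    ((cechRestrict f s (k.succAbove l)).comp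
      (cechRestrict f (dropIndex s (k.succAbove l)) (l.predAbove k)))
  simpa only [AlgHom.comp_toLinearMap, LinearMap.lTensor_comp_apply] using this

theorem prod_eq_mul_prod_dropIndex {i : ℕ} (t : Fin (i + 1) ↪o Fin n) (k : Fin (i + 1)) :
    ∏ l, f (t l) = f (t k) * ∏ l, f (dropIndex t k l) :=
  Fin.prod_univ_succAbove _ k

/-- R_{xy} is R_y with x inverted. Thus each Čech restriction map inverts just the omitted element,
a property that survives tensoring with M. -/
theorem isLocalizedModule_of_away_mul {x y : R} {A B : Type*} [CommRing A] [CommRing B]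
    [Algebra R A] [Algebra R B] [IsLocalization.Away y A] [IsLocalization.Away (x * y) B]
    (φ : A →ₐ[R] B) : IsLocalizedModule (Submonoid.powers x) φ.toLinearMap := by
  have hunit : IsUnit (algebraMap R B (x * y)) := IsLocalization.Away.algebraMap_isUnit _
  rw [map_mul] at hunit
  have hv : IsUnit (algebraMap R A y) := IsLocalization.Away.algebraMap_isUnit _
  constructor
  · rintro ⟨_, m, rfl⟩
    have h1 := (isUnit_of_mul_isUnit_left hunit).pow m
    rw [← map_pow] at h1
    rw [Module.End.isUnit_iff]
    have : (algebraMap R (Module.End R B) (x ^ m) : B → B) = fun z => (h1.unit : B) * z := by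
      ext z
      rw [Module.algebraMap_end_apply, Algebra.smul_def, IsUnit.unit_spec]
    change Function.Bijective (algebraMap R (Module.End R B) (x ^ m) : B → B)
    rw [this]
    exact h1.unit.mulLeft_bijective
  · intro z
    obtain ⟨m, r, hr⟩ := IsLocalization.Away.surj (x * y) z
    obtain ⟨w, hw⟩ := (hv.pow m).exists_right_inv
    refine ⟨(w * algebraMap R _ r, ⟨x ^ m, m, rfl⟩), ?_⟩
    have hw' : algebraMap R B y ^ m * φ w = 1 := by
      rw [← φ.commutes, ← map_pow, ← map_mul, hw, map_one]
    refine ((isUnit_of_mul_isUnit_right hunit).pow m).mul_left_cancel ?_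
    have h3 : algebraMap R B y ^ m * (algebraMap R B (x ^ m) * z) =
        algebraMap R B y ^ m * (φ w * algebraMap R B r) := by
      rw [← mul_assoc _ (φ w), hw', one_mul, ← hr, map_mul, map_pow]
      ring
    rw [AlgHom.toLinearMap_apply, map_mul, φ.commutes, Submonoid.smul_def, Algebra.smul_def]
    exact h3
  · intro a b hab
    obtain ⟨m, r, hr⟩ := IsLocalization.Away.surj y (a - b)
    have h0 : algebraMap R B r = 0 := by
      rw [← φ.commutes, ← hr, map_mul, map_sub]
      have : φ a = φ b := hab
      rw [this, sub_self, zero_mul]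
    obtain ⟨⟨_, c, rfl⟩, hc⟩ := (IsLocalization.map_eq_zero_iff (Submonoid.powers (x * y)) B r).1 h0
    refine ⟨⟨x ^ c, c, rfl⟩, ?_⟩
    rw [Submonoid.smul_def, Submonoid.smul_def, ← sub_eq_zero, ← smul_sub]
    refine ((hv.pow c).mul (hv.pow m)).mul_left_cancel ?_
    rw [mul_zero, Algebra.smul_def]
    have : algebraMap R A ((x * y) ^ c * r) = 0 := by
      have hc' : (x * y) ^ c * r = 0 := hc
      rw [hc', map_zero]
    rw [mul_pow, map_mul, map_mul, ← hr] at this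
    simp only [map_pow] at this ⊢
    rw [← this]; ring

instance isLocalizedModule_cechRestrict {i : ℕ} (t : Fin (i + 1) ↪o Fin n) (k : Fin (i + 1)) :
    IsLocalizedModule (Submonoid.powers (f (t k))) (cechRestrict f t k).toLinearMap := by
  have : IsLocalization.Away (f (t k) * ∏ l, f (dropIndex t k l)) (CechTerm f t) := by
    rw [← prod_eq_mul_prod_dropIndex]; infer_instance
  exact isLocalizedModule_of_away_mul (y := ∏ l, f (dropIndex t k l)) _

instance isLocalizedModule_lTensor {A B : Type*} [AddCommGroup A] [Module R A] [AddCommGroup B]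
    [Module R B] (S : Submonoid R) (g : A →ₗ[R] B) [IsLocalizedModule S g] :
    IsLocalizedModule S (g.lTensor M) := by
  have h1 : IsLocalizedModule S (g.rTensor M) :=
    inferInstanceAs (IsLocalizedModule S (TensorProduct.AlgebraTensorModule.rTensor R M g))
  have h2 := IsLocalizedModule.of_linearEquiv_right S (g.rTensor M) (TensorProduct.comm R M A)
  have h3 := IsLocalizedModule.of_linearEquiv S
    ((g.rTensor M) ∘ₗ (TensorProduct.comm R M A).toLinearMap) (TensorProduct.comm R B M)
  convert h3 using 1
  ext m a
  simp

/-- The component of a Čech cochain at an increasing sequence of indices. -/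
noncomputable def cechComp (M : Type w) [AddCommGroup M] [Module R M] {i : ℕ}
    (s : Fin i ↪o Fin n) : M ⊗[R] CechCochain f i →ₗ[R] M ⊗[R] CechTerm f s :=
  (LinearMap.proj s : CechCochain f i →ₗ[R] CechTerm f s).lTensor M

theorem piRight_apply_eq_cechComp {i : ℕ} (z : M ⊗[R] CechCochain f i) (s : Fin i ↪o Fin n) :
    TensorProduct.piRight R R M (fun s : Fin i ↪o Fin n => CechTerm f s) z s = cechComp f M s z := by
  induction z with
  | zero => simp
  | tmul m c => rfl
  | add x y hx hy => rw [map_add, map_add, Pi.add_apply, hx, hy]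

theorem cechComp_ext {i : ℕ} {z z' : M ⊗[R] CechCochain f i}
    (h : ∀ s, cechComp f M s z = cechComp f M s z') : z = z' := by
  apply (TensorProduct.piRight R R M (fun s : Fin i ↪o Fin n => CechTerm f s)).injective
  ext s
  rw [piRight_apply_eq_cechComp, piRight_apply_eq_cechComp, h]

theorem exists_cechComp_eq {i : ℕ} (x : ∀ s : Fin i ↪o Fin n, M ⊗[R] CechTerm f s) :
    ∃ z, ∀ s, cechComp f M s z = x s :=
  ⟨(TensorProduct.piRight R R M (fun s : Fin i ↪o Fin n => CechTerm f s)).symm x, fun s => by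
    rw [← piRight_apply_eq_cechComp, LinearEquiv.apply_symm_apply]⟩

theorem cechComp_cechDiffM {i : ℕ} (z : M ⊗[R] CechCochain f i) (s : Fin (i + 1) ↪o Fin n) :
    cechComp f M s (cechDiffM f M i z) = ∑ k : Fin (i + 1), (-1 : R) ^ (k : ℕ) •
      (cechRestrict f s k).toLinearMap.lTensor M (cechComp f M (dropIndex s k) z) := by
  have h : (LinearMap.proj s : CechCochain f (i + 1) →ₗ[R] CechTerm f s) ∘ₗ cechDiff f i =
      ∑ k : Fin (i + 1), ((-1 : R) ^ (k : ℕ)) •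
        (cechRestrict f s k).toLinearMap ∘ₗ LinearMap.proj (dropIndex s k) :=
    LinearMap.proj_pi _ _
  rw [cechComp, cechDiffM, ← LinearMap.lTensor_comp_apply, h]
  simp only [← LinearMap.coe_lTensorHom, map_sum, map_smul, LinearMap.sum_apply,
    LinearMap.smul_apply]
  simp only [LinearMap.coe_lTensorHom, LinearMap.lTensor_comp_apply]
  rfl

/-- Every element of local cohomology is killed by a power of each of the elements `f j`. -/
theorem exists_pow_smul_mem_coboundaries (j : Fin n) {i : ℕ} (z : M ⊗[R] CechCochain f i)
    (hz : cechDiffM f M i z = 0) :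
    ∃ N : ℕ, f j ^ N • z ∈ coboundaries (cechDiffM f M) i := by
  classical
  have hloc : ∀ (t : Fin (i + 1) ↪o Fin n) (k : Fin (i + 1)), t k = j →
      IsLocalizedModule (Submonoid.powers (f j)) ((cechRestrict f t k).toLinearMap.lTensor M) := by
    rintro t k rfl
    infer_instance
  have hz0 : ∀ s : Fin (i + 1) ↪o Fin n, ∑ k : Fin (i + 1), (-1 : R) ^ (k : ℕ) •
      (cechRestrict f s k).toLinearMap.lTensor M (cechComp f M (dropIndex s k) z) = 0 := fun s => by
    rw [← cechComp_cechDiffM, hz, map_zero]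
  -- it suffices to treat the components away from `j` up to torsion
  have red : ∀ b : M ⊗[R] CechCochain f i, b ∈ coboundaries (cechDiffM f M) i →
      ∀ N : ℕ, (∀ s : Fin i ↪o Fin n, j ∈ Set.range s → cechComp f M s b = f j ^ N • cechComp f M s z) →
      (∀ (t : Fin (i + 1) ↪o Fin n) (k : Fin (i + 1)), t k = j →
        (cechRestrict f t k).toLinearMap.lTensor M (cechComp f M (dropIndex t k) b) =
          f j ^ N • (cechRestrict f t k).toLinearMap.lTensor M (cechComp f M (dropIndex t k) z)) →
      ∃ N : ℕ, f j ^ N • z ∈ coboundaries (cechDiffM f M) i := by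
    intro b hb N h1 h2
    have h3 : ∀ s : Fin i ↪o Fin n, ∃ c : ℕ,
        f j ^ c • cechComp f M s b = f j ^ c • (f j ^ N • cechComp f M s z) := by
      intro s
      by_cases hs : j ∈ Set.range s
      · exact ⟨0, by rw [h1 s hs]⟩
      · obtain ⟨t, k, hk, rfl⟩ := exists_dropIndex_eq s hs
        have := h2 t k hk
        rw [← map_smul] at this
        have hl := hloc t k hk
        obtain ⟨⟨_, c, rfl⟩, hc⟩ := IsLocalizedModule.exists_of_eq (S := Submonoid.powers (f j)) this
        exact ⟨c, hc⟩
    choose c hc using h3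
    refine ⟨(∑ s, c s) + N, ?_⟩
    have : f j ^ ((∑ s, c s) + N) • z = f j ^ (∑ s, c s) • b := by
      refine cechComp_ext f fun s => ?_
      obtain ⟨e, he⟩ := Nat.exists_eq_add_of_le (Finset.single_le_sum (f := c)
        (fun _ _ => Nat.zero_le _) (Finset.mem_univ s))
      rw [map_smul, map_smul, he, add_comm (c s) e, pow_add, pow_add, mul_smul, mul_smul, mul_smul,
        hc s]
    rw [this]
    exact Submodule.smul_mem _ _ hb
  cases i with
  | zero =>
    refine red 0 (Submodule.zero_mem _) 0 (fun s hs => ?_) fun t k hk => ?_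
    · obtain ⟨k, _⟩ := hs; exact k.elim0
    · have h1 := hz0 t
      have hk0 : k = 0 := Fin.fin_one_eq_zero k
      subst hk0
      have h2 := (Fin.sum_univ_one _).symm.trans h1
      simpa using h2.symm
  | succ i =>
    -- Inserting `j` is a localization at `f j`, so each component of `z` containing `j` lifts after
    -- multiplication by a power of `f j`; there are finitely many components, so one exponent
    -- serves all.
    have hsurj : ∀ t : Fin (i + 1) ↪o Fin n, ∃ N : ℕ, ∀ k : Fin (i + 1), t k = j →
        ∃ x : M ⊗[R] CechTerm f (dropIndex t k),
          (cechRestrict f t k).toLinearMap.lTensor M x = f j ^ N • cechComp f M t z := by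
      intro t
      by_cases ht : j ∈ Set.range t
      · obtain ⟨k, hk⟩ := ht
        have hl : IsLocalizedModule (Submonoid.powers (f j))
            ((cechRestrict f t k).toLinearMap.lTensor M) := by
          rw [← hk]; infer_instance
        obtain ⟨⟨x, ⟨_, N, rfl⟩⟩, hx⟩ := IsLocalizedModule.surj (Submonoid.powers (f j))
          ((cechRestrict f t k).toLinearMap.lTensor M) (cechComp f M t z)
        refine ⟨N, fun k' hk' => ?_⟩
        obtain rfl : k' = k := t.injective (hk'.trans hk.symm)
        exact ⟨x, hx.symm⟩
      · exact ⟨0, fun k hk => absurd ⟨k, hk⟩ ht⟩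
    choose N0 hN0 using hsurj
    set N := ∑ t, N0 t
    have hsurj : ∀ (t : Fin (i + 1) ↪o Fin n) (k : Fin (i + 1)), t k = j →
        ∃ x : M ⊗[R] CechTerm f (dropIndex t k),
          (cechRestrict f t k).toLinearMap.lTensor M x = f j ^ N • cechComp f M t z := by
      intro t k hk
      obtain ⟨x, hx⟩ := hN0 t k hk
      obtain ⟨e, he⟩ := Nat.exists_eq_add_of_le (Finset.single_le_sum (f := N0)
        (fun _ _ => Nat.zero_le _) (Finset.mem_univ t))
      refine ⟨f j ^ e • x, ?_⟩
      rw [map_smul, hx, smul_smul, ← pow_add, add_comm e, ← he]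
    choose x hx using hsurj
    -- This is the contracting homotopy of the complex with `f j` inverted, cleared of denominators:
    -- the component at s is, up to sign, a lift of the component of `z` at s ∪ {j}, and 0 if j
    -- already occurs in s.
    let b' : ∀ s : Fin i ↪o Fin n, M ⊗[R] CechTerm f s := fun s =>
      if h : ∃ (t : Fin (i + 1) ↪o Fin n) (k : Fin (i + 1)), t k = j ∧ dropIndex t k = s then
        h.choose_spec.choose_spec.2 ▸
          ((-1 : R) ^ (h.choose_spec.choose : ℕ) • x h.choose h.choose_spec.choose
            h.choose_spec.choose_spec.1)
      else 0
    have hb' : ∀ (t : Fin (i + 1) ↪o Fin n) (k : Fin (i + 1)) (hk : t k = j),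
        b' (dropIndex t k) = (-1 : R) ^ (k : ℕ) • x t k hk := by
      intro t k hk
      have h : ∃ (t' : Fin (i + 1) ↪o Fin n) (k' : Fin (i + 1)),
        t' k' = j ∧ dropIndex t' k' = dropIndex t k := ⟨t, k, hk, rfl⟩
      have h1 := eq_of_dropIndex_eq (h.choose_spec.choose_spec.1.trans hk.symm)
        h.choose_spec.choose_spec.2
      simp only [b', dif_pos h]
      have aux : ∀ (t' : Fin (i + 1) ↪o Fin n) (k' : Fin (i + 1)) (hk' : t' k' = j)
          (hd : dropIndex t' k' = dropIndex t k), t' = t ∧ k' = k →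
          (hd ▸ ((-1 : R) ^ (k' : ℕ) • x t' k' hk') : M ⊗[R] CechTerm f (dropIndex t k)) =
            (-1 : R) ^ (k : ℕ) • x t k hk := by
        rintro t' k' hk' hd ⟨rfl, rfl⟩
        rfl
      exact aux _ _ _ _ h1
    have hb0 : ∀ s : Fin i ↪o Fin n, j ∈ Set.range s → b' s = 0 := by
      rintro s ⟨l, hl⟩
      simp only [b']
      rw [dif_neg]
      rintro ⟨t, k, hk, rfl⟩
      exact Fin.succAbove_ne k l (t.injective (hl.trans hk.symm))
    obtain ⟨b, hb⟩ := exists_cechComp_eq f b'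
    have hdb : ∀ s : Fin (i + 1) ↪o Fin n, cechComp f M s (cechDiffM f M i b) =
        ∑ k : Fin (i + 1), (-1 : R) ^ (k : ℕ) •
          (cechRestrict f s k).toLinearMap.lTensor M (b' (dropIndex s k)) := fun s => by
      rw [cechComp_cechDiffM]
      simp only [hb]
    have hx' : ∀ (t : Fin (i + 1) ↪o Fin n) (k : Fin (i + 1)), t k = j →
        (cechRestrict f t k).toLinearMap.lTensor M (b' (dropIndex t k)) =
          (-1 : R) ^ (k : ℕ) • f j ^ N • cechComp f M t z := by
      intro t k hk
      rw [hb' t k hk, map_smul, hx]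
    refine red (cechDiffM f M i b) ⟨b, rfl⟩ N (fun s hs => ?_) fun t k hk => ?_
    · obtain ⟨k, hk⟩ := hs
      rw [hdb, Finset.sum_eq_single k]
      · rw [hx' s k hk, smul_smul, ← pow_add, Even.neg_one_pow ⟨_, rfl⟩, one_smul]
      · intro l _ hlk
        obtain ⟨m, hm⟩ := Fin.exists_succAbove_eq hlk.symm
        rw [hb0 _ ⟨m, by simp [dropIndex, hm, hk]⟩, map_zero, smul_zero]
      · simp
    -- When j does not occur, the cocycle condition on s ∪ {j} expresses the restricted component of
    -- `z` through the faces that contain j, whose lifts are the entries of `b'`.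
    · have h1 := hz0 t
      rw [Fin.sum_univ_succAbove _ k] at h1
      have h2 : (cechRestrict f t k).toLinearMap.lTensor M (cechComp f M (dropIndex t k) z) =
          -(-1 : R) ^ (k : ℕ) • ∑ l : Fin (i + 1), (-1 : R) ^ (k.succAbove l : ℕ) •
            (cechRestrict f t (k.succAbove l)).toLinearMap.lTensor M
              (cechComp f M (dropIndex t (k.succAbove l)) z) := by
        rw [add_eq_zero_iff_eq_neg'] at h1
        rw [h1, neg_smul, smul_neg, neg_neg, smul_smul, ← pow_add, Even.neg_one_pow ⟨_, rfl⟩,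
          one_smul]
      rw [hdb, h2, map_sum, Finset.smul_sum, Finset.smul_sum]
      refine Finset.sum_congr rfl fun l _ => ?_
      have hpos : dropIndex t (k.succAbove l) (l.predAbove k) = j := by
        rw [← hk]
        simp [dropIndex, Fin.succAbove_succAbove_predAbove]
      have hsign := neg_one_pow_succAbove (A := R) k l
      rw [map_smul, cechRestrict_comm f t k l b', hx' _ _ hpos, map_smul, map_smul]
      simp only [smul_smul]
      congr 1
      have hsq : ((-1 : R) ^ (k.succAbove l : ℕ)) * (-1) ^ (k.succAbove l : ℕ) = 1 := by
        rw [← pow_add, Even.neg_one_pow ⟨_, rfl⟩]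
      have hsl : ((-1 : R) ^ (l : ℕ)) * (-1) ^ (l : ℕ) = 1 := by
        rw [← pow_add, Even.neg_one_pow ⟨_, rfl⟩]
      rw [pow_add, pow_add] at hsign
      linear_combination (((-1 : R) ^ (k.succAbove l : ℕ)) * (-1) ^ (l : ℕ) * f j ^ N) * hsign -
        ((-1 : R) ^ (l : ℕ) * (-1) ^ (l.predAbove k : ℕ) * f j ^ N) * hsq -
        (f j ^ N * (-1) ^ (k.succAbove l : ℕ) * (-1) ^ (k : ℕ)) * hsl

theorem HM.exists_pow_smul_eq_zero (j : Fin n) {i : ℕ} (x : HM f M i) :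
    ∃ N : ℕ, f j ^ N • x = 0 := by
  obtain ⟨z, rfl⟩ := Coh.mk_surjective x
  obtain ⟨N, hN⟩ := exists_pow_smul_mem_coboundaries f j z.1 z.2
  exact ⟨N, Coh.mk_eq_zero.2 hN⟩

end CechModule

/-! ### Modules killed by the `f j`, and modules on which some `f j` is regular. -/

section Degenerate

variable {R : Type u} [CommRing R] {n : ℕ} (f : Fin n → R)
  (M : Type w) [AddCommGroup M] [Module R M]

/-- The degree `0` term of the Čech complex is the ring. -/
noncomputable def cechZeroEquiv : R ≃ₗ[R] CechCochain f 0 :=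
  LinearEquiv.ofBijective (Algebra.linearMap R (CechCochain f 0)) (by
    have hb : ∀ s : Fin 0 ↪o Fin n, Function.Bijective (algebraMap R (CechTerm f s)) := fun s =>
      (IsLocalization.atUnits R (Submonoid.powers (∏ k, f (s k))) (by
        rintro _ ⟨m, rfl⟩
        simp)).bijective
    have hs : ∀ s t : Fin 0 ↪o Fin n, s = t := fun s t => by ext k; exact k.elim0
    constructor
    · intro a b hab
      exact (hb OrderEmbedding.ofIsEmpty).1 (congrFun hab OrderEmbedding.ofIsEmpty)
    · intro c
      obtain ⟨r, hr⟩ := (hb OrderEmbedding.ofIsEmpty).2 (c OrderEmbedding.ofIsEmpty)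
      refine ⟨r, funext fun s => ?_⟩
      obtain rfl := hs OrderEmbedding.ofIsEmpty s
      exact hr)

/-- The degree `0` term of the Čech complex of a module is the module. -/
noncomputable def cechZeroEquivM : M ≃ₗ[R] M ⊗[R] CechCochain f 0 :=
  (TensorProduct.rid R M).symm ≪≫ₗ (cechZeroEquiv f).lTensor M

/-- In positive degree every localization inverts some `f j`, which acts as zero on M. -/
theorem subsingleton_tensor_cechCochain (hM : ∀ j (m : M), f j • m = 0) (i : ℕ) :
    Subsingleton (M ⊗[R] CechCochain f (i + 1)) := by
  have h0 : ∀ (s : Fin (i + 1) ↪o Fin n) (y : M ⊗[R] CechTerm f s), y = 0 := by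
    intro s y
    induction y with
    | zero => rfl
    | add a b ha hb => rw [ha, hb, add_zero]
    | tmul m c =>
      have hu : IsUnit (algebraMap R (CechTerm f s) (f (s 0))) := by
        have h : IsUnit (algebraMap R (CechTerm f s) (∏ l, f (s l))) :=
          IsLocalization.Away.algebraMap_isUnit _
        have hd : f (s 0) ∣ ∏ l, f (s l) :=
          Finset.dvd_prod_of_mem (fun l => f (s l)) (Finset.mem_univ 0)
        exact isUnit_of_dvd_unit (map_dvd (algebraMap R (CechTerm f s)) hd) h
      obtain ⟨w, hw⟩ := hu.exists_right_inv
      have : c = f (s 0) • (w * c) := by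
        rw [Algebra.smul_def, ← mul_assoc, hw, one_mul]
      rw [this, ← TensorProduct.smul_tmul, hM, TensorProduct.zero_tmul]
  exact ⟨fun a b => cechComp_ext f fun s => (h0 s _).trans (h0 s _).symm⟩

theorem subsingleton_HM_succ (hM : ∀ j (m : M), f j • m = 0) (i : ℕ) :
    Subsingleton (HM f M (i + 1)) := by
  have := subsingleton_tensor_cechCochain f M hM i
  exact inferInstanceAs (Subsingleton (Coh (cechDiffM f M) (i + 1)))

theorem nontrivial_HM_zero (hM : ∀ j (m : M), f j • m = 0) [Nontrivial M] :
    Nontrivial (HM f M 0) := by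
  have := subsingleton_tensor_cechCochain f M hM 0
  obtain ⟨m, hm⟩ := exists_ne (0 : M)
  refine ⟨Coh.mk ⟨cechZeroEquivM f M m, Subsingleton.elim _ _⟩, 0, fun h => hm ?_⟩
  have h1 : cechZeroEquivM f M m = 0 := Coh.mk_eq_zero.1 h
  simpa using h1

theorem isArtinian_HM_zero [IsArtinian R M] : IsArtinian R (HM f M 0) := by
  have := isArtinian_of_linearEquiv (cechZeroEquivM f M)
  exact inferInstanceAs (IsArtinian R (Coh (cechDiffM f M) 0))

instance subsingleton_HM [Subsingleton M] (i : ℕ) : Subsingleton (HM f M i) :=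
  inferInstanceAs (Subsingleton (Coh (cechDiffM f M) i))

variable {M}

/-- Multiplication by a nonzerodivisor `x` on a module, as a short exact sequence. -/
theorem exact_lsmul_mkQ (x : R) :
    Function.Exact (LinearMap.lsmul R M x) (LinearMap.range (LinearMap.lsmul R M x)).mkQ :=
  LinearMap.exact_map_mkQ_range _

theorem subsingleton_HM_zero {j : Fin n} (hj : Function.Injective (LinearMap.lsmul R M (f j))) :
    Subsingleton (HM f M 0) := by
  have hinj : ∀ y : HM f M 0, f j • y = 0 → y = 0 := fun y hy => by
    rw [← HM.map_lsmul] at hy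
    exact (map_eq_zero_iff _ (HM.map_zero_injective f _ hj)).1 hy
  have : ∀ y : HM f M 0, y = 0 := by
    intro y
    obtain ⟨N, hN⟩ := HM.exists_pow_smul_eq_zero f j y
    induction N with
    | zero => simpa using hN
    | succ N ih => exact ih (hinj _ (by rw [smul_smul, ← pow_succ', hN]))
  exact ⟨fun a b => (this a).trans (this b).symm⟩

/-- The long exact sequence makes `f j` injective on Hⁱ⁺¹(M), but every element there is killed by a
power of `f j`. -/
theorem subsingleton_HM_succ_of_quotient {j : Fin n}
    (hj : Function.Injective (LinearMap.lsmul R M (f j))) (i : ℕ)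
    [Subsingleton (HM f (M ⧸ LinearMap.range (LinearMap.lsmul R M (f j))) i)] :
    Subsingleton (HM f M (i + 1)) := by
  obtain ⟨δ, -, hδ⟩ := HM.exists_connecting f _ _ hj (exact_lsmul_mkQ (f j))
    (Submodule.mkQ_surjective _) i
  have hinj : ∀ y : HM f M (i + 1), f j • y = 0 → y = 0 := fun y hy => by
    rw [← HM.map_lsmul] at hy
    obtain ⟨w, rfl⟩ := (hδ y).1 hy
    rw [Subsingleton.elim w 0, map_zero]
  have : ∀ y : HM f M (i + 1), y = 0 := by
    intro y
    obtain ⟨N, hN⟩ := HM.exists_pow_smul_eq_zero f j y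
    induction N with
    | zero => simpa using hN
    | succ N ih => exact ih (hinj _ (by rw [smul_smul, ← pow_succ', hN]))
  exact ⟨fun a b => (this a).trans (this b).symm⟩

/-- The elements of Hⁱ⁺¹(M) killed by `f j` form a quotient of Hⁱ(M/f_jM). Artinianness passes from
them to all of Hⁱ⁺¹(M) by `isArtinian_of_torsion`. -/
theorem isArtinian_HM_succ_of_quotient {j : Fin n}
    (hj : Function.Injective (LinearMap.lsmul R M (f j))) (i : ℕ)
    [IsArtinian R (HM f (M ⧸ LinearMap.range (LinearMap.lsmul R M (f j))) i)] :
    IsArtinian R (HM f M (i + 1)) := by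
  obtain ⟨δ, -, hδ⟩ := HM.exists_connecting f _ _ hj (exact_lsmul_mkQ (f j))
    (Submodule.mkQ_surjective _) i
  have hker : LinearMap.ker (LinearMap.lsmul R (HM f M (i + 1)) (f j)) = LinearMap.range δ := by
    rw [← hδ.linearMap_ker_eq]
    ext y
    rw [LinearMap.mem_ker, LinearMap.mem_ker, HM.map_lsmul]
    rfl
  have : IsArtinian R (LinearMap.ker (LinearMap.lsmul R (HM f M (i + 1)) (f j))) := by
    rw [hker]; infer_instance
  exact isArtinian_of_torsion (f j) (HM.exists_pow_smul_eq_zero f j)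

theorem isArtinian_HM_of_subsingleton (i : ℕ) [Subsingleton (HM f M i)] :
    IsArtinian R (HM f M i) := inferInstance

theorem HM.map_zero_apply {N : Type*} [AddCommGroup N] [Module R N] (i : ℕ) (x : HM f M i) :
    HM.map f (0 : M →ₗ[R] N) i x = 0 := by
  obtain ⟨v, rfl⟩ := Coh.mk_surjective x
  refine Coh.mk_eq_zero.2 ?_
  change (0 : M →ₗ[R] N).rTensor _ _ ∈ _
  rw [LinearMap.rTensor_zero]
  exact Submodule.zero_mem _

theorem HM.smul_eq_zero {a : R} (ha : ∀ m : M, a • m = 0) (i : ℕ) (x : HM f M i) :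
    a • x = 0 := by
  rw [← HM.map_lsmul, show LinearMap.lsmul R M a = 0 from LinearMap.ext ha, HM.map_zero_apply]

/-- Take yH minimal among these submodules with y ∉ p. For z ∉ p the product zy is again outside p,
so zyH = yH. -/
theorem exists_smul_eq_smul_of_isArtinian {H : Type*} [AddCommGroup H] [Module R H]
    [IsArtinian R H] (p : Ideal R) [hp : p.IsPrime] :
    ∃ y, y ∉ p ∧ ∀ z, z ∉ p → ∀ w : H, ∃ w', z • w' = y • w := by
  obtain ⟨_, ⟨y, hy, rfl⟩, hmin⟩ := IsArtinian.set_has_minimal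
    {N | ∃ y, y ∉ p ∧ N = LinearMap.range (LinearMap.lsmul R H y)}
    ⟨_, 1, (Ideal.ne_top_iff_one _).1 hp.ne_top, rfl⟩
  refine ⟨y, hy, fun z hz w => ?_⟩
  have hle : LinearMap.range (LinearMap.lsmul R H (z * y)) ≤
      LinearMap.range (LinearMap.lsmul R H y) := by
    rintro _ ⟨w, rfl⟩
    exact ⟨z • w, by simp [smul_smul, mul_comm]⟩
  have heq := eq_of_le_of_not_lt hle
    (hmin _ ⟨z * y, fun h => ((hp.mem_or_mem h).elim hz hy), rfl⟩)
  have hw : y • w ∈ LinearMap.range (LinearMap.lsmul R H (z * y)) := by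
    rw [heq]; exact ⟨w, rfl⟩
  obtain ⟨w', hw'⟩ := hw
  exact ⟨y • w', by rw [smul_smul]; exact hw'⟩

theorem lsmul_quotient_injective (p : Ideal R) [p.IsPrime] {x : R} (hx : x ∉ p) :
    Function.Injective (LinearMap.lsmul R (R ⧸ p) x) := by
  rw [injective_iff_map_eq_zero]
  intro y hy
  obtain ⟨r, rfl⟩ := Ideal.Quotient.mk_surjective y
  have : Ideal.Quotient.mk p (x * r) = 0 := hy
  rw [Ideal.Quotient.eq_zero_iff_mem] at this ⊢
  exact (Ideal.IsPrime.mem_or_mem ‹_› this).resolve_left hx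

end Degenerate

/-! ### Artinianness and Grothendieck vanishing. -/

section Artinian

variable {R : Type u} [CommRing R] [IsNoetherianRing R] {n : ℕ} (f : Fin n → R)
  (hm : (Ideal.span (Set.range f)).IsMaximal)

omit [IsNoetherianRing R] in
include hm in
theorem eq_span_of_forall_mem {p : Ideal R} (hp : p ≠ ⊤) (h : ∀ j, f j ∈ p) :
    p = Ideal.span (Set.range f) :=
  (hm.eq_of_le hp (Ideal.span_le.2 (by rintro _ ⟨j, rfl⟩; exact h j))).symm

omit [IsNoetherianRing R] in
theorem smul_quotient_eq_zero {p : Ideal R} {x : R} (h : x ∈ p) (m : R ⧸ p) : x • m = 0 := by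
  obtain ⟨r, rfl⟩ := Ideal.Quotient.mk_surjective m
  change Ideal.Quotient.mk p (x * r) = 0
  exact Ideal.Quotient.eq_zero_iff_mem.2 (p.mul_mem_right _ h)

include hm in
/-- The local cohomology of a finitely generated module with support in a maximal ideal is
Artinian. -/
theorem isArtinian_HM (i : ℕ) (M : Type u) [AddCommGroup M] [Module R M] (hM : Module.Finite R M) :
    IsArtinian R (HM f M i) := by
  -- A prime filtration reduces to M = R/p. If all `f j` lie in p, then p is the given maximal ideal
  -- and R/p is simple. Otherwise some `f j` is regular on R/p, which kills degree 0 and lowers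
  -- positive degrees by one.
  induction i generalizing M with
  | zero =>
    refine IsNoetherianRing.induction_on_isQuotientEquivQuotientPrime R hM
      (motive := fun M _ _ _ => IsArtinian R (HM f M 0)) ?_ ?_ ?_
    · intro N _ _ _ _
      infer_instance
    · intro N _ _ _ p e
      have hp := p.2
      suffices IsArtinian R (HM f (R ⧸ p.asIdeal) 0) from
        isArtinian_of_linearEquiv (HM.congr f e 0).symm
      by_cases h : ∀ j, f j ∈ p.asIdeal
      · have h1 := eq_span_of_forall_mem f hm p.2.ne_top h
        have : IsSimpleModule R (R ⧸ p.asIdeal) := by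
          rw [isSimpleModule_iff_isCoatom, h1]; exact hm.out
        exact isArtinian_HM_zero f _
      · push Not at h
        obtain ⟨j, hj⟩ := h
        have := subsingleton_HM_zero f (lsmul_quotient_injective p.asIdeal hj)
        infer_instance
    · intro N₁ _ _ _ N₂ _ _ _ N₃ _ _ _ g h hg hh hgh h1 h3
      exact isArtinian_of_range_eq_ker (HM.map f g 0) (HM.map f h 0)
        (HM.map_exact f g h hg hgh hh 0).linearMap_ker_eq.symm
  | succ i ih =>
    refine IsNoetherianRing.induction_on_isQuotientEquivQuotientPrime R hM
      (motive := fun M _ _ _ => IsArtinian R (HM f M (i + 1))) ?_ ?_ ?_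
    · intro N _ _ _ _
      infer_instance
    · intro N _ _ _ p e
      have hp := p.2
      suffices IsArtinian R (HM f (R ⧸ p.asIdeal) (i + 1)) from
        isArtinian_of_linearEquiv (HM.congr f e (i + 1)).symm
      by_cases h : ∀ j, f j ∈ p.asIdeal
      · have := subsingleton_HM_succ f (R ⧸ p.asIdeal) (fun j => smul_quotient_eq_zero (h j)) i
        exact isArtinian_HM_of_subsingleton f (i + 1)
      · push Not at h
        obtain ⟨j, hj⟩ := h
        have := ih ((R ⧸ p.asIdeal) ⧸ LinearMap.range (LinearMap.lsmul R (R ⧸ p.asIdeal) (f j)))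
          inferInstance
        exact isArtinian_HM_succ_of_quotient f (lsmul_quotient_injective p.asIdeal hj) i
    · intro N₁ _ _ _ N₂ _ _ _ N₃ _ _ _ g h hg hh hgh h1 h3
      exact isArtinian_of_range_eq_ker (HM.map f g (i + 1)) (HM.map f h (i + 1))
        (HM.map_exact f g h hg hgh hh (i + 1)).linearMap_ker_eq.symm

omit [IsNoetherianRing R] in
theorem subsingleton_of_exact {A B C : Type*} [AddCommGroup A] [AddCommGroup B] [AddCommGroup C]
    [Module R A] [Module R B] [Module R C] {g : A →ₗ[R] B} {h : B →ₗ[R] C}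
    (hgh : Function.Exact g h) [Subsingleton A] [Subsingleton C] : Subsingleton B := by
  have : ∀ y : B, y = 0 := fun y => by
    obtain ⟨a, rfl⟩ := (hgh y).1 (Subsingleton.elim _ _)
    rw [Subsingleton.elim a 0, map_zero]
  exact ⟨fun a b => (this a).trans (this b).symm⟩

-- The dimension drop used in all inductions: a prime in the support of N contains p and also x ∉ p,
-- so it lies strictly above p.
omit [IsNoetherianRing R] in
theorem coheight_lt_of_mem_support {N : Type u} [AddCommGroup N] [Module R N] [Module.Finite R N]
    (p : PrimeSpectrum R) (hp : p.asIdeal ≤ Module.annihilator R N) {x : R} (hx : x ∉ p.asIdeal)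
    (hxN : x ∈ Module.annihilator R N) {k : ℕ} (hk : Order.coheight p < k + 1)
    {q : PrimeSpectrum R} (hq : q ∈ Module.support R N) : Order.coheight q < k := by
  rw [Module.mem_support_iff_of_finite] at hq
  have hpq : p < q := lt_of_le_of_ne (hp.trans hq) (by rintro rfl; exact hx (hq hxN))
  have h1 := Order.coheight_add_one_le hpq
  have h2 : Order.coheight q + 1 < k + 1 := lt_of_le_of_lt h1 hk
  exact lt_of_add_lt_add_right h2

omit [IsNoetherianRing R] in
theorem le_annihilator_quotient_range {M : Type u} [AddCommGroup M] [Module R M] (g : M →ₗ[R] M) :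
    Module.annihilator R M ≤ Module.annihilator R (M ⧸ LinearMap.range g) :=
  (LinearMap.range g).mkQ.annihilator_le_of_surjective (Submodule.mkQ_surjective _)

omit [IsNoetherianRing R] in
theorem mem_annihilator_quotient_range {M : Type u} [AddCommGroup M] [Module R M] (x : R) :
    x ∈ Module.annihilator R (M ⧸ LinearMap.range (LinearMap.lsmul R M x)) := by
  rw [Module.mem_annihilator]
  intro m
  obtain ⟨m, rfl⟩ := Submodule.mkQ_surjective _ m
  rw [← map_smul, Submodule.mkQ_apply, Submodule.Quotient.mk_eq_zero]
  exact ⟨m, rfl⟩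

/-- Grothendieck's vanishing theorem. -/
theorem subsingleton_HM_of_coheight_lt (k : ℕ) (M : Type u) [AddCommGroup M] [Module R M]
    (hM : Module.Finite R M) (hk : ∀ q ∈ Module.support R M, Order.coheight q < k)
    (i : ℕ) (hi : k ≤ i) : Subsingleton (HM f M i) := by
  induction k generalizing M i with
  | zero =>
    have : Subsingleton M := by
      rw [← Module.support_eq_empty_iff (R := R), Set.eq_empty_iff_forall_notMem]
      intro q hq
      exact not_lt_zero (by exact_mod_cast hk q hq)
    infer_instance
  | succ k ih =>
    -- The support bound is part of the motive because it passes to submodules and quotients along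
    -- the filtration.
    revert hk
    refine IsNoetherianRing.induction_on_isQuotientEquivQuotientPrime R hM
      (motive := fun M _ _ _ => (∀ q ∈ Module.support R M, Order.coheight q < (k + 1 : ℕ)) →
        Subsingleton (HM f M i)) ?_ ?_ ?_
    · intro N _ _ _ _ _
      infer_instance
    · intro N _ _ _ p e hN
      have hp := p.2
      have hpk : Order.coheight p < (k + 1 : ℕ) := by
        refine hN p ?_
        rw [Module.mem_support_iff_of_finite, e.annihilator_eq, Ideal.annihilator_quotient]
      suffices Subsingleton (HM f (R ⧸ p.asIdeal) i) from (HM.congr f e i).toEquiv.subsingleton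
      obtain ⟨i, rfl⟩ : ∃ i', i = i' + 1 := ⟨i - 1, by omega⟩
      by_cases h : ∀ j, f j ∈ p.asIdeal
      · exact subsingleton_HM_succ f (R ⧸ p.asIdeal) (fun j => smul_quotient_eq_zero (h j)) i
      · push Not at h
        obtain ⟨j, hj⟩ := h
        have := ih ((R ⧸ p.asIdeal) ⧸ LinearMap.range (LinearMap.lsmul R (R ⧸ p.asIdeal) (f j)))
          inferInstance
          (fun q hq => coheight_lt_of_mem_support p
            ((Ideal.annihilator_quotient (I := p.asIdeal)).ge.trans
              (le_annihilator_quotient_range _)) hj (mem_annihilator_quotient_range _)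
            (by exact_mod_cast hpk) hq)
          i (by omega)
        exact subsingleton_HM_succ_of_quotient f (lsmul_quotient_injective p.asIdeal hj) i
    · intro N₁ _ _ _ N₂ _ _ _ N₃ _ _ _ g h hg hh hgh h1 h3 h2
      have := h1 fun q hq => h2 q (Module.support_subset_of_injective g hg hq)
      have := h3 fun q hq => h2 q (Module.support_subset_of_surjective h hh hq)
      exact subsingleton_of_exact (HM.map_exact f g h hg hgh hh i)

end Artinian

/-! ### Grothendieck's nonvanishing theorem. -/

section Nonvanishing

variable {R : Type u} [CommRing R] [IsNoetherianRing R] {n : ℕ} (f : Fin n → R)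
  (hm : (Ideal.span (Set.range f)).IsMaximal)

/-- The obstruction is H^{d+1} of the kernel q/p. For x ∈ q \ p, multiplication by x embeds R/p in
q/p with cokernel of dimension at most d, so this group sits between H^{d+1}(R/p) = 0 and a group
that vanishes for dimension reasons. -/
theorem HM.map_factor_surjective {p q : PrimeSpectrum R} (hpq : p < q) {d : ℕ}
    (hp : Order.coheight p ≤ d + 1) [Subsingleton (HM f (R ⧸ p.asIdeal) (d + 1))] :
    Function.Surjective
      (HM.map f (Submodule.factor (show p.asIdeal ≤ q.asIdeal from hpq.le)) d) := by
  have := p.2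
  set φ : (R ⧸ p.asIdeal) →ₗ[R] R ⧸ q.asIdeal :=
    Submodule.factor (show p.asIdeal ≤ q.asIdeal from hpq.le)
  have hφ : Function.Surjective φ := Submodule.factor_surjective _
  obtain ⟨δ, hδ, -⟩ := HM.exists_connecting f (LinearMap.ker φ).subtype φ
    Subtype.val_injective (LinearMap.exact_subtype_ker_map φ) hφ d
  suffices Subsingleton (HM f (LinearMap.ker φ) (d + 1)) from fun y =>
    (hδ y).1 (Subsingleton.elim _ _)
  obtain ⟨x, hxq, hxp⟩ := SetLike.exists_of_lt (show p.asIdeal < q.asIdeal from hpq)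
  let μ : (R ⧸ p.asIdeal) →ₗ[R] LinearMap.ker φ :=
    (LinearMap.lsmul R (R ⧸ p.asIdeal) x).codRestrict _ fun a => by
      rw [LinearMap.mem_ker, LinearMap.lsmul_apply, map_smul]
      exact smul_quotient_eq_zero hxq _
  have hμ : Function.Injective μ := fun a b hab =>
    lsmul_quotient_injective p.asIdeal hxp (congrArg Subtype.val hab)
  have hN := subsingleton_HM_of_coheight_lt f (d + 1) (LinearMap.ker φ ⧸ LinearMap.range μ)
    inferInstance (fun q' hq' => coheight_lt_of_mem_support p (fun a ha => by
        rw [Module.mem_annihilator]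
        intro m
        obtain ⟨m, rfl⟩ := Submodule.mkQ_surjective _ m
        rw [← map_smul]
        have : a • m = 0 := Subtype.ext (smul_quotient_eq_zero ha m.1)
        rw [this, LinearMap.map_zero]) hxp (by
        rw [Module.mem_annihilator]
        intro m
        obtain ⟨m, rfl⟩ := Submodule.mkQ_surjective _ m
        rw [← map_smul, Submodule.mkQ_apply, Submodule.Quotient.mk_eq_zero]
        exact ⟨m.1, rfl⟩)
      (lt_of_le_of_lt hp (by exact_mod_cast Nat.lt_succ_self _)) hq') (d + 1) le_rfl
  exact subsingleton_of_exact (HM.map_exact f μ (LinearMap.range μ).mkQ hμ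
    (LinearMap.exact_map_mkQ_range _) (Submodule.mkQ_surjective _) (d + 1))

/-- Multiplication by z is injective on R/q with cokernel of dimension less than d, whose H^d
vanishes. -/
theorem HM.smul_surjective {q : PrimeSpectrum R} {z : R} (hz : z ∉ q.asIdeal) {d : ℕ}
    (hq : Order.coheight q ≤ d) (y : HM f (R ⧸ q.asIdeal) d) : ∃ y', z • y' = y := by
  have := q.2
  have hN := subsingleton_HM_of_coheight_lt f d
    ((R ⧸ q.asIdeal) ⧸ LinearMap.range (LinearMap.lsmul R (R ⧸ q.asIdeal) z))
    inferInstance (fun q' hq' => coheight_lt_of_mem_support q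
      ((Ideal.annihilator_quotient (I := q.asIdeal)).ge.trans (le_annihilator_quotient_range _)) hz
      (mem_annihilator_quotient_range _) (lt_of_le_of_lt hq (by exact_mod_cast Nat.lt_succ_self _))
      hq') d le_rfl
  obtain ⟨y', hy'⟩ := (HM.map_exact f _ _ (lsmul_quotient_injective q.asIdeal hz)
    (exact_lsmul_mkQ z) (Submodule.mkQ_surjective _) d y).1 (Subsingleton.elim _ _)
  exact ⟨y', by rw [← hy', HM.map_lsmul]⟩

/-- In a chain of primes of maximal length starting from `l.head` the second prime can be chosen
to avoid a given element outside `l.head`. -/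
theorem exists_ltSeries_notMem_one {d : ℕ} (l : LTSeries (PrimeSpectrum R))
    (hl : l.length = d + 2) (hmax : l.last.asIdeal.IsMaximal)
    (hco : Order.coheight l.head ≤ (d + 2 : ℕ)) {y : R} (hy : y ∉ l.head.asIdeal) :
    ∃ q : LTSeries (PrimeSpectrum R), q.length = d + 2 ∧ q.head = l.head ∧ q.last = l.last ∧
      y ∉ (q 1).asIdeal ∧ ∃ z ∈ (q 1).asIdeal, z ∉ l.head.asIdeal := by
  set I := l.head.asIdeal ⊔ Ideal.span {y} with hI
  have hyI : y ∈ I := le_sup_right (α := Ideal R) (Ideal.mem_span_singleton_self y)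
  have hstep : ∀ q : LTSeries (PrimeSpectrum R), q.length = d + 2 → q.head < q 1 ∧
      ∃ t : LTSeries (PrimeSpectrum R), t.length = d + 1 ∧ t.head = q 1 ∧ t.last = q.last := by
    intro q hq
    have hq0 : q.length ≠ 0 := by omega
    have hlt : (0 : Fin (q.length + 1)) < 1 := by
      rw [Fin.lt_def, Fin.val_one', Fin.val_zero, Nat.mod_eq_of_lt (by omega)]
      exact Nat.one_pos
    exact ⟨q.strictMono hlt, q.tail hq0, by rw [RelSeries.tail_length, hq]; rfl,
      RelSeries.head_tail _ _, RelSeries.last_tail _ _⟩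
  have hlm : ¬ l.last.asIdeal ≤ l.head.asIdeal :=
    not_le_of_gt (show l.head < l.last from l.strictMono (by
      rw [Fin.lt_def, Fin.val_last, Fin.val_zero]; omega))
  -- Prime avoidance could fail only if the last prime were minimal over I = head + (y). But a chain
  -- whose second prime contains y puts a prime strictly between, as the length is at least 2.
  have hex : ∃ z ∈ l.last.asIdeal, ∀ p ∈ insert l.head.asIdeal I.minimalPrimes, z ∉ p := by
    by_contra hcon
    push Not at hcon
    have hsub : (l.last.asIdeal : Set R) ⊆ ⋃ p ∈ insert l.head.asIdeal I.minimalPrimes, (p : Set R) := fun z hz => by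
      obtain ⟨p, hp, hzp⟩ := hcon z hz
      exact Set.mem_biUnion hp hzp
    obtain ⟨p, hp, hle⟩ := (Ideal.subset_union_prime_finite
      ((Ideal.finite_minimalPrimes_of_isNoetherianRing R I).insert _) (f := id) ⊥ ⊥
      fun p hp _ _ => hp.elim (fun h => h ▸ l.head.2) fun h => h.1.1).1 hsub
    replace hp := hp.resolve_left (by rintro rfl; exact hlm hle)
    have hpm : l.last.asIdeal = p := hmax.eq_of_le hp.1.1.ne_top hle
    obtain ⟨q, hyq, hql, hqh, hqlast⟩ := PrimeSpectrum.exist_ltSeries_mem_one_of_mem_last l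
      (x := y) (by rw [hpm]; exact hp.1.2 hyI)
    obtain ⟨hlt, t, ht, hth, htl⟩ := hstep q (by omega)
    have h1 : t.head < t.last := t.strictMono (by
      rw [Fin.lt_def, Fin.val_last, Fin.val_zero]; omega)
    rw [hth, htl, ← hqlast] at h1
    have h2 : I ≤ (q 1).asIdeal := by
      rw [hI, sup_le_iff, Ideal.span_singleton_le_iff_mem]
      exact ⟨by rw [hqh]; exact hlt.le, hyq⟩
    have h3 := hp.2 ⟨(q 1).2, h2⟩ (by
      rw [← hpm]; exact h1.le)
    rw [← hpm] at h3
    exact h1.not_ge h3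
  obtain ⟨z, hz, hzp⟩ := hex
  obtain ⟨q, hzq, hql, hqh, hqlast⟩ := PrimeSpectrum.exist_ltSeries_mem_one_of_mem_last l hz
  obtain ⟨hlt, t, ht, hth, htl⟩ := hstep q (by omega)
  refine ⟨q, by omega, hqh.symm, hqlast.symm, fun hyq => ?_, z, hzq, fun hz0 => ?_⟩
  -- If y were in the second prime, a minimal prime of I would fit strictly between the head and
  -- that prime, since it avoids z, and the chain would exceed the coheight of the head.
  · obtain ⟨p, hp, hpq⟩ := Ideal.exists_minimalPrimes_le (I := I) (J := (q 1).asIdeal) (by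
      rw [hI, sup_le_iff, Ideal.span_singleton_le_iff_mem]
      exact ⟨by rw [hqh]; exact hlt.le, hyq⟩)
    let p' : PrimeSpectrum R := ⟨p, hp.1.1⟩
    have h1 : p' < q 1 := lt_of_le_of_ne hpq fun h => hzp p (Or.inr hp) (by
      have : p = (q 1).asIdeal := congrArg PrimeSpectrum.asIdeal h
      rw [this]; exact hzq)
    have h2 : l.head < p' := lt_of_le_of_ne ((le_sup_left (α := Ideal R)).trans hp.1.2) fun h => hy (by
      rw [h]; exact hp.1.2 hyI)
    have h3 : ((d + 1 : ℕ) : ℕ∞) ≤ Order.coheight (q 1) := by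
      rw [← ht]; exact Order.length_le_coheight hth.ge
    have h4 := Order.coheight_add_one_le h1
    have h5 := Order.coheight_add_one_le h2
    have h6 : ((d + 1 : ℕ) : ℕ∞) + 1 + 1 ≤ ((d + 2 : ℕ) : ℕ∞) :=
      ((add_le_add_left (add_le_add_left h3 1) 1).trans (add_le_add_left h4 1)).trans (h5.trans hco)
    have h7 : d + 1 + 1 + 1 ≤ d + 2 := by exact_mod_cast h6
    omega
  · exact hzp _ (Or.inl rfl) hz0

include hm in
/-- Grothendieck's nonvanishing theorem for `R ⧸ p`. -/
theorem nontrivial_HM_quotient (d : ℕ) (l : LTSeries (PrimeSpectrum R)) (hl : l.length = d)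
    (hlast : l.last.asIdeal = Ideal.span (Set.range f)) (hco : Order.coheight l.head ≤ d) :
    Nontrivial (HM f (R ⧸ l.head.asIdeal) d) := by
  induction d generalizing l with
  | zero =>
    have h : l.head = l.last := by
      simp only [RelSeries.head, RelSeries.last]
      congr 1
      exact Fin.ext (by simp [hl])
    have : Nontrivial (R ⧸ l.head.asIdeal) := Ideal.Quotient.nontrivial_iff.2 l.head.2.ne_top
    refine nontrivial_HM_zero f _ fun j => smul_quotient_eq_zero ?_
    rw [h, hlast]
    exact Ideal.subset_span ⟨j, rfl⟩
  | succ d ih =>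
    by_contra hcon
    rw [not_nontrivial_iff_subsingleton] at hcon
    have hp := l.head.2
    have hl0 : l.length ≠ 0 := by omega
    -- If H^{d+1}(R/p) = 0 for p = `l.head`, then H^d(R/p) maps onto the nonzero H^d(R/q₁) for the
    -- second prime q₁ of every chain of this length with the same ends.
    have key : ∀ q : LTSeries (PrimeSpectrum R), q.length = d + 1 → q.head = l.head →
        q.last = l.last → ∀ hlt : l.head < q 1, Function.Surjective
          (HM.map f (Submodule.factor (show l.head.asIdeal ≤ (q 1).asIdeal from hlt.le)) d) ∧
          Nontrivial (HM f (R ⧸ (q 1).asIdeal) d) ∧ Order.coheight (q 1) ≤ d := by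
      intro q hq hqh hqlast hlt
      have hco1 : Order.coheight (q 1) ≤ d := by
        have := (Order.coheight_add_one_le hlt).trans hco
        push_cast at this
        exact (ENat.add_le_add_iff_right ENat.one_ne_top).1 this
      refine ⟨HM.map_factor_surjective f hlt (by exact_mod_cast hco), ?_, hco1⟩
      have hq0 : q.length ≠ 0 := by omega
      have h1 := ih (q.tail hq0) (by rw [RelSeries.tail_length, hq]; rfl)
        (by rw [RelSeries.last_tail, hqlast, hlast]) (by rw [RelSeries.head_tail]; exact hco1)
      rwa [RelSeries.head_tail] at h1
    have hlt : ∀ q : LTSeries (PrimeSpectrum R), q.length = d + 1 → q.head < q 1 := by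
      intro q hq
      refine q.strictMono (a := 0) (b := 1) ?_
      rw [Fin.lt_def, Fin.val_one', Fin.val_zero, Nat.mod_eq_of_lt (by omega)]
      exact Nat.one_pos
    cases d with
    | zero =>
      obtain ⟨hs, hn, -⟩ := key l hl rfl rfl (hlt l hl)
      have hlm : l.head < l.last := l.strictMono (by
        rw [Fin.lt_def, Fin.val_last, Fin.val_zero]; omega)
      obtain ⟨j, hj⟩ : ∃ j, f j ∉ l.head.asIdeal := by
        by_contra h
        push Not at h
        have h1 := eq_span_of_forall_mem f hm hp.ne_top h
        rw [← hlast] at h1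
        exact hlm.ne (PrimeSpectrum.ext h1)
      have := subsingleton_HM_zero f (lsmul_quotient_injective l.head.asIdeal hj)
      have := hs.subsingleton
      exact not_subsingleton _ this
    | succ d =>
      have hart := isArtinian_HM f hm (d + 1) (R ⧸ l.head.asIdeal) inferInstance
      obtain ⟨y, hy, hyz⟩ := exists_smul_eq_smul_of_isArtinian
        (H := HM f (R ⧸ l.head.asIdeal) (d + 1)) l.head.asIdeal
      obtain ⟨q, hql, hqh, hqlast, hyq, z, hzq, hz0⟩ := exists_ltSeries_notMem_one l hl
        (by rw [hlast]; exact hm) hco hy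
      have hlt' : l.head < q 1 := by rw [← hqh]; exact hlt q hql
      obtain ⟨hs, hn, hcoq⟩ := key q hql hqh hqlast hlt'
      -- Lift u = y u' to y w in the cohomology of R/p. There y w is divisible by z, and z ∈ q₁
      -- kills the cohomology of R/q₁, so u = 0.
      obtain ⟨u, hu⟩ := exists_ne (0 : HM f (R ⧸ (q 1).asIdeal) (d + 1))
      obtain ⟨u', rfl⟩ := HM.smul_surjective f hyq hcoq u
      obtain ⟨w, rfl⟩ := hs u'
      obtain ⟨w', hw'⟩ := hyz z hz0 w
      rw [← map_smul, ← hw', map_smul] at hu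
      exact hu (HM.smul_eq_zero f (smul_quotient_eq_zero hzq) _ _)

end Nonvanishing

/-! ### Comparison with the local cohomology of the ring. -/

section LocalCohomologyEquiv

variable {R : Type u} [CommRing R] {n : ℕ} (f : Fin n → R)

theorem cechCoboundaries_eq (i : ℕ) : cechCoboundaries f i = coboundaries (cechDiff f) i := by
  cases i <;> rfl

/-- The local cohomology of the ring as an instance of the local cohomology of a module. -/
noncomputable def localCohomologyEquiv (i : ℕ) : HM f R i ≃ₗ[R] LocalCohomology f i :=
  (cohEquiv (dC := cechDiffM f R) (dD := cechDiff f) (fun i => TensorProduct.lid R _)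
    (fun i x => by
      induction x with
      | zero => simp
      | tmul a c => simp [cechDiffM]
      | add x y hx hy => simp only [map_add, hx, hy]) i) ≪≫ₗ
  Submodule.quotEquivOfEq _ _ (by rw [cechCoboundaries_eq]; rfl)

end LocalCohomologyEquiv

/-! ### The action of Frobenius: injectivity for pure maps, spanning in top degree. -/

section Frobenius

variable {R : Type u} [CommRing R]

/-- A ring endomorphism raising each element to some positive power, such as an iterate of the
Frobenius endomorphism. -/
def IsPowerHom (φ : R →+* R) : Prop := ∀ r, ∃ k : ℕ, φ r = r ^ (k + 1)

/-- The ring `R` regarded as an `R`-algebra through `φ`. -/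
@[nolint unusedArguments]
def Twist (_φ : R →+* R) : Type u := R

namespace Twist

variable (φ : R →+* R)

instance : CommRing (Twist φ) := inferInstanceAs (CommRing R)

instance : Algebra R (Twist φ) := φ.toAlgebra

/-- The identification of `R` with its twist. -/
def of : R ≃+* Twist φ := RingEquiv.refl R

theorem smul_def (r : R) (m : Twist φ) : r • m = of φ (φ r * (of φ).symm m) := rfl

theorem symm_smul (r : R) (m : Twist φ) : (of φ).symm (r • m) = φ r * (of φ).symm m := rfl

theorem symm_add (m m' : Twist φ) :
    (of φ).symm (m + m') = (of φ).symm m + (of φ).symm m' := rfl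

end Twist

variable {φ : R →+* R} (hφ : IsPowerHom φ)

include hφ in
theorem IsPowerHom.isUnit (g : R) (y : Submonoid.powers g) :
    IsUnit (((algebraMap R (Localization.Away g)).comp φ) y) := by
  obtain ⟨k, hk⟩ := hφ y
  rw [RingHom.comp_apply, hk, map_pow]
  exact (IsLocalization.map_units (Localization.Away g) y).pow _

/-- The endomorphism of the localization `R_g` induced by `φ`. -/
noncomputable def locHom (g : R) : Localization.Away g →+* Localization.Away g :=
  IsLocalization.lift (hφ.isUnit g)

theorem locHom_algebraMap (g r : R) :
    locHom hφ g (algebraMap R _ r) = algebraMap R _ (φ r) :=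
  IsLocalization.lift_eq _ _

theorem locHom_smul (g r : R) (x : Localization.Away g) :
    locHom hφ g (r • x) = φ r • locHom hφ g x := by
  rw [Algebra.smul_def, map_mul, locHom_algebraMap, ← Algebra.smul_def]

theorem locHom_comm {g h : R} (ψ : Localization.Away g →ₐ[R] Localization.Away h)
    (x : Localization.Away g) : ψ (locHom hφ g x) = locHom hφ h (ψ x) := by
  have : (ψ : Localization.Away g →+* Localization.Away h).comp (locHom hφ g) =
      (locHom hφ h).comp (ψ : Localization.Away g →+* Localization.Away h) := by
    refine IsLocalization.ringHom_ext (Submonoid.powers g) (RingHom.ext fun r => ?_)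
    simp [locHom_algebraMap]
  exact RingHom.congr_fun this x

theorem locHom_mk (g r : R) (s : Submonoid.powers g) (s' : Submonoid.powers g)
    (hs : (s' : R) = φ s) :
    locHom hφ g (Localization.mk r s) = Localization.mk (φ r) s' := by
  rw [Localization.mk_eq_mk', IsLocalization.eq_mk'_iff_mul_eq, hs,
    ← locHom_algebraMap hφ, ← map_mul, IsLocalization.mk'_spec, locHom_algebraMap]

variable {n : ℕ} (f : Fin n → R)

/-- The semilinear endomorphism of the Čech complex induced by `φ`. -/
noncomputable def cechHom (i : ℕ) : CechCochain f i →ₛₗ[φ] CechCochain f i where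
  toFun c s := locHom hφ _ (c s)
  map_add' _ _ := funext fun _ => map_add _ _ _
  map_smul' _ _ := funext fun _ => locHom_smul hφ _ _ _

theorem cechHom_apply (i : ℕ) (c : CechCochain f i) (s : Fin i ↪o Fin n) :
    cechHom hφ f i c s = locHom hφ _ (c s) := rfl

theorem cechDiff_apply (i : ℕ) (c : CechCochain f i) (s : Fin (i + 1) ↪o Fin n) :
    cechDiff f i c s =
      ∑ k : Fin (i + 1), ((-1 : R) ^ (k : ℕ)) • cechRestrict f s k (c (dropIndex s k)) := by
  simp [cechDiff]

theorem cechDiff_cechHom (i : ℕ) (c : CechCochain f i) :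
    cechDiff f i (cechHom hφ f i c) = cechHom hφ f (i + 1) (cechDiff f i c) := by
  funext s
  rw [cechHom_apply, cechDiff_apply, cechDiff_apply, map_sum]
  refine Finset.sum_congr rfl fun k _ => ?_
  rw [locHom_smul, cechHom_apply, locHom_comm, map_pow, map_neg, map_one]

theorem cechHom_mem_coboundaries (i : ℕ) {c : CechCochain f i}
    (hc : c ∈ cechCoboundaries f i) : cechHom hφ f i c ∈ cechCoboundaries f i := by
  cases i with
  | zero =>
    have : c = 0 := hc
    rw [this, map_zero]; exact Submodule.zero_mem _
  | succ i =>
    obtain ⟨b, rfl⟩ := hc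
    exact ⟨cechHom hφ f i b, cechDiff_cechHom hφ f i b⟩

/-- The semilinear endomorphism of the cocycles induced by `φ`. -/
noncomputable def cocycleHom (i : ℕ) : cechCocycles f i →ₛₗ[φ] cechCocycles f i where
  toFun c := ⟨cechHom hφ f i c, by
    have h : cechDiff f i c = 0 := c.2
    change cechDiff f i _ = 0
    rw [cechDiff_cechHom, h, map_zero]⟩
  map_add' c c' := Subtype.ext (map_add _ _ _)
  map_smul' r c := Subtype.ext (LinearMap.map_smulₛₗ _ _ _)

/-- The semilinear endomorphism of local cohomology induced by `φ`. -/
noncomputable def localCohomologyHom (i : ℕ) : LocalCohomology f i →ₛₗ[φ] LocalCohomology f i :=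
  Submodule.mapQ _ _ (cocycleHom hφ f i) fun _ hc => cechHom_mem_coboundaries hφ f i hc

theorem localCohomologyHom_mk (i : ℕ) (c : cechCocycles f i) :
    localCohomologyHom hφ f i (Submodule.Quotient.mk c) =
      Submodule.Quotient.mk (cocycleHom hφ f i c) := rfl

/-- The comparison map from the Čech complex of the twist of `R` to that of `R`. -/
noncomputable def twistMap (i : ℕ) : Twist φ ⊗[R] CechCochain f i →+ CechCochain f i :=
  TensorProduct.liftAddHom
    { toFun := fun m => (DistribSMul.toAddMonoidHom _ ((Twist.of φ).symm m)).comp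
        (cechHom hφ f i).toAddMonoidHom
      map_zero' := by ext; simp
      map_add' := fun m m' => by
        refine AddMonoidHom.ext fun c => ?_
        change (Twist.of φ).symm (m + m') • cechHom hφ f i c = (Twist.of φ).symm m • _ +
          (Twist.of φ).symm m' • _
        rw [Twist.symm_add, add_smul]; rfl }
    (fun r m c => by
      change (Twist.of φ).symm (r • m) • cechHom hφ f i c =
        (Twist.of φ).symm m • cechHom hφ f i (r • c)
      rw [Twist.symm_smul, LinearMap.map_smulₛₗ, smul_smul, mul_comm])

theorem twistMap_tmul (i : ℕ) (m : Twist φ) (c : CechCochain f i) :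
    twistMap hφ f i (m ⊗ₜ c) = (Twist.of φ).symm m • cechHom hφ f i c := rfl

theorem twistMap_cechDiffM (i : ℕ) (z : Twist φ ⊗[R] CechCochain f i) :
    twistMap hφ f (i + 1) (cechDiffM f _ i z) = cechDiff f i (twistMap hφ f i z) := by
  induction z with
  | zero => simp
  | tmul m c =>
    rw [cechDiffM, LinearMap.lTensor_tmul, twistMap_tmul, twistMap_tmul, map_smul,
      cechDiff_cechHom]
  | add x y hx hy => simp only [map_add, hx, hy]

/-- The analogue of `twistMap` on a single localization. -/
noncomputable def twistTerm (g : R) :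
    Twist φ ⊗[R] Localization.Away g →+ Localization.Away g :=
  TensorProduct.liftAddHom
    { toFun := fun m => (DistribSMul.toAddMonoidHom _ ((Twist.of φ).symm m)).comp
        (locHom hφ g).toAddMonoidHom
      map_zero' := by ext; simp
      map_add' := fun m m' => by
        refine AddMonoidHom.ext fun c => ?_
        change (Twist.of φ).symm (m + m') • locHom hφ g c = (Twist.of φ).symm m • _ +
          (Twist.of φ).symm m' • _
        rw [Twist.symm_add, add_smul]; rfl }
    (fun r m c => by
      change (Twist.of φ).symm (r • m) • locHom hφ g c =
        (Twist.of φ).symm m • locHom hφ g (r • c)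
      rw [Twist.symm_smul, locHom_smul, smul_smul, mul_comm])

theorem twistTerm_tmul (g : R) (m : Twist φ) (x : Localization.Away g) :
    twistTerm hφ g (m ⊗ₜ x) = (Twist.of φ).symm m • locHom hφ g x := rfl

theorem twistTerm_smul (g r : R) (z : Twist φ ⊗[R] Localization.Away g) :
    twistTerm hφ g (r • z) = φ r • twistTerm hφ g z := by
  induction z with
  | zero => simp
  | tmul m c =>
    rw [TensorProduct.smul_tmul', twistTerm_tmul, twistTerm_tmul, Twist.symm_smul, mul_smul]
  | add x y hx hy => simp only [smul_add, map_add, hx, hy]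

theorem isUnit_smul_injective {A M : Type*} [CommRing A] [Algebra R A] [AddCommGroup M]
    [Module R M] {g : R} (hg : IsUnit (algebraMap R A g)) (z : M ⊗[R] A) (hz : g • z = 0) :
    z = 0 := by
  obtain ⟨w, hw⟩ := hg.exists_right_inv
  have h : ∀ z : M ⊗[R] A, (LinearMap.mulLeft R w).lTensor M (g • z) = z := by
    intro z
    induction z with
    | zero => simp
    | tmul m a =>
      rw [← TensorProduct.tmul_smul, LinearMap.lTensor_tmul, LinearMap.mulLeft_apply,
        Algebra.smul_def, mul_left_comm, ← mul_assoc, hw, one_mul]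
    | add x y hx hy => rw [smul_add, map_add, hx, hy]
  rw [← h z, hz, map_zero]

theorem exists_pow_smul_eq_tmul_one {M : Type*} [AddCommGroup M] [Module R M] (g : R)
    (z : M ⊗[R] Localization.Away g) : ∃ (k : ℕ) (m : M), g ^ k • z = m ⊗ₜ 1 := by
  obtain ⟨⟨y, ⟨_, k, rfl⟩⟩, hy⟩ := IsLocalizedModule.surj (Submonoid.powers g)
    ((Algebra.linearMap R (Localization.Away g)).lTensor M) z
  obtain ⟨m, rfl⟩ := (TensorProduct.rid R M).symm.surjective y
  refine ⟨k, m, hy.trans ?_⟩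
  simp

/-- Clearing denominators turns z into m ⊗ 1, with image m in R_g. If this is zero then g^N m = 0 in
R, and g^N, acting through φ as a positive power of itself, already kills m in the twist. -/
theorem twistTerm_injective (g : R) : Function.Injective (twistTerm hφ g) := by
  rw [injective_iff_map_eq_zero]
  intro z hz
  obtain ⟨k, m, hm⟩ := exists_pow_smul_eq_tmul_one g z
  have h0 : algebraMap R (Localization.Away g) ((Twist.of φ).symm m) = 0 := by
    have := twistTerm_smul hφ g (g ^ k) z
    rw [hz, smul_zero, hm, twistTerm_tmul, map_one, Algebra.smul_def, mul_one] at this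
    exact this
  obtain ⟨⟨_, N, rfl⟩, hN⟩ := (IsLocalization.map_eq_zero_iff (Submonoid.powers g) _ _).1 h0
  have hN' : g ^ N * (Twist.of φ).symm m = 0 := hN
  obtain ⟨l, hl⟩ := hφ (g ^ N)
  have hm0 : g ^ N • m = 0 := by
    rw [Twist.smul_def, hl, pow_succ, mul_assoc, hN', mul_zero, map_zero]
  have hunit : ∀ j, IsUnit (algebraMap R (Localization.Away g) (g ^ j)) := fun j => by
    rw [map_pow]; exact (IsLocalization.Away.algebraMap_isUnit g).pow j
  refine isUnit_smul_injective (hunit (N + k)) z ?_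
  rw [pow_add, mul_smul, hm, TensorProduct.smul_tmul', hm0, TensorProduct.zero_tmul]

/-- Enlarge the denominator of r/gᵏ to (gᵏ)^{l+1} = φ(gᵏ). -/
theorem twistTerm_surjective (g : R) : Function.Surjective (twistTerm hφ g) := by
  intro y
  obtain ⟨k, r, hr⟩ := IsLocalization.Away.surj g y
  obtain ⟨w, hw⟩ := ((IsLocalization.Away.algebraMap_isUnit (S := Localization.Away g) g).pow k)
    |>.exists_right_inv
  obtain ⟨l, hl⟩ := hφ (g ^ k)
  refine ⟨Twist.of φ ((g ^ k) ^ l * r) ⊗ₜ w, ?_⟩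
  rw [twistTerm_tmul, RingEquiv.symm_apply_apply, Algebra.smul_def, map_mul, ← hr]
  have h1 : algebraMap R (Localization.Away g) ((g ^ k) ^ (l + 1)) * locHom hφ g w = 1 := by
    rw [← hl, ← locHom_algebraMap hφ, ← map_mul, map_pow, hw, map_one]
  rw [pow_succ, map_mul, map_pow _ g k] at h1
  linear_combination y * h1

theorem twistMap_apply (i : ℕ) (z : Twist φ ⊗[R] CechCochain f i) (s : Fin i ↪o Fin n) :
    twistMap hφ f i z s = twistTerm hφ _ (cechComp f (Twist φ) s z) := by
  induction z with
  | zero => simp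
  | tmul m c => rfl
  | add x y hx hy => simp only [map_add, Pi.add_apply, hx, hy]

/-- The Čech complex with coefficients in R viewed through φ is the Čech complex of R itself, so
module cohomology can be applied to Frobenius. -/
theorem twistMap_bijective (i : ℕ) : Function.Bijective (twistMap hφ f i) := by
  constructor
  · intro z z' h
    refine cechComp_ext f fun s => twistTerm_injective hφ _ ?_
    rw [← twistMap_apply, ← twistMap_apply, h]
  · intro c
    choose x hx using fun s => twistTerm_surjective hφ _ (c s)
    obtain ⟨z, hz⟩ := exists_cechComp_eq f x
    exact ⟨z, funext fun s => by rw [twistMap_apply, hz, hx]⟩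

theorem IsPureHom.injective {A B : Type u} [CommRing A] [CommRing B] [alg : Algebra A B]
    (h : IsPureHom (algebraMap A B)) (M : Type u) [AddCommGroup M] [Module A M] :
    Function.Injective (fun m : M => (1 : B) ⊗ₜ[A] m) := by
  have : (algebraMap A B).toAlgebra = alg := Algebra.algebra_ext _ _ fun _ => rfl
  unfold IsPureHom at h
  rw [this] at h
  exact h M

/-- A pure power endomorphism acts injectively on local cohomology. -/
theorem localCohomologyHom_injective (hp : IsPureHom φ) (i : ℕ) :
    Function.Injective (localCohomologyHom hφ f i) := by
  have hpure : IsPureHom (algebraMap R (Twist φ)) := hp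
  rw [injective_iff_map_eq_zero]
  intro x hx
  obtain ⟨c, rfl⟩ := Submodule.Quotient.mk_surjective _ x
  rw [localCohomologyHom_mk, Submodule.Quotient.mk_eq_zero] at hx
  have hx' : cechHom hφ f i c ∈ cechCoboundaries f i := hx
  rw [Submodule.Quotient.mk_eq_zero]
  change (c : CechCochain f i) ∈ cechCoboundaries f i
  rw [← Submodule.Quotient.mk_eq_zero]
  -- Purity is applied to cochains modulo coboundaries. A primitive of φ(c) comes from the twisted
  -- complex by `twistMap_bijective`, so 1 ⊗ c is a differential there and dies in the tensored
  -- quotient.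
  refine hpure.injective (CechCochain f i ⧸ cechCoboundaries f i) ?_
  have h1 : twistMap hφ f i ((1 : Twist φ) ⊗ₜ (c : CechCochain f i)) = cechHom hφ f i c := by
    rw [twistMap_tmul, map_one, one_smul]
  suffices h : (cechCoboundaries f i).mkQ.lTensor (Twist φ)
      ((1 : Twist φ) ⊗ₜ (c : CechCochain f i)) = 0 by
    rw [LinearMap.lTensor_tmul] at h
    simpa using h
  cases i with
  | zero =>
    have h2 : cechHom hφ f 0 c = 0 := hx'
    rw [h2] at h1
    rw [(map_eq_zero_iff _ (twistMap_bijective hφ f 0).1).1 h1, map_zero]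
  | succ i =>
    obtain ⟨b, hb⟩ := hx'
    obtain ⟨z, rfl⟩ := (twistMap_bijective hφ f i).2 b
    rw [← twistMap_cechDiffM, ← h1] at hb
    rw [← (twistMap_bijective hφ f (i + 1)).1 hb, cechDiffM, ← LinearMap.lTensor_comp_apply]
    have : (cechCoboundaries f (i + 1)).mkQ ∘ₗ cechDiff f i = 0 := by
      refine LinearMap.ext fun y => ?_
      exact (Submodule.Quotient.mk_eq_zero _).2 ⟨y, rfl⟩
    rw [this, LinearMap.lTensor_zero, LinearMap.zero_apply]

theorem sum_single_tmul {C : Type*} [AddCommGroup C] [Module R C] {m : ℕ}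
    (z : (Fin m → R) ⊗[R] C) :
    z = ∑ j, (Pi.single j 1 : Fin m → R) ⊗ₜ
      TensorProduct.lid R C ((LinearMap.proj j : (Fin m → R) →ₗ[R] R).rTensor C z) := by
  induction z with
  | zero => simp
  | tmul v c =>
    simp only [LinearMap.rTensor_tmul, TensorProduct.lid_tmul, LinearMap.proj_apply]
    simp only [← TensorProduct.smul_tmul, ← TensorProduct.sum_tmul]
    congr 1
    ext j
    simp [Pi.single_apply]
  | add x y hx hy =>
    simp only [map_add, TensorProduct.tmul_add, Finset.sum_add_distrib]
    rw [← hx, ← hy]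

/-- If the local cohomology of the kernel of a surjection vanishes in degree `d + 1`, then cocycles
in degree `d` lift along the surjection up to coboundaries. -/
theorem exists_lift_cocycle {M N : Type u} [AddCommGroup M] [Module R M] [AddCommGroup N]
    [Module R N] (π : M →ₗ[R] N) (hπ : Function.Surjective π) (d : ℕ)
    (hd : Subsingleton (HM f (LinearMap.ker π) (d + 1)))
    (z : N ⊗[R] CechCochain f d) (hz : cechDiffM f N d z = 0) :
    ∃ z' : M ⊗[R] CechCochain f d, cechDiffM f M d z' = 0 ∧
      π.rTensor _ z' - z ∈ coboundaries (cechDiffM f N) d := by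
  obtain ⟨δ, hδ, -⟩ := HM.exists_connecting f (LinearMap.ker π).subtype π
    Subtype.val_injective (LinearMap.exact_subtype_ker_map π) hπ d
  obtain ⟨w, hw⟩ := (hδ (Coh.mk (d := cechDiffM f N) ⟨z, hz⟩)).1 (Subsingleton.elim _ _)
  obtain ⟨z', rfl⟩ := Coh.mk_surjective w
  refine ⟨z', z'.2, ?_⟩
  exact (Submodule.Quotient.eq ((coboundaries (cechDiffM f N) d).submoduleOf
      (LinearMap.ker (cechDiffM f N d)))).1 hw

theorem cechDiff_lid (d : ℕ) (y : R ⊗[R] CechCochain f d) :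
    cechDiff f d (TensorProduct.lid R _ y) = TensorProduct.lid R _ (cechDiffM f R d y) := by
  induction y with
  | zero => simp
  | tmul a c => simp [cechDiffM]
  | add x y hx hy => simp only [map_add, hx, hy]

theorem twistMap_mem_cechCoboundaries (d : ℕ) {y : Twist φ ⊗[R] CechCochain f d}
    (hy : y ∈ coboundaries (cechDiffM f (Twist φ)) d) :
    twistMap hφ f d y ∈ cechCoboundaries f d := by
  cases d with
  | zero =>
    have : y = 0 := hy
    rw [this, map_zero]; exact Submodule.zero_mem _
  | succ d =>
    obtain ⟨b, rfl⟩ := hy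
    exact ⟨twistMap hφ f d b, (twistMap_cechDiffM hφ f d b).symm⟩

/-- If local cohomology vanishes in degree `d + 1`, then local cohomology in degree `d` is spanned
by the image of a finite power endomorphism. -/
theorem exists_eq_sum_localCohomologyHom [IsNoetherianRing R] (hfin : φ.Finite) (d : ℕ)
    (hd : ∀ (M : Type u) [AddCommGroup M] [Module R M], Module.Finite R M →
      Subsingleton (HM f M (d + 1)))
    (x : LocalCohomology f d) :
    ∃ (m : ℕ) (s : Fin m → R) (y : Fin m → LocalCohomology f d),
      x = ∑ j, s j • localCohomologyHom hφ f d (y j) := by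
  have hT : Module.Finite R (Twist φ) := hfin
  obtain ⟨m, π, hπ⟩ := Module.Finite.exists_fin' R (Twist φ)
  obtain ⟨c, rfl⟩ := Submodule.Quotient.mk_surjective _ x
  obtain ⟨z, hz⟩ := (twistMap_bijective hφ f d).2 c
  have hzd : cechDiffM f (Twist φ) d z = 0 := by
    apply (twistMap_bijective hφ f (d + 1)).1
    rw [twistMap_cechDiffM, hz, map_zero]
    exact c.2
  -- The class is lifted along R^m → `Twist φ`; the coordinates of the lift are the required
  -- cocycles of R.
  obtain ⟨z', hz', hdiff⟩ := exists_lift_cocycle f π hπ d (hd (LinearMap.ker π) inferInstance) z hzd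
  let cj : Fin m → CechCochain f d := fun j => TensorProduct.lid R _
    ((LinearMap.proj j : (Fin m → R) →ₗ[R] R).rTensor _ z')
  have hcj : ∀ j, cj j ∈ cechCocycles f d := fun j => by
    change cechDiff f d (cj j) = 0
    rw [cechDiff_lid, ← rTensor_cechDiffM, hz', map_zero, map_zero]
  refine ⟨m, fun j => (Twist.of φ).symm (π (Pi.single j 1)),
    fun j => Submodule.Quotient.mk ⟨cj j, hcj j⟩, ?_⟩
  simp only [localCohomologyHom_mk]
  have hsum : twistMap hφ f d (π.rTensor _ z') =
      ∑ j, (Twist.of φ).symm (π (Pi.single j 1)) • cechHom hφ f d (cj j) := by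
    conv_lhs => rw [sum_single_tmul z']
    simp only [map_sum, LinearMap.rTensor_tmul, twistMap_tmul]
    rfl
  have hmem := twistMap_mem_cechCoboundaries hφ f d hdiff
  rw [map_sub, hz, hsum] at hmem
  symm
  have hmk : ∀ (s : Fin m → R) (c : Fin m → cechCocycles f d),
      ∑ j, s j • (Submodule.Quotient.mk (c j) : LocalCohomology f d) =
        Submodule.Quotient.mk (∑ j, s j • c j) := by
    intro s c
    simp only [← Submodule.mkQ_apply, map_sum, map_smul]
  rw [hmk, Submodule.Quotient.eq]
  change ((∑ j, _ : cechCocycles f d) - c : cechCocycles f d).1 ∈ cechCoboundaries f d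
  convert hmem using 1
  rw [Submodule.coe_sub, Submodule.coe_sum]
  rfl

end Frobenius

/-! ### Gradings given by projections, on products, subgroups and quotients. -/

section Projections

variable {M : Type u} [AddCommGroup M]

/-- The family `π` consists of the projections to the components of a grading `N` of `M`. -/
structure IsProjections (N : ℤ → AddSubgroup M) (π : ℤ → M →+ M) : Prop where
  apply_self : ∀ {α : ℤ} {x : M}, x ∈ N α → π α x = x
  apply_of_ne : ∀ {α β : ℤ} {x : M}, x ∈ N α → β ≠ α → π β x = 0
  mem_iSup : ∀ x : M, x ∈ ⨆ α, N α

namespace IsProjections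

variable {N : ℤ → AddSubgroup M} {π : ℤ → M →+ M} (h : IsProjections N π)
include h

theorem induction {P : M → Prop} (hom : ∀ α, ∀ x ∈ N α, P x) (add : ∀ x y, P x → P y → P (x + y))
    (x : M) : P x :=
  AddSubgroup.iSup_induction N (C := P) (h.mem_iSup x) hom (hom 0 0 (zero_mem _)) add

theorem apply_mem (α : ℤ) (x : M) : π α x ∈ N α := by
  induction x using h.induction with
  | hom β x hx =>
    by_cases hαβ : α = β
    · subst hαβ; rwa [h.apply_self hx]
    · rw [h.apply_of_ne hx hαβ]; exact zero_mem _
  | add x y hx hy => rw [map_add]; exact add_mem hx hy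

theorem exists_eq_sum (x : M) :
    ∃ S : Finset ℤ, (∀ α ∉ S, π α x = 0) ∧ x = ∑ α ∈ S, π α x := by
  classical
  induction x using h.induction with
  | hom β x hx =>
    refine ⟨{β}, fun α hα => h.apply_of_ne hx (by simpa using hα), ?_⟩
    rw [Finset.sum_singleton, h.apply_self hx]
  | add x y hx hy =>
    obtain ⟨S, hS, hS'⟩ := hx
    obtain ⟨S', hS1, hS1'⟩ := hy
    refine ⟨S ∪ S', fun α hα => ?_, ?_⟩
    · rw [Finset.notMem_union] at hα
      rw [map_add, hS α hα.1, hS1 α hα.2, add_zero]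
    · simp only [map_add, Finset.sum_add_distrib]
      rw [← Finset.sum_subset Finset.subset_union_left fun α _ hα => hS α hα,
        ← Finset.sum_subset Finset.subset_union_right fun α _ hα => hS1 α hα, ← hS', ← hS1']

theorem eq_zero {x : M} (hx : ∀ α, π α x = 0) : x = 0 := by
  obtain ⟨S, -, hS⟩ := h.exists_eq_sum x
  rw [hS]; exact Finset.sum_eq_zero fun α _ => hx α

end IsProjections

/-- The projections of a finite product of graded groups. -/
theorem IsProjections.pi {ι : Type*} [Finite ι] {M : ι → Type u} [∀ s, AddCommGroup (M s)]
    {N : ∀ s, ℤ → AddSubgroup (M s)} {π : ∀ s, ℤ → M s →+ M s}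
    (h : ∀ s, IsProjections (N s) (π s)) :
    IsProjections (fun α => AddSubgroup.pi Set.univ fun s => N s α)
      (fun α => AddMonoidHom.pi fun s => (π s α).comp (Pi.evalAddMonoidHom M s)) where
  apply_self hx := funext fun s => (h s).apply_self (hx s trivial)
  apply_of_ne hx hne := funext fun s => (h s).apply_of_ne (hx s trivial) hne
  mem_iSup x := by
    classical
    have := Fintype.ofFinite ι
    rw [← Finset.univ_sum_single x]
    refine sum_mem fun s _ => ?_
    generalize x s = y
    induction y using (h s).induction with
    | hom α y hy =>
      refine AddSubgroup.mem_iSup_of_mem α fun t _ => ?_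
      by_cases hst : t = s
      · subst hst; simpa using hy
      · simp [hst, zero_mem]
    | add y y' hy hy' => rw [Pi.single_add]; exact add_mem hy hy'

/-- The projections of a graded subgroup. -/
theorem IsProjections.restrict {M' : Type w} [AddCommGroup M'] {N : ℤ → AddSubgroup M}
    {π : ℤ → M →+ M} (h : IsProjections N π) (ι : M' →+ M) (hι : Function.Injective ι)
    (π' : ℤ → M' →+ M') (hπ : ∀ α x, ι (π' α x) = π α (ι x)) :
    IsProjections (fun α => (N α).comap ι) π' where
  apply_self hx := hι (by rw [hπ, h.apply_self hx])
  apply_of_ne hx hne := hι (by rw [hπ, h.apply_of_ne hx hne, map_zero])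
  mem_iSup x := by
    obtain ⟨S, -, hS⟩ := h.exists_eq_sum (ι x)
    have : x = ∑ α ∈ S, π' α x := hι (by rw [map_sum, hS]; simp only [hπ, ← hS])
    rw [this]
    refine sum_mem fun α _ => AddSubgroup.mem_iSup_of_mem α ?_
    rw [AddSubgroup.mem_comap, hπ]
    exact h.apply_mem α _

/-- The projections of a graded quotient. -/
theorem IsProjections.map {M' : Type w} [AddCommGroup M'] {N : ℤ → AddSubgroup M}
    {π : ℤ → M →+ M} (h : IsProjections N π) (q : M →+ M') (hq : Function.Surjective q)
    (π' : ℤ → M' →+ M') (hπ : ∀ α x, π' α (q x) = q (π α x)) :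
    IsProjections (fun α => (N α).map q) π' where
  apply_self := by
    rintro α _ ⟨x, hx, rfl⟩
    rw [hπ, h.apply_self hx]
  apply_of_ne := by
    rintro α β _ ⟨x, hx, rfl⟩ hne
    rw [hπ, h.apply_of_ne hx hne, map_zero]
  mem_iSup := by
    intro x
    obtain ⟨x, rfl⟩ := hq x
    rw [← AddSubgroup.map_iSup]
    exact ⟨x, h.mem_iSup x, rfl⟩

end Projections

/-! ### The grading of localizations, the Čech complex and local cohomology. -/

section Grading

open LaurentPolynomial DirectSum

variable {K : Type v} {R : Type u} [Field K] [CommRing R] [Algebra K R]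
  (𝒜 : ℕ → Submodule K R) [GradedAlgebra 𝒜]

/-- The ring homomorphism `R → B[T;T⁻¹]`, `r ↦ ∑ rₙ Tⁿ` for an `R`-algebra `B`. -/
noncomputable def laurentCoaction (B : Type w) [CommRing B] [Algebra R B] : R →+* B[T;T⁻¹] :=
  Polynomial.toLaurent.comp (coaction 𝒜 (algebraMap R B))

theorem laurentCoaction_of_mem (B : Type w) [CommRing B] [Algebra R B] {α : ℤ} {r : R}
    (hr : r ∈ intPiece 𝒜 α) : laurentCoaction 𝒜 B r = C (algebraMap R B r) * T α := by
  cases α with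
  | ofNat n =>
    rw [laurentCoaction, RingHom.comp_apply, coaction_of_mem 𝒜 _ (n := n) hr,
      Polynomial.toLaurent_C_mul_T]
    rfl
  | negSucc n =>
    have : r = 0 := hr
    rw [this]; simp

theorem isUnit_laurentCoaction {g : R} {D : ℕ} (hg : g ∈ 𝒜 D) (y : Submonoid.powers g) :
    IsUnit (laurentCoaction 𝒜 (Localization.Away g) y) := by
  obtain ⟨_, k, rfl⟩ := y
  change IsUnit (laurentCoaction 𝒜 (Localization.Away g) (g ^ k))
  rw [map_pow, laurentCoaction_of_mem 𝒜 _ (α := (D : ℤ)) hg]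
  exact (((IsLocalization.Away.algebraMap_isUnit g).map C).mul (isUnit_T _)).pow k

/-- The extension of `laurentCoaction` to the localization at a homogeneous element. -/
noncomputable def locCoaction {g : R} {D : ℕ} (hg : g ∈ 𝒜 D) :
    Localization.Away g →+* (Localization.Away g)[T;T⁻¹] :=
  IsLocalization.lift (isUnit_laurentCoaction 𝒜 hg)

/-- The projection of the localization at a homogeneous element to its component of degree `α`. -/
noncomputable def locProj {g : R} {D : ℕ} (hg : g ∈ 𝒜 D) (α : ℤ) :
    Localization.Away g →+ Localization.Away g where
  toFun x := (locCoaction 𝒜 hg x).coeff α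
  map_zero' := by simp
  map_add' x y := by simp

/-- Both sides agree after multiplication by the unit sTᵇ. Asking only for x s = r, rather than for
a fraction over a power of g, lets the lemma apply to images in another localization. -/
theorem locCoaction_eq {g : R} {D : ℕ} (hg : g ∈ 𝒜 D) {α : ℤ} {b : ℕ} {r s : R}
    {x : Localization.Away g} (hs : s ∈ 𝒜 b)
    (hu : IsUnit (algebraMap R (Localization.Away g) s)) (hr : r ∈ intPiece 𝒜 (α + b))
    (hx : x * algebraMap R _ s = algebraMap R _ r) :
    locCoaction 𝒜 hg x = C x * T α := by
  have hs' : locCoaction 𝒜 hg (algebraMap R _ s) = C (algebraMap R _ s) * T (b : ℤ) := by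
    rw [locCoaction, IsLocalization.lift_eq, laurentCoaction_of_mem 𝒜 _ (α := (b : ℤ)) hs]
  have hr' : locCoaction 𝒜 hg (algebraMap R _ r) = C (algebraMap R _ r) * T (α + b) := by
    rw [locCoaction, IsLocalization.lift_eq, laurentCoaction_of_mem 𝒜 _ hr]
  refine ((hu.map C).mul (isUnit_T (b : ℤ))).mul_left_injective ?_
  change locCoaction 𝒜 hg x * (_ * _) = _ * (_ * _)
  rw [← hs', ← map_mul, hx, hr', ← hx, hs', map_mul, T_add]
  ring

theorem coeff_C_mul_T {B : Type w} [CommRing B] (x : B) (α β : ℤ) :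
    (C x * T α : B[T;T⁻¹]).coeff β = if β = α then x else 0 := by
  rw [← single_eq_C_mul_T, AddMonoidAlgebra.coeff_single, Finsupp.single_apply]
  simp only [eq_comm]

theorem locProj_self {g : R} {D : ℕ} (hg : g ∈ 𝒜 D) {α : ℤ} {x : Localization.Away g}
    (hx : locCoaction 𝒜 hg x = C x * T α) : locProj 𝒜 hg α x = x := by
  change (locCoaction 𝒜 hg x).coeff α = x
  rw [hx, coeff_C_mul_T, if_pos rfl]

theorem locProj_of_ne {g : R} {D : ℕ} (hg : g ∈ 𝒜 D) {α β : ℤ} {x : Localization.Away g}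
    (hx : locCoaction 𝒜 hg x = C x * T α) (hne : β ≠ α) : locProj 𝒜 hg β x = 0 := by
  change (locCoaction 𝒜 hg x).coeff β = 0
  rw [hx, coeff_C_mul_T, if_neg hne]

theorem mk_mul_algebraMap {g : R} (r : R) (s : Submonoid.powers g) :
    Localization.mk r s * algebraMap R (Localization.Away g) s = algebraMap R _ r := by
  rw [Localization.mk_eq_mk', IsLocalization.mk'_spec]

theorem locCoaction_of_mem {g : R} {D : ℕ} (hg : g ∈ 𝒜 D) {α : ℤ} {x : Localization.Away g}
    (hx : x ∈ localizationPiece 𝒜 g α) : locCoaction 𝒜 hg x = C x * T α := by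
  obtain ⟨b, r, s, hs, hr, rfl⟩ := hx
  exact locCoaction_eq 𝒜 hg hs (IsLocalization.map_units _ s) hr (mk_mul_algebraMap r s)

theorem isProjections_locProj {g : R} {D : ℕ} (hg : g ∈ 𝒜 D) :
    IsProjections (localizationPiece 𝒜 g) (locProj 𝒜 hg) where
  apply_self hx := locProj_self 𝒜 hg (locCoaction_of_mem 𝒜 hg hx)
  apply_of_ne hx hne := locProj_of_ne 𝒜 hg (locCoaction_of_mem 𝒜 hg hx) hne
  mem_iSup x := by
    induction x using Localization.induction_on with
    | _ y =>
    obtain ⟨r, s⟩ := y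
    change Localization.mk r s ∈ _
    obtain ⟨k, hk⟩ := s.2
    have hs : (s : R) ∈ 𝒜 (k • D) := hk ▸ SetLike.pow_mem_graded k hg
    induction r using DirectSum.Decomposition.inductionOn 𝒜 with
    | zero => rw [Localization.mk_zero]; exact zero_mem _
    | homogeneous r =>
      rename_i i
      refine AddSubgroup.mem_iSup_of_mem ((i : ℤ) - (k • D : ℕ)) ⟨k • D, r, s, hs, ?_, rfl⟩
      rw [sub_add_cancel]
      exact r.2
    | add r r' hr hr' => rw [← Localization.add_mk_self]; exact add_mem hr hr'

theorem locProj_comm {g h : R} {D E : ℕ} (hg : g ∈ 𝒜 D) (hh : h ∈ 𝒜 E)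
    (ψ : Localization.Away g →ₐ[R] Localization.Away h) (α : ℤ) (x : Localization.Away g) :
    locProj 𝒜 hh α (ψ x) = ψ (locProj 𝒜 hg α x) := by
  induction x using (isProjections_locProj 𝒜 hg).induction with
  | hom β x hx =>
    have h1 : locCoaction 𝒜 hh (ψ x) = C (ψ x) * T β := by
      obtain ⟨b, r, s, hs, hr, rfl⟩ := hx
      refine locCoaction_eq 𝒜 hh hs ?_ hr ?_
      · rw [← ψ.commutes]
        exact (IsLocalization.map_units _ s).map ψ
      · rw [← ψ.commutes, ← map_mul, mk_mul_algebraMap, ψ.commutes]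
    by_cases hαβ : α = β
    · subst hαβ
      rw [locProj_self 𝒜 hh h1, (isProjections_locProj 𝒜 hg).apply_self hx]
    · rw [locProj_of_ne 𝒜 hh h1 hαβ, (isProjections_locProj 𝒜 hg).apply_of_ne hx hαβ, map_zero]
  | add x y hx hy => simp only [map_add, hx, hy]

theorem smul_mem_localizationPiece {g : R} {α : ℤ} {k : ℕ} {r : R} (hr : r ∈ 𝒜 k)
    {x : Localization.Away g} (hx : x ∈ localizationPiece 𝒜 g α) :
    r • x ∈ localizationPiece 𝒜 g (α + k) := by
  obtain ⟨b, t, s, hs, ht, rfl⟩ := hx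
  refine ⟨b, r • t, s, hs, ?_, Localization.smul_mk r t s⟩
  rw [smul_eq_mul, mul_comm, add_right_comm]
  exact mul_mem_intPiece 𝒜 ht hr

theorem pow_mem_intPiece {α : ℤ} {r : R} (hr : r ∈ intPiece 𝒜 α) (k : ℕ) :
    r ^ (k + 1) ∈ intPiece 𝒜 (((k + 1 : ℕ) : ℤ) * α) := by
  cases α with
  | ofNat n =>
    have : r ^ (k + 1) ∈ 𝒜 ((k + 1) • n) := SetLike.pow_mem_graded (k + 1) hr
    change r ^ (k + 1) ∈ intPiece 𝒜 (((k + 1 : ℕ) : ℤ) * (n : ℤ))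
    rw [← Nat.cast_mul]
    exact this
  | negSucc n =>
    have : r = 0 := hr
    rw [this, zero_pow k.succ_ne_zero]
    exact zero_mem _

theorem locHom_mem_localizationPiece {φ : R →+* R} (hφ : IsPowerHom φ) (k : ℕ)
    (hk : ∀ r, φ r = r ^ (k + 1)) {g : R} {α : ℤ} {x : Localization.Away g}
    (hx : x ∈ localizationPiece 𝒜 g α) :
    locHom hφ g x ∈ localizationPiece 𝒜 g (((k + 1 : ℕ) : ℤ) * α) := by
  obtain ⟨b, r, s, hs, hr, rfl⟩ := hx
  refine ⟨(k + 1) • b, φ r, s ^ (k + 1), SetLike.pow_mem_graded _ hs, ?_,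
    locHom_mk hφ g r s _ (hk s).symm⟩
  rw [hk]
  have := pow_mem_intPiece 𝒜 hr k
  rwa [mul_add, ← Nat.cast_mul] at this

variable {n : ℕ} (f : Fin n → R) {D : Fin n → ℕ} (hD : ∀ j, f j ∈ 𝒜 (D j))

include hD in
theorem prod_mem_graded {i : ℕ} (s : Fin i ↪o Fin n) :
    ∏ k, f (s k) ∈ 𝒜 (∑ k, D (s k)) :=
  SetLike.prod_mem_graded _ _ _ fun k _ => hD (s k)

/-- The projection of the Čech complex to its component of degree `α`. -/
noncomputable def cechProj (i : ℕ) (α : ℤ) : CechCochain f i →+ CechCochain f i :=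
  AddMonoidHom.pi fun s =>
    (locProj 𝒜 (prod_mem_graded 𝒜 f hD s) α).comp (Pi.evalAddMonoidHom (CechTerm f) s)

theorem cechProj_apply (i : ℕ) (α : ℤ) (c : CechCochain f i) (s : Fin i ↪o Fin n) :
    cechProj 𝒜 f hD i α c s = locProj 𝒜 (prod_mem_graded 𝒜 f hD s) α (c s) := rfl

theorem isProjections_cechProj (i : ℕ) :
    IsProjections (fun α => AddSubgroup.pi Set.univ fun s : Fin i ↪o Fin n =>
      localizationPiece 𝒜 (∏ k, f (s k)) α) (cechProj 𝒜 f hD i) :=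
  IsProjections.pi fun s => isProjections_locProj 𝒜 (prod_mem_graded 𝒜 f hD s)

theorem neg_one_pow_smul_comm {M : Type w} [AddCommGroup M] [Module R M] (π : M →+ M) (k : ℕ)
    (x : M) : π (((-1 : R) ^ k) • x) = ((-1 : R) ^ k) • π x := by
  rcases neg_one_pow_eq_or R k with h | h <;> simp [h]

theorem cechProj_cechDiff (i : ℕ) (α : ℤ) (c : CechCochain f i) :
    cechProj 𝒜 f hD (i + 1) α (cechDiff f i c) = cechDiff f i (cechProj 𝒜 f hD i α c) := by
  funext s
  rw [cechProj_apply, cechDiff_apply, cechDiff_apply, map_sum]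
  refine Finset.sum_congr rfl fun k _ => ?_
  rw [neg_one_pow_smul_comm, cechProj_apply, locProj_comm]

/-- The projection of the cocycles to their component of degree `α`. -/
noncomputable def cocycleProj (i : ℕ) (α : ℤ) : cechCocycles f i →+ cechCocycles f i where
  toFun c := ⟨cechProj 𝒜 f hD i α c, by
    have h : cechDiff f i c = 0 := c.2
    change cechDiff f i _ = 0
    rw [← cechProj_cechDiff, h, map_zero]⟩
  map_zero' := Subtype.ext (map_zero _)
  map_add' _ _ := Subtype.ext (map_add _ _ _)

theorem isProjections_cocycleProj (i : ℕ) :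
    IsProjections (homogeneousCocycles 𝒜 f i) (cocycleProj 𝒜 f hD i) :=
  (isProjections_cechProj 𝒜 f hD i).restrict (cechCocycles f i).subtype.toAddMonoidHom
    Subtype.val_injective _ fun _ _ => rfl

theorem cechProj_mem_coboundaries (i : ℕ) (α : ℤ) {c : CechCochain f i}
    (hc : c ∈ cechCoboundaries f i) : cechProj 𝒜 f hD i α c ∈ cechCoboundaries f i := by
  cases i with
  | zero =>
    have : c = 0 := hc
    rw [this, map_zero]; exact Submodule.zero_mem _
  | succ i =>
    obtain ⟨b, rfl⟩ := hc
    exact ⟨cechProj 𝒜 f hD i α b, (cechProj_cechDiff 𝒜 f hD i α b).symm⟩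

/-- The projection of local cohomology to its component of degree `α`. -/
noncomputable def localCohomologyProj (i : ℕ) (α : ℤ) :
    LocalCohomology f i →+ LocalCohomology f i :=
  QuotientAddGroup.map ((cechCoboundaries f i).submoduleOf (cechCocycles f i)).toAddSubgroup
    ((cechCoboundaries f i).submoduleOf (cechCocycles f i)).toAddSubgroup (cocycleProj 𝒜 f hD i α)
    fun _ hc => cechProj_mem_coboundaries 𝒜 f hD i α hc

theorem isProjections_localCohomologyProj (i : ℕ) :
    IsProjections (localCohomologyPiece 𝒜 f i) (localCohomologyProj 𝒜 f hD i) :=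
  (isProjections_cocycleProj 𝒜 f hD i).map
    ((cechCoboundaries f i).submoduleOf (cechCocycles f i)).mkQ.toAddMonoidHom
    (Submodule.mkQ_surjective _) _ fun _ _ => rfl

theorem smul_mem_localCohomologyPiece {i : ℕ} {α : ℤ} {k : ℕ} {r : R} (hr : r ∈ 𝒜 k)
    {x : LocalCohomology f i} (hx : x ∈ localCohomologyPiece 𝒜 f i α) :
    r • x ∈ localCohomologyPiece 𝒜 f i (α + k) := by
  obtain ⟨c, hc, rfl⟩ := hx
  exact ⟨r • c, fun s hs => smul_mem_localizationPiece 𝒜 hr (hc s hs), rfl⟩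

theorem localCohomologyHom_mem_localCohomologyPiece {φ : R →+* R} (hφ : IsPowerHom φ) (k : ℕ)
    (hk : ∀ r, φ r = r ^ (k + 1)) {i : ℕ} {α : ℤ}
    {x : LocalCohomology f i} (hx : x ∈ localCohomologyPiece 𝒜 f i α) :
    localCohomologyHom hφ f i x ∈ localCohomologyPiece 𝒜 f i (((k + 1 : ℕ) : ℤ) * α) := by
  obtain ⟨c, hc, rfl⟩ := hx
  exact ⟨cocycleHom hφ f i c, fun s hs => locHom_mem_localizationPiece 𝒜 hφ k hk (hc s hs), rfl⟩

end Grading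

/-! ### Graded modules with a Frobenius action: the two degree arguments. -/

section GradedModule

open DirectSum

variable {K : Type v} {R : Type u} [Field K] [CommRing R] [Algebra K R]
  (𝒜 : ℕ → Submodule K R) [GradedAlgebra 𝒜]
  {H : Type w} [AddCommGroup H] [Module R H] {N : ℤ → AddSubgroup H} {π : ℤ → H →+ H}

/-- The scalar multiplication of `R` on `H` is compatible with the gradings. -/
def IsGradedSMul (N : ℤ → AddSubgroup H) : Prop :=
  ∀ {α : ℤ} {k : ℕ} {r : R} {x : H}, r ∈ 𝒜 k → x ∈ N α → r • x ∈ N (α + k)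

variable {𝒜} (hN : IsProjections N π) (hs : IsGradedSMul 𝒜 N)
include hN hs

omit [GradedAlgebra 𝒜] in
theorem proj_homogeneous_smul {k : ℕ} {r : R} (hr : r ∈ 𝒜 k) (β : ℤ) (x : H) :
    π β (r • x) = r • π (β - k) x := by
  induction x using hN.induction with
  | hom α x hx =>
    by_cases h : β = α + k
    · subst h
      rw [add_sub_cancel_right, hN.apply_self hx, hN.apply_self (hs hr hx)]
    · rw [hN.apply_of_ne (hs hr hx) h, hN.apply_of_ne hx fun h' => h (by omega), smul_zero]
  | add x y hx hy => simp only [smul_add, map_add, hx, hy]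

/-- Scalars have nonnegative degree, so the degree β part of r • x sees only components of x of
degree at most β. -/
theorem proj_smul_of_lt (r : R) {β : ℤ} {x : H} (hx : ∀ γ ≤ β, π γ x = 0) : π β (r • x) = 0 := by
  induction r using DirectSum.Decomposition.inductionOn 𝒜 with
  | zero => simp
  | homogeneous r =>
    rw [proj_homogeneous_smul hN hs r.2, hx _ (by omega), smul_zero]
  | add r r' hr hr' => rw [add_smul, map_add, hr, hr', add_zero]

theorem proj_smul_of_mem (r : R) {α : ℤ} {x : H} (hx : x ∈ N α) (n : ℕ) :
    π (α + n) (r • x) = (decompose 𝒜 r n : R) • x := by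
  classical
  induction r using DirectSum.Decomposition.inductionOn 𝒜 with
  | zero => simp
  | homogeneous r =>
    rename_i i
    rw [proj_homogeneous_smul hN hs r.2, decompose_coe, coe_of_apply]
    split_ifs with h
    · subst h
      rw [add_sub_cancel_right, hN.apply_self hx]
    · rw [hN.apply_of_ne hx (by omega), smul_zero, Submodule.coe_zero, zero_smul]
  | add r r' hr hr' =>
    rw [add_smul, map_add, hr, hr', decompose_add, DirectSum.add_apply, Submodule.coe_add, add_smul]

/-- The submodule of the elements all of whose components have degree at least `k`. -/
def geSubmodule (k : ℤ) : Submodule R H where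
  carrier := {x | ∀ β < k, π β x = 0}
  zero_mem' β _ := map_zero _
  add_mem' hx hy β hβ := by rw [map_add, hx β hβ, hy β hβ, add_zero]
  smul_mem' r _ hx β hβ := proj_smul_of_lt hN hs r fun γ hγ => hx γ (hγ.trans_lt hβ)

/-- A nonzero graded Artinian module has a largest degree. -/
theorem exists_isGreatest_degree [IsArtinian R H] [Nontrivial H] :
    ∃ a, IsGreatest {α : ℤ | N α ≠ ⊥} a := by
  -- The submodules of elements of degree at least k stabilize, and an element of the stable one has
  -- no component in any degree.
  obtain ⟨n, hn⟩ := exists_stable_of_antitone (fun k : ℕ => geSubmodule hN hs (k : ℤ))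
    fun i j hij x hx β hβ => hx β (hβ.trans_le (by exact_mod_cast hij))
  have hbot : ∀ x ∈ geSubmodule hN hs (n : ℤ), x = 0 := by
    intro x hx
    refine hN.eq_zero fun α => ?_
    have : x ∈ geSubmodule hN hs (max n (α + 1).toNat : ℕ) := by
      rw [hn _ (le_max_left _ _)]; exact hx
    exact this α (by omega)
  have hbdd : ∀ α ∈ {α : ℤ | N α ≠ ⊥}, α ≤ n := by
    intro α hα
    by_contra! hlt
    refine hα ((AddSubgroup.eq_bot_iff_forall _).2 fun x hx => hbot x fun β hβ => ?_)
    exact hN.apply_of_ne hx (by omega)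
  have hne : ∃ α, α ∈ {α : ℤ | N α ≠ ⊥} := by
    by_contra! h
    obtain ⟨x, hx⟩ := exists_ne (0 : H)
    refine hx (hN.eq_zero fun α => ?_)
    have hα : N α = ⊥ := by simpa using h α
    simpa [hα] using hN.apply_mem α x
  obtain ⟨a, ha, ha'⟩ := Int.exists_greatest_of_bdd ⟨n, hbdd⟩ hne
  exact ⟨a, ha, ha'⟩

theorem smul_eq_zero_of_isGreatest {a : ℤ} (ha : ∀ α, a < α → N α = ⊥) {x : H} (hx : x ∈ N a)
    {r : R} (hr : r ∈ irrelevantIdeal 𝒜) : r • x = 0 := by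
  refine hN.eq_zero fun β => ?_
  rcases le_or_gt β a with hβ | hβ
  · rcases hβ.lt_or_eq with hβ | rfl
    · exact proj_smul_of_lt hN hs r fun γ hγ => hN.apply_of_ne hx (by omega)
    · have := proj_smul_of_mem hN hs r hx 0
      rw [Nat.cast_zero, add_zero] at this
      rw [this]
      have hr0 : (decompose 𝒜 r 0 : R) = 0 := hr
      rw [hr0, zero_smul]
  · simpa [ha β hβ] using hN.apply_mem β (r • x)

/-- The submodule spanned by the images under `F` of the homogeneous elements of degree at
least `k`. -/
def spanImage (R : Type u) {H : Type w} [CommRing R] [AddCommGroup H] [Module R H]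
    (N : ℤ → AddSubgroup H) (F : H → H) (k : ℤ) : Submodule R H :=
  Submodule.span R {x | ∃ β ≥ k, ∃ y ∈ N β, F y = x}

omit hN hs in
theorem spanImage_antitone (F : H → H) : Antitone (spanImage R N F) := fun _ _ hkl =>
  Submodule.span_mono fun _ ⟨β, hβ, y⟩ => ⟨β, hkl.trans hβ, y⟩

section SpanImage

variable {φ : R →+* R} {F : H →ₛₗ[φ] H} {q : ℕ} (hF : ∀ {β : ℤ} {y : H}, y ∈ N β → F y ∈ N (q * β))

-- Semilinearity moves φ(m) inside, φ(m)F(y) = F(my), and m ∈ 𝔪 raises the degree of y by at least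
-- one.
omit hN in
theorem smul_mem_spanImage {r : R} (hr : r ∈ (irrelevantIdeal 𝒜).map φ) {k : ℤ} {y : H}
    (hy : y ∈ N k) : r • F y ∈ spanImage R N F (k + 1) := by
  classical
  rw [Ideal.map] at hr
  induction hr using Submodule.span_induction with
  | mem r hr =>
    obtain ⟨m, hm, rfl⟩ := hr
    rw [← map_smulₛₗ, ← DirectSum.sum_support_decompose 𝒜 m, Finset.sum_smul, map_sum]
    refine Submodule.sum_mem _ fun i _ => ?_
    rcases Nat.eq_zero_or_pos i with rfl | hi
    · have hm0 : (decompose 𝒜 m 0 : R) = 0 := hm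
      rw [hm0, zero_smul, map_zero]
      exact Submodule.zero_mem _
    · exact Submodule.subset_span ⟨k + i, by omega, _, hs (SetLike.coe_mem _) hy, rfl⟩
  | zero => rw [zero_smul]; exact Submodule.zero_mem _
  | add r s _ _ hr hs => rw [add_smul]; exact Submodule.add_mem _ hr hs
  | smul t r _ hr => rw [smul_eq_mul, mul_smul]; exact Submodule.smul_mem _ _ hr

include hF

/-- Only the component of r of degree a - qβ carries F(y), y of degree β, into degree a. For β > k
there is nothing to do; for β = k that component lies in φ(𝔪)R and can be traded for a larger β. -/
theorem proj_mem_spanImage {a k : ℤ}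
    (hJ : ∀ {n : ℕ} {r : R}, r ∈ 𝒜 n → a - q * k ≤ n → r ∈ (irrelevantIdeal 𝒜).map φ)
    {x : H} (hx : x ∈ spanImage R N F k) : π a x ∈ spanImage R N F (k + 1) := by
  -- The projection is not R-linear, so the induction on the span needs the claim for all multiples
  -- of x.
  suffices h : ∀ r : R, π a (r • x) ∈ spanImage R N F (k + 1) by simpa using h 1
  induction hx using Submodule.span_induction with
  | mem x hx =>
    obtain ⟨β, hβ, y, hy, rfl⟩ := hx
    intro r
    rcases lt_or_ge a (q * β) with h | h
    · rw [proj_smul_of_lt hN hs r fun γ hγ => hN.apply_of_ne (hF hy) (by omega)]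
      exact Submodule.zero_mem _
    · obtain ⟨n, hn⟩ := Int.eq_ofNat_of_zero_le (sub_nonneg.2 h)
      rw [show a = q * β + n by omega, proj_smul_of_mem hN hs r (hF hy)]
      rcases hβ.lt_or_eq with hlt | rfl
      · exact Submodule.smul_mem _ _ (Submodule.subset_span ⟨β, hlt, y, hy, rfl⟩)
      · exact smul_mem_spanImage hs (hJ (SetLike.coe_mem _) hn.le) hy
  | zero => intro r; rw [smul_zero, map_zero]; exact Submodule.zero_mem _
  | add x y _ _ hx hy =>
    intro r; rw [smul_add, map_add]; exact Submodule.add_mem _ (hx r) (hy r)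
  | smul t x _ hx => intro r; rw [smul_smul]; exact hx _

/-- If `H` is spanned by the image of `F`, then it vanishes in degree `a` as soon as it vanishes in
larger degrees and `R` and `φ(𝔪)R` agree in the degrees from `a - q a` on. -/
theorem eq_bot_of_span {a : ℤ} (ha : ∀ α, a < α → N α = ⊥)
    (hspan : ∀ x : H, ∃ (m : ℕ) (s : Fin m → R) (y : Fin m → H), x = ∑ j, s j • F (y j))
    (hJ : ∀ {n : ℕ} {r : R}, r ∈ 𝒜 n → a - q * a ≤ n → r ∈ (irrelevantIdeal 𝒜).map φ) :
    N a = ⊥ := by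
  have hstart : ∀ x : H, ∃ k : ℤ, x ∈ spanImage R N F k := by
    have hadd : ∀ x y : H, (∃ k : ℤ, x ∈ spanImage R N F k) → (∃ k : ℤ, y ∈ spanImage R N F k) →
        ∃ k : ℤ, x + y ∈ spanImage R N F k := by
      rintro x y ⟨k, hk⟩ ⟨l, hl⟩
      exact ⟨min k l, Submodule.add_mem _ (spanImage_antitone F (min_le_left _ _) hk)
        (spanImage_antitone F (min_le_right _ _) hl)⟩
    intro x
    obtain ⟨m, s, y, rfl⟩ := hspan x
    refine Finset.sum_induction _ (fun x => ∃ k : ℤ, x ∈ spanImage R N F k) hadd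
      ⟨0, Submodule.zero_mem _⟩ fun j _ => ?_
    suffices h : ∃ k : ℤ, F (y j) ∈ spanImage R N F k by
      obtain ⟨k, hk⟩ := h
      exact ⟨k, Submodule.smul_mem _ _ hk⟩
    generalize y j = z
    induction z using hN.induction with
    | hom β z hz => exact ⟨β, Submodule.subset_span ⟨β, le_rfl, z, hz, rfl⟩⟩
    | add z z' hz hz' => rw [map_add]; exact hadd _ _ hz hz'
  have hbot : spanImage R N F (a + 1) = ⊥ := by
    refine Submodule.span_eq_bot.2 ?_
    rintro _ ⟨β, hβ, y, hy, rfl⟩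
    rw [ha β (by omega)] at hy
    rw [AddSubgroup.mem_bot.1 hy, map_zero]
  refine (AddSubgroup.eq_bot_iff_forall _).2 fun x hx => ?_
  obtain ⟨k, hk⟩ := hstart x
  -- The level rises by one until it reaches a + 1, where the span is zero. The degree hypothesis
  -- `hJ` serves every level k ≤ a because a - qa ≤ a - qk.
  have hall : ∀ i : ℕ, x ∈ spanImage R N F (min (k + i) (a + 1)) := by
    intro i
    induction i with
    | zero => exact spanImage_antitone F (by simp) hk
    | succ i ih =>
      rcases le_or_gt (a + 1) (k + i) with h | h
      · rw [min_eq_right h] at ih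
        rwa [min_eq_right (by push_cast; omega)]
      · rw [min_eq_left h.le] at ih
        have := proj_mem_spanImage hN hs hF (a := a) (fun {n r} hr hn => hJ hr ?_) ih
        · rw [hN.apply_self hx] at this
          refine spanImage_antitone F ?_ this
          push_cast; omega
        · refine le_trans ?_ hn
          have : (q : ℤ) * (k + i) ≤ q * a := mul_le_mul_of_nonneg_left (by omega) (by positivity)
          omega
  have := hall (a + 1 - k).toNat
  rw [min_eq_right (by omega), hbot] at this
  exact this

end SpanImage

section Injective

variable {p : ℕ} [Fact p.Prime] [CharP R p] {F : H →ₛₗ[frobenius R p] H}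

omit hN hs in
theorem iterate_smul (e : ℕ) (r : R) (x : H) : F^[e] (r • x) = r ^ p ^ e • F^[e] x := by
  induction e with
  | zero => simp
  | succ e ih =>
    rw [Function.iterate_succ_apply', ih, map_smulₛₗ, Function.iterate_succ_apply', frobenius_def,
      ← pow_mul, pow_succ]

omit hN hs in
theorem iterate_mem (hF : ∀ {β : ℤ} {y : H}, y ∈ N β → F y ∈ N (p * β)) (e : ℕ) {β : ℤ} {y : H}
    (hy : y ∈ N β) : F^[e] y ∈ N ((p : ℤ) ^ e * β) := by
  induction e with
  | zero => simpa using hy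
  | succ e ih =>
    rw [Function.iterate_succ_apply', pow_succ', mul_assoc]
    exact hF ih

omit hN hs in
theorem iterate_smul_eq_zero (e : ℕ) {x : H} (hx : ∀ r ∈ irrelevantIdeal 𝒜, r • x = 0) {r : R}
    (hr : r ∈ (irrelevantIdeal 𝒜).map (iterateFrobenius R p e)) : r • F^[e] x = 0 := by
  rw [Ideal.map] at hr
  induction hr using Submodule.span_induction with
  | mem r hr =>
    obtain ⟨m, hm, rfl⟩ := hr
    have h0 : F^[e] (0 : H) = 0 := Function.iterate_fixed (map_zero F) e
    rw [iterateFrobenius_def, ← iterate_smul, hx m hm, h0]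
  | zero => exact zero_smul _ _
  | add r s _ _ hr hs => rw [add_smul, hr, hs, add_zero]
  | smul t r _ hr => rw [smul_eq_mul, mul_smul, hr, smul_zero]

/-- An element of degree `a` killed by `𝔪` vanishes if Frobenius acts injectively and the iterates
of Frobenius move the degree `a` far below the degree range of `R` modulo the Frobenius powers
of `𝔪`. -/
theorem eq_zero_of_injective [IsArtinian R H]
    (hF : ∀ {β : ℤ} {y : H}, y ∈ N β → F y ∈ N (p * β)) (hinj : Function.Injective F)
    {a : ℤ} {x : H} (hxa : x ∈ N a) (hx : ∀ r ∈ irrelevantIdeal 𝒜, r • x = 0) (ν : ℕ → ℕ)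
    (hν : ∀ {e n : ℕ} {r : R}, r ∈ 𝒜 n → ν e < n →
      r ∈ (irrelevantIdeal 𝒜).map (iterateFrobenius R p e))
    (hlim : ∀ e : ℕ, ∃ e' : ℕ, ∀ j ≥ e', (p : ℤ) ^ j * a + ν j < p ^ e * a) : x = 0 := by
  -- By the descending chain condition, for this e the element Fᵉx lies in the span of the Fʲx with
  -- j as large as desired.
  obtain ⟨e, he⟩ := exists_stable_of_antitone
    (fun e : ℕ => Submodule.span R {y | ∃ j ≥ e, F^[j] x = y})
    fun _ _ hkl => Submodule.span_mono fun _ ⟨β, hβ, y⟩ => ⟨β, hkl.trans hβ, y⟩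
  obtain ⟨e', he'⟩ := hlim e
  have hmem : F^[e] x ∈ Submodule.span R {y | ∃ j ≥ max e e', F^[j] x = y} := by
    rw [he _ (le_max_left _ _)]
    exact Submodule.subset_span ⟨e, le_rfl, rfl⟩
  -- To reach degree pᵉa from Fʲx takes a scalar of degree pᵉa - pʲa > ν j. Such a scalar lies in
  -- the j-th Frobenius power of 𝔪, which kills Fʲx.
  have hvanish : ∀ z ∈ Submodule.span R {y | ∃ j ≥ max e e', F^[j] x = y},
      ∀ r : R, π ((p : ℤ) ^ e * a) (r • z) = 0 := by
    intro z hz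
    induction hz using Submodule.span_induction with
    | mem z hz =>
      obtain ⟨j, hj, rfl⟩ := hz
      intro r
      have hlt := he' j ((le_max_right _ _).trans hj)
      obtain ⟨n, hn⟩ := Int.eq_ofNat_of_zero_le
        (show 0 ≤ (p : ℤ) ^ e * a - p ^ j * a by omega)
      rw [show (p : ℤ) ^ e * a = p ^ j * a + n by omega,
        proj_smul_of_mem hN hs r (iterate_mem (N := N) hF j hxa)]
      exact iterate_smul_eq_zero j hx (hν (SetLike.coe_mem _) (by omega))
    | zero => intro r; rw [smul_zero, map_zero]
    | add x y _ _ hx hy => intro r; rw [smul_add, map_add, hx, hy, add_zero]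
    | smul t x _ hx => intro r; rw [smul_smul]; exact hx _
  have h0 := hvanish _ hmem 1
  rw [one_smul, hN.apply_self (iterate_mem (N := N) hF e hxa)] at h0
  refine hinj.iterate e ?_
  rw [h0, Function.iterate_fixed (map_zero F) e]

end Injective

end GradedModule

open DirectSum

/-! ### Standard graded algebras: finiteness and powers of the irrelevant ideal. -/

section StandardGraded

variable {K : Type v} {R : Type u} [Field K] [CommRing R] [Algebra K R]
  {𝒜 : ℕ → Submodule K R} [GradedAlgebra 𝒜] (hstd : IsStandardGraded 𝒜)

namespace IsStandardGraded

include hstd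

theorem finiteType : Algebra.FiniteType K R := by
  have := hstd.finite_degree_one
  obtain ⟨s, hs⟩ := (Module.Finite.iff_fg (N := 𝒜 1)).1 this
  refine ⟨s, ?_⟩
  rw [← hstd.adjoin_degree_one, ← hs, Algebra.adjoin_span]

theorem isNoetherianRing : IsNoetherianRing R :=
  have := hstd.finiteType
  Algebra.FiniteType.isNoetherianRing K R

theorem isUnit_of_mem_zero {r : R} (hr : r ∈ 𝒜 0) (h0 : r ≠ 0) : IsUnit r := by
  rw [hstd.degree_zero] at hr
  obtain ⟨k, rfl⟩ := Submodule.mem_one.1 hr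
  exact (IsUnit.mk0 k fun hk => h0 (by rw [hk, map_zero])).map _

theorem isMaximal_irrelevantIdeal : (irrelevantIdeal 𝒜).IsMaximal := by
  have := hstd.nontrivial
  refine Ideal.isMaximal_iff.2 ⟨fun h => ?_, fun I x hI hx hxI => ?_⟩
  · have h0 : (decompose 𝒜 (1 : R) 0 : R) = 0 := h
    rw [decompose_of_mem_same 𝒜 SetLike.GradedOne.one_mem] at h0
    exact one_ne_zero h0
  · have hu := hstd.isUnit_of_mem_zero (SetLike.coe_mem (decompose 𝒜 x 0)) fun h => hx h
    have hsub : x - (decompose 𝒜 x 0 : R) ∈ irrelevantIdeal 𝒜 := by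
      change (decompose 𝒜 _ 0 : R) = 0
      rw [decompose_sub, DirectSum.sub_apply, Submodule.coe_sub,
        decompose_of_mem_same 𝒜 (SetLike.coe_mem (decompose 𝒜 x 0)), sub_self]
    have hmem : (decompose 𝒜 x 0 : R) ∈ I := by
      simpa using I.sub_mem hxI (hI hsub)
    rw [I.eq_top_of_isUnit_mem hmem hu]
    exact Submodule.mem_top

/-- Generation in degree one is essential here. It turns `nu`, defined by powers of 𝔪, into a bound
on the degrees of R modulo the Frobenius powers of 𝔪. -/
theorem mem_irrelevantIdeal_pow {n : ℕ} {r : R} (hr : r ∈ 𝒜 n) : r ∈ irrelevantIdeal 𝒜 ^ n := by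
  classical
  suffices h : ∀ r ∈ Algebra.adjoin K (𝒜 1 : Set R), ∀ n : ℕ,
      (decompose 𝒜 r n : R) ∈ irrelevantIdeal 𝒜 ^ n by
    have := h r (by rw [hstd.adjoin_degree_one]; exact Algebra.mem_top) n
    rwa [decompose_of_mem_same 𝒜 hr] at this
  intro r hr
  induction hr using Algebra.adjoin_induction with
  | mem x hx =>
    intro n
    by_cases h : n = 1
    · subst h
      rw [decompose_of_mem_same 𝒜 hx, pow_one]
      exact HomogeneousIdeal.mem_irrelevant_of_mem 𝒜 one_pos hx
    · rw [decompose_of_mem_ne 𝒜 hx (Ne.symm h)]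
      exact Ideal.zero_mem _
  | algebraMap k =>
    intro n
    by_cases h : n = 0
    · subst h
      rw [pow_zero, Ideal.one_eq_top]
      exact Submodule.mem_top
    · rw [decompose_of_mem_ne 𝒜 (SetLike.algebraMap_mem_graded 𝒜 k) (Ne.symm h)]
      exact Ideal.zero_mem _
  | add x y _ _ hx hy =>
    intro n
    rw [decompose_add, DirectSum.add_apply, Submodule.coe_add]
    exact Ideal.add_mem _ (hx n) (hy n)
  | mul x y _ _ hx hy =>
    intro n
    rw [decompose_mul, coe_mul_apply_eq_sum_antidiagonal]
    refine Ideal.sum_mem _ fun ij hij => ?_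
    rw [← Finset.HasAntidiagonal.mem_antidiagonal.1 hij, pow_add]
    exact Ideal.mul_mem_mul (hx _) (hy _)

end IsStandardGraded

end StandardGraded

/-! ### Bounds for ν and existence of the diagonal F-threshold. -/

section Nu

/-- A pigeonhole principle: one ideal must occur q times in each product. The extra 1 keeps the
exponent positive when `s` is empty. -/
theorem sup_pow_le {R : Type u} [CommSemiring R] {ι : Type*} (s : Finset ι) (I : ι → Ideal R)
    (q : ℕ) : s.sup I ^ (s.card * q + 1) ≤ s.sup fun i => I i ^ q := by
  classical
  induction s using Finset.induction_on with
  | empty => simp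
  | insert a s ha ih =>
    rw [Finset.sup_insert, Finset.sup_insert, Finset.card_insert_of_notMem ha,
      show (s.card + 1) * q + 1 = q + (s.card * q + 1) by ring]
    exact Ideal.sup_pow_add_le_pow_sup_pow.trans (sup_le_sup_left ih _)

theorem span_range_pow_le {R : Type u} [CommRing R] (p : ℕ) [Fact p.Prime] [CharP R p] {n : ℕ}
    (f : Fin n → R) (e : ℕ) :
    Ideal.span (Set.range f) ^ (n * p ^ e + 1) ≤
      (Ideal.span (Set.range f)).map (iterateFrobenius R p e) := by
  have hsup : Ideal.span (Set.range f) = Finset.univ.sup fun j => Ideal.span {f j} := by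
    rw [Finset.sup_univ_eq_iSup, ← Ideal.span_iUnion, Set.iUnion_singleton_eq_range]
  have h := sup_pow_le Finset.univ (fun j => Ideal.span {f j}) (p ^ e)
  rw [← hsup, Finset.card_univ, Fintype.card_fin] at h
  refine h.trans (Finset.sup_le fun j _ => ?_)
  rw [Ideal.span_singleton_pow, Ideal.span_singleton_le_iff_mem, ← iterateFrobenius_def]
  exact Ideal.mem_map_of_mem _ (Ideal.subset_span ⟨j, rfl⟩)

variable {K : Type v} {R : Type u} [Field K] [CommRing R] [Algebra K R]
  {𝒜 : ℕ → Submodule K R} [GradedAlgebra 𝒜] (hstd : IsStandardGraded 𝒜)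
  (p : ℕ) [Fact p.Prime] [CharP R p] {n : ℕ} {f : Fin n → R}
  (hspan : Ideal.span (Set.range f) = irrelevantIdeal 𝒜)

-- Boundedness makes the `sSup` in `nu` a genuine supremum rather than the default value 0, and
-- bounds ν(pᵉ)/pᵉ by the number of generators.
include hspan in
theorem mem_upperBounds_nu (e : ℕ) :
    n * p ^ e ∈ upperBounds
      {r : ℕ | ¬ irrelevantIdeal 𝒜 ^ r ≤ (irrelevantIdeal 𝒜).map (iterateFrobenius R p e)} := by
  intro r hr
  by_contra! hlt
  refine hr ((Ideal.pow_le_pow_right hlt).trans ?_)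
  rw [← hspan]
  exact span_range_pow_le p f e

theorem map_iterateFrobenius_le (I : Ideal R) (e : ℕ) : I.map (iterateFrobenius R p e) ≤ I := by
  rw [Ideal.map_le_iff_le_comap]
  intro x hx
  rw [Ideal.mem_comap, iterateFrobenius_def]
  exact I.pow_mem_of_mem hx _ (pow_pos (Fact.out : p.Prime).pos _)

include hspan in
theorem pow_le_of_nu_lt {e r : ℕ} (hr : nu 𝒜 p e < r) :
    irrelevantIdeal 𝒜 ^ r ≤ (irrelevantIdeal 𝒜).map (iterateFrobenius R p e) := by
  by_contra h
  exact hr.not_ge (le_csSup ⟨_, mem_upperBounds_nu p hspan e⟩ h)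

include hstd in
theorem not_irrelevantIdeal_pow_zero_le (e : ℕ) :
    ¬ irrelevantIdeal 𝒜 ^ 0 ≤ (irrelevantIdeal 𝒜).map (iterateFrobenius R p e) := by
  intro h
  rw [pow_zero, Ideal.one_eq_top] at h
  exact hstd.isMaximal_irrelevantIdeal.ne_top
    (top_le_iff.1 (h.trans (map_iterateFrobenius_le p _ e)))

include hstd hspan in
theorem not_irrelevantIdeal_pow_nu_le (e : ℕ) :
    ¬ irrelevantIdeal 𝒜 ^ nu 𝒜 p e ≤ (irrelevantIdeal 𝒜).map (iterateFrobenius R p e) :=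
  Nat.sSup_mem (s := {r : ℕ |
      ¬ irrelevantIdeal 𝒜 ^ r ≤ (irrelevantIdeal 𝒜).map (iterateFrobenius R p e)})
    ⟨0, not_irrelevantIdeal_pow_zero_le hstd p e⟩ ⟨_, mem_upperBounds_nu p hspan e⟩

include hstd hspan in
theorem nu_le (e : ℕ) : nu 𝒜 p e ≤ n * p ^ e :=
  mem_upperBounds_nu p hspan e (not_irrelevantIdeal_pow_nu_le hstd p hspan e)

include hstd hspan in
theorem mem_map_of_nu_lt {e k : ℕ} {r : R} (hr : r ∈ 𝒜 k) (hk : nu 𝒜 p e < k) :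
    r ∈ (irrelevantIdeal 𝒜).map (iterateFrobenius R p e) :=
  pow_le_of_nu_lt p hspan hk (hstd.mem_irrelevantIdeal_pow hr)

/-- Purity for A/I: the elements of IB annihilate the class of 1 in B ⊗ A/I, and the image of x
applied to it is 1 ⊗ x. -/
theorem IsPureHom.mem_of_mem_map {A B : Type u} [CommRing A] [CommRing B] [Algebra A B]
    (h : IsPureHom (algebraMap A B)) {I : Ideal A} {x : A}
    (hx : algebraMap A B x ∈ I.map (algebraMap A B)) : x ∈ I := by
  have hzero : ∀ b ∈ I.map (algebraMap A B), b ⊗ₜ[A] (Ideal.Quotient.mk I 1) = 0 := by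
    intro b hb
    rw [Ideal.map] at hb
    induction hb using Submodule.span_induction with
    | mem b hb =>
      obtain ⟨y, hy, rfl⟩ := hb
      rw [Algebra.algebraMap_eq_smul_one, TensorProduct.smul_tmul, ← Ideal.Quotient.mk_eq_mk,
        ← Submodule.Quotient.mk_smul, smul_eq_mul, mul_one,
        (Submodule.Quotient.mk_eq_zero I).2 hy, TensorProduct.tmul_zero]
    | zero => exact TensorProduct.zero_tmul _ _
    | add x y _ _ hx hy => rw [TensorProduct.add_tmul, hx, hy, add_zero]
    | smul c x _ hx =>
      rw [← TensorProduct.smul_tmul', hx, smul_zero]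
  rw [← Submodule.Quotient.mk_eq_zero]
  refine h.injective (A ⧸ I) ?_
  have := hzero _ hx
  rw [Algebra.algebraMap_eq_smul_one, TensorProduct.smul_tmul, ← Ideal.Quotient.mk_eq_mk,
    ← Submodule.Quotient.mk_smul, smul_eq_mul, mul_one] at this
  simpa using this

theorem IsFPure.mem_of_pow_mem (h : IsFPure R p) {I : Ideal R} {x : R}
    (hx : x ^ p ∈ I.map (frobenius R p)) : x ∈ I := by
  have hT : IsPureHom (algebraMap R (Twist (frobenius R p))) := h
  exact hT.mem_of_mem_map hx

-- If 𝔪^{pν(pᵉ)} lay in the next Frobenius power, the p-th power of every x ∈ 𝔪^{ν(pᵉ)} would lie in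
-- (𝔪^[pᵉ])^[p], and purity would give x ∈ 𝔪^[pᵉ].
include hstd hspan in
theorem mul_nu_le (hpure : IsFPure R p) (e : ℕ) : p * nu 𝒜 p e ≤ nu 𝒜 p (e + 1) := by
  refine le_csSup ⟨_, mem_upperBounds_nu p hspan (e + 1)⟩ fun hle =>
    not_irrelevantIdeal_pow_nu_le hstd p hspan e fun x hx => hpure.mem_of_pow_mem p ?_
  rw [Ideal.map_map, ← iterateFrobenius_one, ← iterateFrobenius_add, add_comm 1 e]
  refine hle ?_
  rw [mul_comm, pow_mul]
  exact Ideal.pow_mem_pow hx p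

include hstd hspan in
/-- For an `F`-pure ring, the diagonal `F`-threshold exists and is an upper bound for
`ν(pᵉ) / pᵉ`. -/
theorem exists_isDiagonalFThreshold (hpure : IsFPure R p) :
    ∃ c : ℝ, IsDiagonalFThreshold 𝒜 p c ∧ ∀ e, (nu 𝒜 p e : ℝ) / (p : ℝ) ^ e ≤ c := by
  have hp : (0 : ℝ) < p := by exact_mod_cast (Fact.out : p.Prime).pos
  have hmono : Monotone fun e : ℕ => (nu 𝒜 p e : ℝ) / (p : ℝ) ^ e := by
    refine monotone_nat_of_le_succ fun e => ?_
    rw [div_le_div_iff₀ (by positivity) (by positivity), pow_succ]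
    have : (p : ℝ) * nu 𝒜 p e ≤ nu 𝒜 p (e + 1) := by
      exact_mod_cast mul_nu_le hstd p hspan hpure e
    nlinarith [pow_pos hp e]
  have hbdd : BddAbove (Set.range fun e : ℕ => (nu 𝒜 p e : ℝ) / (p : ℝ) ^ e) := by
    refine ⟨n, ?_⟩
    rintro _ ⟨e, rfl⟩
    change (nu 𝒜 p e : ℝ) / (p : ℝ) ^ e ≤ n
    rw [div_le_iff₀ (by positivity)]
    exact_mod_cast nu_le hstd p hspan e
  exact ⟨_, tendsto_atTop_ciSup hmono hbdd, fun e => le_ciSup hbdd e⟩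

end Nu

/-! ### The two inequalities. -/

section Main

variable {K : Type v} {R : Type u} [Field K] [CommRing R] [Algebra K R]

theorem isArtinian_localCohomology [IsNoetherianRing R] {n : ℕ} (f : Fin n → R)
    (hm : (Ideal.span (Set.range f)).IsMaximal) (i : ℕ) : IsArtinian R (LocalCohomology f i) :=
  have := isArtinian_HM f hm i R inferInstance
  isArtinian_of_linearEquiv (localCohomologyEquiv f i)

theorem subsingleton_HM_of_krullDim_lt [IsNoetherianRing R] {n : ℕ} (f : Fin n → R) {d : ℕ}
    (hd : ringKrullDim R = d) (M : Type u) [AddCommGroup M] [Module R M]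
    (hM : Module.Finite R M) : Subsingleton (HM f M (d + 1)) := by
  refine subsingleton_HM_of_coheight_lt f (d + 1) M hM (fun q _ => ?_) (d + 1) le_rfl
  have h : ((Order.coheight q : ℕ∞) : WithBot ℕ∞) ≤ (d : ℕ∞) :=
    (Order.coheight_le_krullDim q).trans hd.le
  have h' : Order.coheight q ≤ (d : ℕ∞) := by exact_mod_cast h
  refine lt_of_le_of_lt h' ?_
  exact_mod_cast Nat.lt_succ_self d

/-- Grothendieck's nonvanishing theorem for the irrelevant ideal. -/
theorem nontrivial_localCohomology [IsNoetherianRing R] {n : ℕ} (f : Fin n → R)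
    (hm : (Ideal.span (Set.range f)).IsMaximal) {d : ℕ} (hd : ringKrullDim R = d)
    (hh : (Ideal.span (Set.range f)).height = d) : Nontrivial (LocalCohomology f d) := by
  have := hm.isPrime
  obtain ⟨l, hl, hlen⟩ := (Ideal.span (Set.range f)).exists_ltSeries_length_eq_height
  have hco : Order.coheight l.head ≤ d := by
    have h : ((Order.coheight l.head : ℕ∞) : WithBot ℕ∞) ≤ (d : ℕ∞) :=
      (Order.coheight_le_krullDim _).trans hd.le
    exact_mod_cast h
  have hlen' : l.length = d := by
    rw [hh] at hlen
    exact_mod_cast hlen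
  have := nontrivial_HM_quotient f hm d l hlen' (by rw [hl]) hco
  have hsub := subsingleton_HM_of_krullDim_lt f hd l.head.asIdeal inferInstance
  -- H^d(R) maps onto H^d(R/p), since H^{d+1} of the ideal p vanishes; here p starts a chain of
  -- length d ending at the maximal ideal.
  obtain ⟨δ, hδ, -⟩ := HM.exists_connecting f l.head.asIdeal.subtype l.head.asIdeal.mkQ
    Subtype.val_injective (LinearMap.exact_subtype_mkQ _) (Submodule.mkQ_surjective _) d
  have hsurj : Function.Surjective (HM.map f l.head.asIdeal.mkQ d) := fun x =>
    (hδ x).1 (Subsingleton.elim _ _)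
  have := hsurj.nontrivial
  exact (localCohomologyEquiv f d).toEquiv.symm.nontrivial

variable {𝒜 : ℕ → Submodule K R} [GradedAlgebra 𝒜] (hstd : IsStandardGraded 𝒜)
  (p : ℕ) [Fact p.Prime] [CharP R p] {n : ℕ} {f : Fin n → R}
  (hf : ∀ j, SetLike.IsHomogeneousElem 𝒜 (f j))
  (hspan : Ideal.span (Set.range f) = irrelevantIdeal 𝒜)

variable (R) in
theorem isPowerHom_iterateFrobenius (e : ℕ) : IsPowerHom (iterateFrobenius R p e) := fun r =>
  ⟨p ^ e - 1, by
    rw [iterateFrobenius_def, Nat.sub_add_cancel (pow_pos (Fact.out : p.Prime).pos _)]⟩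

variable (R) in
theorem isPowerHom_frobenius : IsPowerHom (frobenius R p) := fun r =>
  ⟨p - 1, by rw [frobenius_def, Nat.sub_add_cancel (Fact.out : p.Prime).pos]⟩

theorem IsFFinite.iterateFrobenius (h : IsFFinite R p) (e : ℕ) :
    (iterateFrobenius R p e).Finite := by
  induction e with
  | zero => rw [iterateFrobenius_zero]; exact RingHom.Finite.id R
  | succ e ih =>
    rw [iterateFrobenius_add, iterateFrobenius_one]
    exact ih.comp h

include hstd hf hspan in
theorem exists_isAInvariant (i : ℕ) [Nontrivial (LocalCohomology f i)] :
    ∃ a : ℤ, IsAInvariant 𝒜 f i a := by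
  choose D hD using hf
  have := hstd.isNoetherianRing
  have := isArtinian_localCohomology f (hspan ▸ hstd.isMaximal_irrelevantIdeal) i
  exact exists_isGreatest_degree (isProjections_localCohomologyProj 𝒜 f hD i)
    (fun hr hx => smul_mem_localCohomologyPiece 𝒜 f hr hx)

theorem IsAInvariant.eq_bot {i : ℕ} {a : ℤ} (ha : IsAInvariant 𝒜 f i a) (α : ℤ) (h : a < α) :
    localCohomologyPiece 𝒜 f i α = ⊥ := by
  by_contra hne
  exact h.not_ge (ha.2 hne)

-- If the inequality failed, every form of degree at least a - pᵉa would lie in 𝔪^[pᵉ], and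
-- `eq_bot_of_span` would make degree a vanish.
include hstd hf hspan in
theorem le_nu_of_isAInvariant (hfin : IsFFinite R p) {d : ℕ} (hd : ringKrullDim R = d) {a : ℤ}
    (ha : IsAInvariant 𝒜 f d a) (e : ℕ) : a - (p : ℤ) ^ e * a ≤ nu 𝒜 p e := by
  choose D hD using hf
  have := hstd.isNoetherianRing
  have hq : p ^ e - 1 + 1 = p ^ e := Nat.sub_add_cancel (pow_pos (Fact.out : p.Prime).pos _)
  by_contra! hlt
  refine ha.1 (eq_bot_of_span (isProjections_localCohomologyProj 𝒜 f hD d)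
    (fun hr hx => smul_mem_localCohomologyPiece 𝒜 f hr hx)
    (F := localCohomologyHom (isPowerHom_iterateFrobenius R p e) f d) (q := p ^ e)
    (fun hy => ?_) ha.eq_bot
    (exists_eq_sum_localCohomologyHom _ f (hfin.iterateFrobenius p e) d
      fun M _ _ hM => subsingleton_HM_of_krullDim_lt f hd M hM)
    fun hr hn => mem_map_of_nu_lt hstd p hspan hr ?_)
  · have := localCohomologyHom_mem_localCohomologyPiece 𝒜 f (isPowerHom_iterateFrobenius R p e)
      (p ^ e - 1) (fun r => by rw [iterateFrobenius_def, hq]) hy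
    rwa [hq] at this
  · push_cast at hn
    omega

include hstd hf hspan in
theorem neg_le_lowerDiagonalFThreshold (hfin : IsFFinite R p) {d : ℕ} (hd : ringKrullDim R = d)
    {a : ℤ} (ha : IsAInvariant 𝒜 f d a) :
    ((-(a : ℝ) : ℝ) : EReal) ≤ lowerDiagonalFThreshold 𝒜 p := by
  have hp : (1 : ℝ) < p := by exact_mod_cast (Fact.out : p.Prime).one_lt
  -- The bound a - pᵉa ≤ ν(pᵉ) divided by pᵉ; its left side tends to -a.
  have hlim : Filter.Tendsto (fun e : ℕ => (((a : ℝ) / (p : ℝ) ^ e - a : ℝ) : EReal)) Filter.atTop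
      (nhds ((-(a : ℝ) : ℝ) : EReal)) := by
    rw [EReal.tendsto_coe]
    have := ((tendsto_pow_atTop_atTop_of_one_lt hp).const_div_atTop (a : ℝ)).sub_const (a : ℝ)
    simpa using this
  rw [← hlim.liminf_eq]
  refine Filter.liminf_le_liminf (Filter.Eventually.of_forall fun e => ?_)
  rw [EReal.coe_le_coe_iff, le_div_iff₀ (by positivity), sub_mul,
    div_mul_cancel₀ _ (by positivity), mul_comm]
  exact_mod_cast le_nu_of_isAInvariant hstd p hf hspan hfin hd ha e

-- Were a + c negative, pʲa + ν(pʲ) ≤ pʲ(a + c) would tend to -∞, and `eq_zero_of_injective` would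
-- kill every class of top degree a. The bound by c must hold for every e, as it does because
-- ν(pᵉ)/pᵉ increases.
include hstd hf hspan in
theorem neg_le_of_isFPure (hpure : IsFPure R p) {c : ℝ}
    (hc : ∀ e, (nu 𝒜 p e : ℝ) / (p : ℝ) ^ e ≤ c) {i : ℕ} {a : ℤ} (ha : IsAInvariant 𝒜 f i a) :
    -(a : ℝ) ≤ c := by
  choose D hD using hf
  have := hstd.isNoetherianRing
  have := isArtinian_localCohomology f (hspan ▸ hstd.isMaximal_irrelevantIdeal) i
  have hp : (1 : ℝ) < p := by exact_mod_cast (Fact.out : p.Prime).one_lt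
  have hq : p - 1 + 1 = p := Nat.sub_add_cancel (Fact.out : p.Prime).pos
  by_contra! hlt
  refine ha.1 ((AddSubgroup.eq_bot_iff_forall _).2 fun x hx => ?_)
  have hN := isProjections_localCohomologyProj 𝒜 f hD i
  refine eq_zero_of_injective hN (fun hr hx => smul_mem_localCohomologyPiece 𝒜 f hr hx)
    (F := localCohomologyHom (isPowerHom_frobenius R p) f i) (fun hy => ?_)
    (localCohomologyHom_injective _ f hpure i) hx
    (fun r hr => smul_eq_zero_of_isGreatest hN
      (fun hr hx => smul_mem_localCohomologyPiece 𝒜 f hr hx) ha.eq_bot hx hr) (nu 𝒜 p)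
    (fun hr hn => mem_map_of_nu_lt hstd p hspan hr hn) fun e => ?_
  · have := localCohomologyHom_mem_localCohomologyPiece 𝒜 f (isPowerHom_frobenius R p)
      (p - 1) (fun r => by rw [frobenius_def, hq]) hy
    rwa [hq] at this
  · have hneg : (a : ℝ) + c < 0 := by linarith
    have hlim := (tendsto_pow_atTop_atTop_of_one_lt hp).atTop_mul_const_of_neg hneg
    obtain ⟨e', he'⟩ := Filter.eventually_atTop.1
      (hlim.eventually_lt_atBot ((p : ℝ) ^ e * a))
    refine ⟨e', fun j hj => ?_⟩
    have h1 := he' j hj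
    have h2 := hc j
    rw [div_le_iff₀ (by positivity)] at h2
    have h3 : (p : ℝ) ^ j * a + nu 𝒜 p j < (p : ℝ) ^ e * a := by nlinarith
    exact_mod_cast h3

end Main

end FThreshold

theorem theorem4p6 {K : Type*} {R : Type*} [Field K] [CommRing R] [Algebra K R]
    (p : ℕ) [Fact p.Prime] [CharP R p]
    (𝒜 : ℕ → Submodule K R) [GradedAlgebra 𝒜]
    (hstd : FThreshold.IsStandardGraded 𝒜) (hfin : FThreshold.IsFFinite R p)
    (d : ℕ) (hd : ringKrullDim R = d)
    {n : ℕ} (f : Fin n → R) (hf : ∀ j, SetLike.IsHomogeneousElem 𝒜 (f j))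
    (hspan : Ideal.span (Set.range f) = FThreshold.irrelevantIdeal 𝒜) :
    (∃ a : ℤ, FThreshold.IsAInvariant 𝒜 f d a ∧
      ((-(a : ℝ) : ℝ) : EReal) ≤ FThreshold.lowerDiagonalFThreshold 𝒜 p) ∧
    (FThreshold.IsFPure R p →
      ∃ c : ℝ, FThreshold.IsDiagonalFThreshold 𝒜 p c ∧
        ∀ i : ℕ, Nontrivial (FThreshold.LocalCohomology f i) →
          ∃ a : ℤ, FThreshold.IsAInvariant 𝒜 f i a ∧ -(a : ℝ) ≤ c) := by
  have := hstd.isNoetherianRing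
  have hmax := hstd.isMaximal_irrelevantIdeal
  have hheight : (Ideal.span (Set.range f)).height = d := by
    rw [hspan]
    exact FThreshold.height_irrelevantIdeal 𝒜 hmax (fun _ => hstd.isUnit_of_mem_zero) hd
  have := FThreshold.nontrivial_localCohomology f (hspan ▸ hmax) hd hheight
  refine ⟨?_, fun hpure => ?_⟩
  · obtain ⟨a, ha⟩ := FThreshold.exists_isAInvariant hstd hf hspan d
    exact ⟨a, ha, FThreshold.neg_le_lowerDiagonalFThreshold hstd p hf hspan hfin hd ha⟩
  · obtain ⟨c, hc, hle⟩ := FThreshold.exists_isDiagonalFThreshold hstd p hspan hpure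
    refine ⟨c, hc, fun i _ => ?_⟩
    obtain ⟨a, ha⟩ := FThreshold.exists_isAInvariant hstd hf hspan i
    exact ⟨a, ha, FThreshold.neg_le_of_isFPure hstd p hf hspan hpure hle ha⟩
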